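/- Let $T>0$ and consider the optimal control problem (P): minimize $\varphi_0(x_0,x_T)$ subject to \[ \dot x_t=F(x_t,u_t,v_t):=f_0(x_t,u_t)+\sum_{i=1}^m v_{i,t}f_i(x_t,u_t)\ \text{ for a.e. } t\in[0,T], \] $\eta_j(x_0,x_T)=0$ for $j=1,\dots,d_\eta$, and $\varphi_i(x_0,x_T)\le 0$ for $i=1,\dots,d_\varphi$, over $x\in W^{1,\infty}(0,T;\mathbb R^n)$, $u\in L^\infty(0,T;\mathbb R^l)$, $v\in L^\infty(0,T;\mathbb R^m)$. The functions $f_i:\mathbb R^{n+l}\to\mathbb R^n$ and $\varphi_i,\eta_j:\mathbb R^{2n}\to\mathbb R$ are of class $C^2$ with (locally) Lipschitz second derivatives. Let $\hat w=(\hat x,\hat u,\hat v)$ be a weak minimum of (P): it is feasible and, for some $\varepsilon>0$, has the least cost among all feasible $(x,u,v)$ with $\|x-\hat x\|_\infty,\|u-\hat u\|_\infty,\|v-\hat v\|_\infty<\varepsilon$. Assume that $\hat u$ and $\hat v$ are smooth on $[0,T]$ (class $C^1$ is enough) and that $\varphi_i(\hat x_0,\hat x_T)=0$ for $i=1,\dots,d_\varphi$.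 For a row vector $p$ put $H(p,x,u,v)=p\,F(x,u,v)$, and put $\ell=\sum_{i=0}^{d_\varphi}\alpha_i\varphi_i+\sum_{j=1}^{d_\eta}\beta_j\eta_j$. A Lagrange multiplier associated with $\hat w$ is a triple $(\alpha,\beta,p)\in\mathbb R^{d_\varphi+1,*}\times\mathbb R^{d_\eta,*}\times W^{1,\infty}(0,T;\mathbb R^{n,*})$ such that $|\alpha|+|\beta|=1$, $\alpha\ge 0$, $-\dot p_t=H_x(p_t,\hat x_t,\hat u_t,\hat v_t)$ a.e. on $[0,T]$, $p_0=-D_{x_0}\ell(\hat x_0,\hat x_T)$, $p_T=D_{x_T}\ell(\hat x_0,\hat x_T)$, and $H_u=0$, $H_v=0$ along $\hat w$ a.e. on $[0,T]$. Assume that $\hat w$ has exactly one Lagrange multiplier $(\alpha,\beta,p)$. With all derivatives evaluated along $(\hat w,p)$ at time $t$ (so that $H_{vx}$ is the $m\times n$ matrix with rows $p\,\partial f_i/\partial x$, and $F_v$ is the $n\times m$ matrix with columns $f_i$), set \[ B=F_xF_v-\tfrac{d}{dt}F_v,\qquad E=F_v^\top H_{ux}^\top-H_{vx}F_u, \] \[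 S=\tfrac12\big(H_{vx}F_v+(H_{vx}F_v)^\top\big),\qquad V=\tfrac12\big(H_{vx}F_v-(H_{vx}F_v)^\top\big), \] \[ R=F_v^\top H_{xx}F_v-\big(H_{vx}B+(H_{vx}B)^\top\big)-\dot S, \] and let $[f_i,f_j]^x=(D_xf_i)f_j-(D_xf_j)f_i$. Then, for every $t\in[0,T]$: (i) $V=0$; equivalently, $H_{vx}F_v$ is symmetric; equivalently, $p\,[f_i,f_j]^x=0$ for all $i,j=1,\dots,m$; (ii) the symmetric matrix $\begin{pmatrix}H_{uu}&E^\top\\ E&R\end{pmatrix}$ is positive semidefinite. -/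

import Mathlib

open Set MeasureTheory

noncomputable section

namespace SingularOC

/-- `ℝ^k` with its Euclidean norm. -/
abbrev Vec (k : ℕ) : Type := EuclideanSpace ℝ (Fin k)

/-- `ℝ^{k,*}`, the space of row vectors, i.e. of linear forms on `ℝ^k`. -/
abbrev RowVec (k : ℕ) : Type := StrongDual ℝ (Vec k)

/-- The `a`-th vector of the standard basis of `ℝ^k`. -/
abbrev stdVec {k : ℕ} (a : Fin k) : Vec k := EuclideanSpace.single a (1 : ℝ)

/-- The data of the optimal control problem: minimize `φ 0 (x 0, x T)` over the solutions of
`x' = f 0 (x, u) + ∑ i, v i • f (i + 1) (x, u)` on `[0, T]` subject to `η j (x 0, x T) = 0` for all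
`j` and `φ i (x 0, x T) ≤ 0` for `i = 1, …, dφ`. -/
structure Problem (n l m dφ dη : ℕ) where
  T : ℝ
  f : Fin (m + 1) → Vec n × Vec l → Vec n
  φ : Fin (dφ + 1) → Vec n × Vec n → ℝ
  η : Fin dη → Vec n × Vec n → ℝ

/-- A triple `w = (x, u, v)` of functions of time (only their values on `[0, T]` matter). -/
structure Triple (n l m : ℕ) where
  x : ℝ → Vec n
  u : ℝ → Vec l
  v : ℝ → Vec m

/-- A function of class `C²` whose second derivative is locally Lipschitz. -/
def HasLipschitzSecondDeriv {X Y : Type*} [NormedAddCommGroup X] [NormedSpace ℝ X]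
    [NormedAddCommGroup Y] [NormedSpace ℝ Y] (g : X → Y) : Prop :=
  ContDiff ℝ 2 g ∧ LocallyLipschitz (iteratedFDeriv ℝ 2 g)

/-- The bracket with respect to `x`: `[g, h]^x = (D_x g) h - (D_x h) g`. -/
def bracketX {n l : ℕ} (g h : Vec n × Vec l → Vec n) (x : Vec n) (u : Vec l) : Vec n :=
  fderiv ℝ (fun x' => g (x', u)) x (h (x, u)) - fderiv ℝ (fun x' => h (x', u)) x (g (x, u))

namespace Problem

variable {n l m dφ dη : ℕ} (P : Problem n l m dφ dη)

/-- All data functions have Lipschitz second derivatives. -/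
def IsRegular : Prop :=
  (∀ i, HasLipschitzSecondDeriv (P.f i)) ∧ (∀ i, HasLipschitzSecondDeriv (P.φ i)) ∧
    ∀ j, HasLipschitzSecondDeriv (P.η j)

/-- Lebesgue measure on `[0, T]`. -/
def timeMeasure : Measure ℝ := volume.restrict (Icc 0 P.T)

/-- The dynamics `F(x, u, v) = ∑_{i=0}^m v_i f_i(x, u)` with `v_0 = 1`. -/
def F (x : Vec n) (u : Vec l) (v : Vec m) : Vec n :=
  P.f 0 (x, u) + ∑ i : Fin m, v i • P.f i.succ (x, u)

/-- Trajectories: `x ∈ W^{1,∞}(0, T)` (that is, `x` is Lipschitz on `[0, T]`), `u, v ∈ L^∞(0, T)`,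
and the state equation holds almost everywhere. -/
def IsTrajectory (w : Triple n l m) : Prop :=
  (∃ K, LipschitzOnWith K w.x (Icc 0 P.T)) ∧
    MemLp w.u ⊤ P.timeMeasure ∧ MemLp w.v ⊤ P.timeMeasure ∧
    ∀ᵐ t ∂P.timeMeasure, HasDerivAt w.x (P.F (w.x t) (w.u t) (w.v t)) t

/-- Feasible trajectories: those satisfying the endpoint constraints. -/
def IsFeasible (w : Triple n l m) : Prop :=
  P.IsTrajectory w ∧ (∀ j, P.η j (w.x 0, w.x P.T) = 0) ∧
    ∀ i : Fin dφ, P.φ i.succ (w.x 0, w.x P.T) ≤ 0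

/-- Weak minimum: `w` is feasible and minimizes the cost among the feasible trajectories that are
close to `w` in the `L^∞` norm, in the state and in both controls. -/
def IsWeakMinimum (w : Triple n l m) : Prop :=
  P.IsFeasible w ∧ ∃ ε : ℝ, 0 < ε ∧ ∀ w' : Triple n l m, P.IsFeasible w' →
    eLpNorm (w'.x - w.x) ⊤ P.timeMeasure < ENNReal.ofReal ε →
    eLpNorm (w'.u - w.u) ⊤ P.timeMeasure < ENNReal.ofReal ε →
    eLpNorm (w'.v - w.v) ⊤ P.timeMeasure < ENNReal.ofReal ε →
    P.φ 0 (w.x 0, w.x P.T) ≤ P.φ 0 (w'.x 0, w'.x P.T)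

/-- The pre-Hamiltonian `H(x, u, v) = p F(x, u, v)`. -/
def H (p : RowVec n) (x : Vec n) (u : Vec l) (v : Vec m) : ℝ := p (P.F x u v)

/-- The endpoint Lagrangian `ℓ = ∑_{i=0}^{dφ} α_i φ_i + ∑_j β_j η_j`. -/
def endpointLagrangian (α : Vec (dφ + 1)) (β : Vec dη) (q : Vec n × Vec n) : ℝ :=
  ∑ i, α i * P.φ i q + ∑ j, β j * P.η j q

/-- `(α, β, p)` is a Lagrange multiplier associated with `w`. There is no complementarity condition
here: the notion is used when all inequality constraints are active at `w`. -/
structure IsMultiplier (w : Triple n l m) (α : Vec (dφ + 1)) (β : Vec dη) (p : ℝ → RowVec n) :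
    Prop where
  lipschitz : ∃ K, LipschitzOnWith K p (Icc 0 P.T)
  nontrivial : ‖α‖ + ‖β‖ = 1
  nonneg : ∀ i, 0 ≤ α i
  costate : ∀ᵐ t ∂P.timeMeasure,
    HasDerivAt p (-fderiv ℝ (fun x => P.H (p t) x (w.u t) (w.v t)) (w.x t)) t
  transversality_zero :
    p 0 = -fderiv ℝ (fun x₀ => P.endpointLagrangian α β (x₀, w.x P.T)) (w.x 0)
  transversality_T :
    p P.T = fderiv ℝ (fun x₁ => P.endpointLagrangian α β (w.x 0, x₁)) (w.x P.T)
  stationarity_u : ∀ᵐ t ∂P.timeMeasure,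
    fderiv ℝ (fun u => P.H (p t) (w.x t) u (w.v t)) (w.u t) = 0
  stationarity_v : ∀ᵐ t ∂P.timeMeasure,
    fderiv ℝ (fun v => P.H (p t) (w.x t) (w.u t) v) (w.v t) = 0

/-- `(α, β, p)` is the only Lagrange multiplier associated with `w` (the costate being a function
on `[0, T]`). -/
def IsUniqueMultiplier (w : Triple n l m) (α : Vec (dφ + 1)) (β : Vec dη) (p : ℝ → RowVec n) :
    Prop :=
  P.IsMultiplier w α β p ∧ ∀ α' β' p', P.IsMultiplier w α' β' p' →
    α' = α ∧ β' = β ∧ EqOn p' p (Icc 0 P.T)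

/-! The matrices of derivatives along `w` and the costate `p`, at time `t`. -/

section Matrices

variable (w : Triple n l m) (p : ℝ → RowVec n) (t : ℝ)

/-- `F_x`, of size `n × n`. -/
def Fx : Matrix (Fin n) (Fin n) ℝ :=
  Matrix.of fun a b => fderiv ℝ (fun x => P.F x (w.u t) (w.v t)) (w.x t) (stdVec b) a

/-- `F_u`, of size `n × l`. -/
def Fu : Matrix (Fin n) (Fin l) ℝ :=
  Matrix.of fun a b => fderiv ℝ (fun u => P.F (w.x t) u (w.v t)) (w.u t) (stdVec b) a

/-- `F_v`, of size `n × m`; its `i`-th column is `f_i(x, u)`. -/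
def Fv : Matrix (Fin n) (Fin m) ℝ :=
  Matrix.of fun a i => fderiv ℝ (fun v => P.F (w.x t) (w.u t) v) (w.v t) (stdVec i) a

/-- `H_xx`, of size `n × n`. -/
def Hxx : Matrix (Fin n) (Fin n) ℝ :=
  Matrix.of fun a b =>
    fderiv ℝ (fun x => fderiv ℝ (fun x' => P.H (p t) x' (w.u t) (w.v t)) x (stdVec b))
      (w.x t) (stdVec a)

/-- `H_ux`, of size `l × n`. -/
def Hux : Matrix (Fin l) (Fin n) ℝ :=
  Matrix.of fun a b =>
    fderiv ℝ (fun u => fderiv ℝ (fun x => P.H (p t) x u (w.v t)) (w.x t) (stdVec b))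
      (w.u t) (stdVec a)

/-- `H_vx`, of size `m × n`. -/
def Hvx : Matrix (Fin m) (Fin n) ℝ :=
  Matrix.of fun i b =>
    fderiv ℝ (fun v => fderiv ℝ (fun x => P.H (p t) x (w.u t) v) (w.x t) (stdVec b))
      (w.v t) (stdVec i)

/-- `H_uu`, of size `l × l`. -/
def Huu : Matrix (Fin l) (Fin l) ℝ :=
  Matrix.of fun a b =>
    fderiv ℝ (fun u => fderiv ℝ (fun u' => P.H (p t) (w.x t) u' (w.v t)) u (stdVec b))
      (w.u t) (stdVec a)

/-- The time derivative on `[0, T]` of a matrix-valued function (one-sided at the endpoints). -/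
def matDeriv {a b : ℕ} (A : ℝ → Matrix (Fin a) (Fin b) ℝ) : Matrix (Fin a) (Fin b) ℝ :=
  Matrix.of fun i j => derivWithin (fun s => A s i j) (Icc 0 P.T) t

/-- `B = F_x F_v - (d/dt) F_v`. -/
def B : Matrix (Fin n) (Fin m) ℝ := P.Fx w t * P.Fv w t - P.matDeriv t (P.Fv w)

/-- `E = F_vᵀ H_uxᵀ - H_vx F_u`. -/
def E : Matrix (Fin m) (Fin l) ℝ :=
  (P.Fv w t).transpose * (P.Hux w p t).transpose - P.Hvx w p t * P.Fu w t

/-- `S = ½ (H_vx F_v + (H_vx F_v)ᵀ)`. -/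
def S : Matrix (Fin m) (Fin m) ℝ :=
  (1 / 2 : ℝ) • (P.Hvx w p t * P.Fv w t + (P.Hvx w p t * P.Fv w t).transpose)

/-- `V = ½ (H_vx F_v - (H_vx F_v)ᵀ)`. -/
def V : Matrix (Fin m) (Fin m) ℝ :=
  (1 / 2 : ℝ) • (P.Hvx w p t * P.Fv w t - (P.Hvx w p t * P.Fv w t).transpose)

/-- `R = F_vᵀ H_xx F_v - (H_vx B + (H_vx B)ᵀ) - (d/dt) S`. -/
def R : Matrix (Fin m) (Fin m) ℝ :=
  (P.Fv w t).transpose * P.Hxx w p t * P.Fv w t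
    - (P.Hvx w p t * P.B w t + (P.Hvx w p t * P.B w t).transpose) - P.matDeriv t (P.S w p)

end Matrices

end Problem

end SingularOC

end

noncomputable section

namespace SingularOC

open Filter Topology Asymptotics

/-! The proof has two halves: a second order necessary condition for processes with continuous
controls, and its localization at a single time.

Second order condition. Take as unknown the initial state together with a continuous function `(x,
u, v)`, and write the state equation in integral form. Its linearization is onto, because linear
Volterra equations are always solvable. Let `M` be the image of the kernel of this linearization
under the derivatives of the endpoint functions. Solving the adjoint equation identifies multipliers
with the annihilators of `M` that have `α ≥ 0`, so uniqueness of the multiplier says that these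
annihilators form a single ray. Finite-dimensional duality draws two consequences. The endpoint
functions become a submersion on the state equation after adding a slack variable for each `i` with
`α i = 0` and one scalar `τ` common to all `i` (`exists_add_slack`). Moreover `M` contains a
direction that strictly decreases the functions with `α i = 0` and leaves the others unchanged
(`exists_pos_slack`). If the second derivative of the Lagrangian were negative in a direction with
zero endpoints, Lyusternik's theorem for the enlarged system would give a curve along which the
Lagrangian equals `-τ ∑ α i`. Negativity forces `τ > 0`, and then all `φ i` decrease strictly while
`η = 0`, contradicting minimality (`second_order_necessary`). Hence `∫ p D²F(z, z) ≥ 0` for all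
linearized trajectories `z` with zero endpoints (`second_variation_nonneg`).

Localization. Since `F` is affine in `v`, the form `p D²F` has no `v`-`v` term. Goh's substitution
`x = ξ + F_v y`, `y' = v`, and an integration by parts turn the functional into the integral of
`q(y, u) + 2 vᵀ V y + 2 H_vu(v, u)` plus terms containing `ξ`, where `q` is the quadratic form of
the matrix in (ii) (`IsNonneg.goh`, `gohForm_eq`). Now compress one profile `(y, v, u)` into `n + 1`
consecutive intervals of length `ε` starting at `t₀`. As `ξ(T)` lies in an `n`-dimensional space,
suitable coefficients `c j` with `∑ c j ^ 2 = 1` make it vanish. The supports are disjoint, so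
blocks do not interact; `ξ = O(ε)` contributes only `O(ε²)`; the terms containing `v` have order `1`
and `q` has order `ε` (`IsNonneg.exists_blockValue_nonneg`). At leading order, well-chosen profiles
give `V = 0` and `H_vu = 0`; at the next order they give `q ≥ 0`. Continuity extends both from the
open interval to `[0, T]`. -/

/-- The composition operator `y ↦ g ∘ y`. -/
def composeLeft {K E F : Type*} [TopologicalSpace K] [TopologicalSpace E] [TopologicalSpace F]
    (g : E → F) (hg : Continuous g) (y : C(K, E)) : C(K, F) :=
  (⟨g, hg⟩ : C(E, F)).comp y

@[simp]
theorem composeLeft_apply {K E F : Type*} [TopologicalSpace K] [TopologicalSpace E]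
    [TopologicalSpace F] (g : E → F) (hg : Continuous g) (y : C(K, E)) (t : K) :
    composeLeft g hg y t = g (y t) := rfl

/-! ### Superposition operators on spaces of continuous functions. -/

section Nemytskii

variable {K E F : Type*} [TopologicalSpace K] [CompactSpace K]
  [NormedAddCommGroup E] [NormedSpace ℝ E] [NormedAddCommGroup F] [NormedSpace ℝ F]

/-- Pointwise application of a continuous family of operators to a continuous function. -/
def pointwiseApply : C(K, E →L[ℝ] F) →L[ℝ] C(K, E) →L[ℝ] C(K, F) :=
  LinearMap.mkContinuous₂
    (LinearMap.mk₂ ℝ (fun (A : C(K, E →L[ℝ] F)) (x : C(K, E)) =>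
        (⟨fun t => A t (x t), A.continuous.clm_apply x.continuous⟩ : C(K, F)))
      (fun _ _ _ => by ext; simp) (fun _ _ _ => by ext; simp)
      (fun _ _ _ => by ext; simp) (fun _ _ _ => by ext; simp)) 1
    (fun A x => by
      rw [ContinuousMap.norm_le _ (by positivity)]
      intro t
      rw [one_mul]
      exact (ContinuousLinearMap.le_opNorm _ _).trans
        (mul_le_mul (A.norm_coe_le_norm t) (x.norm_coe_le_norm t) (norm_nonneg _)
          (norm_nonneg A)))

@[simp]
theorem pointwiseApply_apply (A : C(K, E →L[ℝ] F)) (x : C(K, E)) (t : K) :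
    pointwiseApply A x t = A t (x t) := rfl

/-- The range of `x` is compact, so `fderiv ℝ g` varies by at most `ε` within some fixed distance
`δ` of it. The mean value inequality on the ball around each `x t` is then uniform in `t`. -/
theorem hasStrictFDerivAt_composeLeft {g : E → F} (hg : ContDiff ℝ 1 g) (x : C(K, E)) :
    HasStrictFDerivAt (composeLeft g hg.continuous : C(K, E) → C(K, F))
      (pointwiseApply (composeLeft (fderiv ℝ g) (hg.continuous_fderiv one_ne_zero) x)) x := by
  rw [hasStrictFDerivAt_iff_isLittleO, isLittleO_iff]
  intro ε hε
  have hu := (isCompact_range x.continuous).uniformContinuousAt_of_continuousAt (fderiv ℝ g)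
    (fun a _ => (hg.continuous_fderiv one_ne_zero).continuousAt) (Metric.dist_mem_uniformity hε)
  obtain ⟨δ, hδ, h⟩ := Metric.mem_uniformity_dist.1 hu
  have hb : Metric.ball x δ ×ˢ Metric.ball x δ ∈ 𝓝 (x, x) :=
    prod_mem_nhds (Metric.ball_mem_nhds _ hδ) (Metric.ball_mem_nhds _ hδ)
  filter_upwards [hb] with ⟨y, z⟩ ⟨hy, hz⟩
  rw [ContinuousMap.norm_le _ (by positivity)]
  intro t
  have hyt : y t ∈ Metric.ball (x t) δ := (ContinuousMap.dist_apply_le_dist t).trans_lt hy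
  have hzt : z t ∈ Metric.ball (x t) δ := (ContinuousMap.dist_apply_le_dist t).trans_lt hz
  have key := (convex_ball (x t) δ).norm_image_sub_le_of_norm_fderiv_le' (𝕜 := ℝ) (f := g)
    (φ := fderiv ℝ g (x t)) (C := ε) (fun a _ => (hg.differentiable one_ne_zero) a)
    (fun a ha => by
      have := h (a := x t) (b := a) (by rw [dist_comm]; exact ha) (mem_range_self t)
      rw [← dist_eq_norm, dist_comm]
      exact le_of_lt this) hzt hyt
  refine key.trans ?_
  gcongr
  exact (y - z).norm_coe_le_norm t

end Nemytskii

/-! ### Taylor expansion and tangent curves. -/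

/-- Second order Taylor expansion of a function whose derivative is differentiable at a point. -/
theorem isLittleO_taylor_two {E : Type*} [NormedAddCommGroup E] [NormedSpace ℝ E] {f : E → ℝ}
    {f' : E → E →L[ℝ] ℝ} {f'' : E →L[ℝ] E →L[ℝ] ℝ} {x : E}
    (hf : ∀ᶠ y in 𝓝 x, HasFDerivAt f (f' y) y) (hf' : HasFDerivAt f' f'' x) :
    (fun y => f y - f x - f' x (y - x) - (1 / 2 : ℝ) * f'' (y - x) (y - x))
      =o[𝓝 x] fun y => ‖y - x‖ ^ 2 := by
  rw [isLittleO_iff]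
  intro ε hε
  have h2 := (isLittleO_iff.1 hf'.isLittleO) hε
  obtain ⟨δ, hδ, hball⟩ := Metric.eventually_nhds_iff_ball.1 (hf.and h2)
  filter_upwards [Metric.ball_mem_nhds x hδ] with y hy
  set d := y - x with hd
  have hmem : ∀ s ∈ Icc (0 : ℝ) 1, x + s • d ∈ Metric.ball x δ := by
    intro s hs
    rw [mem_ball_iff_norm] at hy ⊢
    rw [add_sub_cancel_left, norm_smul, Real.norm_of_nonneg hs.1]
    calc s * ‖d‖ ≤ 1 * ‖d‖ := by gcongr; exact hs.2
      _ < δ := by rw [one_mul]; exact hy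
  have hder : ∀ s ∈ Icc (0 : ℝ) 1, HasDerivWithinAt
      (fun s : ℝ => f (x + s • d) - s * f' x d - (1 / 2 * s ^ 2) * f'' d d)
      (f' (x + s • d) d - f' x d - s * f'' d d) (Icc 0 1) s := by
    intro s hs
    have h1 : HasDerivAt (fun s : ℝ => x + s • d) d s := by
      simpa using ((hasDerivAt_id s).smul_const d).const_add x
    have h3 := (hball _ (hmem s hs)).1.comp_hasDerivAt s h1
    have h4 : HasDerivAt (fun s : ℝ => s * f' x d) (f' x d) s := by
      simpa using (hasDerivAt_id s).mul_const (f' x d)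
    have h5 : HasDerivAt (fun s : ℝ => (1 / 2 * s ^ 2) * f'' d d) (s * f'' d d) s := by
      have := ((hasDerivAt_pow 2 s).const_mul (1 / 2 : ℝ)).mul_const (f'' d d)
      refine this.congr_deriv ?_
      push_cast
      ring
    exact ((h3.sub h4).sub h5).hasDerivWithinAt
  have hbd : ∀ s ∈ Ico (0 : ℝ) 1, ‖f' (x + s • d) d - f' x d - s * f'' d d‖ ≤ ε * ‖d‖ ^ 2 := by
    intro s hs
    have h6 := (hball _ (hmem s ⟨hs.1, hs.2.le⟩)).2
    rw [add_sub_cancel_left] at h6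
    have h7 : f' (x + s • d) d - f' x d - s * f'' d d
        = (f' (x + s • d) - f' x - f'' (s • d)) d := by simp
    rw [h7]
    refine (ContinuousLinearMap.le_opNorm _ _).trans ?_
    rw [norm_smul, Real.norm_of_nonneg hs.1] at h6
    calc _ ≤ (ε * (s * ‖d‖)) * ‖d‖ := by gcongr
      _ ≤ (ε * (1 * ‖d‖)) * ‖d‖ := by gcongr; exact hs.2.le
      _ = _ := by ring
  have := norm_image_sub_le_of_norm_deriv_le_segment' hder hbd 1 (by simp)
  simp only [one_smul, zero_smul] at this
  rw [Real.norm_of_nonneg (by positivity : (0 : ℝ) ≤ ‖d‖ ^ 2)]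
  refine le_trans (le_of_eq ?_) (this.trans (le_of_eq (by ring)))
  congr 1
  rw [hd, add_sub_cancel]
  simp
  ring

/-- **Lyusternik's theorem**: a vector in the kernel of a surjective strict derivative is tangent to
the level set. -/
theorem exists_tangent_curve {E F : Type*} [NormedAddCommGroup E] [NormedSpace ℝ E]
    [CompleteSpace E] [NormedAddCommGroup F] [NormedSpace ℝ F] [CompleteSpace F] {f : E → F}
    {f' : E →L[ℝ] F} {a z : E} (hf : HasStrictFDerivAt f f' a) (hsurj : Function.Surjective f')
    (ha : f a = 0) (hz : f' z = 0) :
    ∃ r : ℝ → E, r =o[𝓝 0] (fun σ : ℝ => σ) ∧ ∀ᶠ σ in 𝓝 (0 : ℝ), f (a + σ • z + r σ) = 0 := by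
  obtain ⟨g, hg⟩ := f'.exists_nonlinearRightInverse_of_surjective
    (LinearMap.range_eq_top.2 hsurj)
  -- With half the inverse norm of the right inverse as approximation constant, `g.nnnorm⁻¹ - c` is
  -- again `c`, which is the rate at which `f` covers balls.
  set c : NNReal := g.nnnorm⁻¹ / 2 with hc
  have hc0 : 0 < c := by positivity
  obtain ⟨s, hs, happ⟩ := hf.approximates_deriv_on_nhds (c := c) (Or.inr hc0)
  obtain ⟨δ, hδ, hball⟩ := Metric.mem_nhds_iff.1 hs
  have hκ : ((g.nnnorm : ℝ)⁻¹ - c) = c := by rw [hc]; push_cast; ring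
  have hcr : (0 : ℝ) < c := hc0
  have hlin : Tendsto (fun σ : ℝ => a + σ • z) (𝓝 0) (𝓝 a) := by
    have : Continuous fun σ : ℝ => a + σ • z := by fun_prop
    simpa using this.tendsto 0
  have hfo : (fun σ : ℝ => f (a + σ • z)) =o[𝓝 0] (fun σ : ℝ => σ) := by
    have h1 := hf.hasFDerivAt.isLittleO.comp_tendsto hlin
    have h2 : (fun σ : ℝ => a + σ • z - a) =O[𝓝 0] fun σ : ℝ => σ :=
      IsBigO.of_bound ‖z‖ (Eventually.of_forall fun σ => by
        rw [add_sub_cancel_left, norm_smul, mul_comm])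
    refine (h1.trans_isBigO h2).congr_left fun σ => ?_
    simp [ha, hz]
  have hft : Tendsto (fun σ : ℝ => ‖f (a + σ • z)‖ / c) (𝓝 0) (𝓝 0) := by
    have := (hfo.trans_tendsto tendsto_id).norm.div_const (c : ℝ)
    simpa using this
  have hev : ∀ᶠ σ in 𝓝 (0 : ℝ), ∃ y, dist y (a + σ • z) ≤ ‖f (a + σ • z)‖ / c ∧ f y = 0 := by
    have e1 : ∀ᶠ σ in 𝓝 (0 : ℝ), dist (a + σ • z) a < δ / 2 :=
      hlin.eventually (Metric.ball_mem_nhds a (half_pos hδ))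
    have e2 : ∀ᶠ σ in 𝓝 (0 : ℝ), ‖f (a + σ • z)‖ / c < δ / 2 :=
      hft.eventually (gt_mem_nhds (half_pos hδ))
    filter_upwards [e1, e2] with σ h1 h2
    have hsub : Metric.closedBall (a + σ • z) (‖f (a + σ • z)‖ / c) ⊆ s := by
      refine Subset.trans (fun y hy => ?_) hball
      have hy' : dist y (a + σ • z) ≤ ‖f (a + σ • z)‖ / c := hy
      rw [Metric.mem_ball]
      linarith [dist_triangle y (a + σ • z) a]
    -- The image of the ball of radius `‖f (a + σ • z)‖ / c` about `a + σ • z` covers a ball about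
    -- `f (a + σ • z)` just large enough to contain `0`.
    have := happ.surjOn_closedBall_of_nonlinearRightInverse g (by positivity) hsub
    rw [hκ, mul_div_cancel₀ _ hcr.ne'] at this
    obtain ⟨y, hy, hy0⟩ := this (show (0 : F) ∈ _ by simp [dist_eq_norm])
    exact ⟨y, hy, hy0⟩
  choose! y hy using fun (σ : ℝ) (h : ∃ y, dist y (a + σ • z) ≤ ‖f (a + σ • z)‖ / c ∧ f y = 0) => h
  refine ⟨fun σ => y σ - (a + σ • z), ?_, ?_⟩
  · refine IsBigO.trans_isLittleO (IsBigO.of_bound (1 / (c : ℝ)) ?_) hfo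
    filter_upwards [hev] with σ h
    have := (hy σ h).1
    rw [dist_eq_norm] at this
    rw [one_div, inv_mul_eq_div]
    exact this
  · filter_upwards [hev] with σ h
    rw [add_sub_cancel]
    exact (hy σ h).2

/-! ### Linear Volterra equations. -/

section Volterra

variable {V : Type*} [NormedAddCommGroup V] {T : ℝ} (hT : 0 ≤ T)

theorem continuous_extend (x : C(Icc 0 T, V)) : Continuous (IccExtend hT x) :=
  x.continuous.Icc_extend'

theorem norm_extend_le (x : C(Icc 0 T, V)) (t : ℝ) : ‖IccExtend hT x t‖ ≤ ‖x‖ :=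
  x.norm_coe_le_norm _

variable [NormedSpace ℝ V]

/-- The primitive vanishing at `0` of a continuous function on `[0, T]`. -/
def primitive : C(Icc 0 T, V) →L[ℝ] C(Icc 0 T, V) :=
  LinearMap.mkContinuous
    { toFun := fun x => ⟨fun t => ∫ s in (0 : ℝ)..t, IccExtend hT x s,
        (intervalIntegral.continuous_primitive
          (fun a b => (continuous_extend hT x).intervalIntegrable a b) 0).comp
          continuous_subtype_val⟩
      map_add' := fun x y => by
        ext t
        exact intervalIntegral.integral_add ((continuous_extend hT x).intervalIntegrable _ _)
          ((continuous_extend hT y).intervalIntegrable _ _)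
      map_smul' := fun c x => by
        ext t
        exact intervalIntegral.integral_smul c _ }
    T
    (fun x => by
      rw [ContinuousMap.norm_le _ (by positivity)]
      intro t
      have := intervalIntegral.norm_integral_le_of_norm_le_const (a := 0) (b := (t : ℝ))
        (f := IccExtend hT x) (C := ‖x‖) (fun s _ => norm_extend_le hT x s)
      refine this.trans ?_
      rw [sub_zero, abs_of_nonneg t.2.1, mul_comm]
      gcongr
      exact t.2.2)

theorem primitive_apply (x : C(Icc 0 T, V)) (t : Icc 0 T) :
    primitive hT x t = ∫ s in (0 : ℝ)..t, IccExtend hT x s := rfl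

/-- An `L¹` bound in place of the supremum bound: a rate supported on a short interval has a small
primitive. -/
theorem norm_primitive_le (x : C(Icc 0 T, V)) :
    ‖primitive hT x‖ ≤ ∫ s in (0 : ℝ)..T, ‖IccExtend hT x s‖ := by
  have hc := (continuous_extend hT x).norm
  rw [ContinuousMap.norm_le _ (intervalIntegral.integral_nonneg hT fun _ _ => norm_nonneg _)]
  intro t
  refine (intervalIntegral.norm_integral_le_integral_norm t.2.1).trans ?_
  exact intervalIntegral.integral_mono_interval le_rfl t.2.1 t.2.2
    (Eventually.of_forall fun _ => norm_nonneg _) (hc.intervalIntegrable _ _)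

/-- The Volterra operator `x ↦ ∫₀ A x`. -/
def volterra (A : C(Icc 0 T, V →L[ℝ] V)) : C(Icc 0 T, V) →L[ℝ] C(Icc 0 T, V) :=
  (primitive hT).comp (pointwiseApply A)

/-- Each application integrates `s ^ k` once more, which produces the factorial. -/
theorem norm_volterra_pow_apply_le (A : C(Icc 0 T, V →L[ℝ] V)) (x : C(Icc 0 T, V)) (k : ℕ) :
    ∀ t : Icc 0 T, ‖(volterra hT A ^ k) x t‖ ≤ (‖A‖ * t) ^ k / k.factorial * ‖x‖ := by
  induction k with
  | zero => intro t; simpa using x.norm_coe_le_norm t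
  | succ k ih =>
    intro t
    rw [pow_succ']
    change ‖∫ s in (0 : ℝ)..t, IccExtend hT (pointwiseApply A ((volterra hT A ^ k) x)) s‖ ≤ _
    have hb : ∀ s ∈ Ioc (0 : ℝ) t,
        ‖IccExtend hT (pointwiseApply A ((volterra hT A ^ k) x)) s‖
          ≤ (‖A‖ ^ (k + 1) / k.factorial * ‖x‖) * s ^ k := by
      intro s hs
      have hs' : s ∈ Icc 0 T := ⟨hs.1.le, hs.2.trans t.2.2⟩
      rw [IccExtend_of_mem hT _ hs', pointwiseApply_apply]
      refine (ContinuousLinearMap.le_opNorm _ _).trans ?_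
      calc _ ≤ ‖A‖ * ((‖A‖ * s) ^ k / k.factorial * ‖x‖) := by
            gcongr
            · exact A.norm_coe_le_norm _
            · exact ih ⟨s, hs'⟩
        _ = _ := by ring
    refine (intervalIntegral.norm_integral_le_of_norm_le t.2.1
      (Eventually.of_forall fun s hs => hb s hs)
      ((by fun_prop : Continuous fun s : ℝ =>
        (‖A‖ ^ (k + 1) / k.factorial * ‖x‖) * s ^ k).intervalIntegrable _ _)).trans (le_of_eq ?_)
    rw [intervalIntegral.integral_const_mul, integral_pow, Nat.factorial_succ]
    push_cast
    field_simp
    rw [zero_pow (by omega), sub_zero]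
    ring

/-- Some power `K ^ k` has norm less than one, for any `A` and `T`. Then `1 - K ^ k` is a unit, and
it is the product of `1 - K` with a geometric sum that commutes with it. -/
theorem isUnit_one_sub_volterra [CompleteSpace V] (A : C(Icc 0 T, V →L[ℝ] V)) :
    IsUnit (1 - volterra hT A) := by
  obtain ⟨k, hk⟩ := ((FloorSemiring.tendsto_pow_div_factorial_atTop (‖A‖ * T)).eventually
    (gt_mem_nhds one_pos)).exists
  have hnorm : ‖volterra hT A ^ k‖ < 1 := by
    refine lt_of_le_of_lt (ContinuousLinearMap.opNorm_le_bound _ (by positivity) fun x => ?_) hk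
    rw [ContinuousMap.norm_le _ (by positivity)]
    intro t
    refine (norm_volterra_pow_apply_le hT A x k t).trans ?_
    have h0 := t.2.1
    have h1 := t.2.2
    gcongr
  have hu := isUnit_one_sub_of_norm_lt_one
    (R := C(Icc 0 T, V) →L[ℝ] C(Icc 0 T, V)) (x := volterra hT A ^ k) hnorm
  rw [← mul_neg_geom_sum] at hu
  refine (Commute.isUnit_mul_iff ?_).1 hu |>.1
  exact (Commute.one_left _).sub_left
    (Commute.sum_right _ _ _ fun i _ => (Commute.refl _).pow_right i)

/-- The bounded inverse of `x ↦ x - ∫₀ A x`. -/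
theorem exists_resolvent [CompleteSpace V] (A : C(Icc 0 T, V →L[ℝ] V)) :
    ∃ R : C(Icc 0 T, V) →L[ℝ] C(Icc 0 T, V),
      ∀ x, R x - primitive hT (pointwiseApply A (R x)) = x := by
  obtain ⟨u, hu⟩ := isUnit_one_sub_volterra hT A
  refine ⟨(↑u⁻¹ : C(Icc 0 T, V) →L[ℝ] C(Icc 0 T, V)), fun x => ?_⟩
  have h := congrArg (fun S : C(Icc 0 T, V) →L[ℝ] C(Icc 0 T, V) => S x) u.mul_inv
  rw [hu] at h
  exact h

end Volterra

/-- Global existence for linear differential equations. -/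
theorem exists_linear_ode {V : Type*} [NormedAddCommGroup V] [NormedSpace ℝ V] [CompleteSpace V]
    {T : ℝ} (hT : 0 ≤ T) (A : ℝ → V →L[ℝ] V) (hA : Continuous A) (v : V) :
    ∃ y : ℝ → V, Continuous y ∧ y 0 = v ∧ ∀ t ∈ Icc 0 T, HasDerivAt y (A t (y t)) t := by
  obtain ⟨R, hR⟩ := exists_resolvent hT (⟨fun t => A t, hA.comp continuous_subtype_val⟩ :
    C(Icc 0 T, V →L[ℝ] V))
  set Y := R (ContinuousMap.const _ v) with hY
  have hYc := continuous_extend hT Y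
  set g : ℝ → V := fun s => A s (IccExtend hT Y s) with hg
  have hgc : Continuous g := hA.clm_apply hYc
  -- Defining the solution by its integral on the whole line gives two-sided derivatives at `0` and
  -- `T`.
  set y : ℝ → V := fun t => v + ∫ s in (0 : ℝ)..t, g s with hy
  have hder : ∀ t, HasDerivAt y (g t) t := fun t =>
    (intervalIntegral.integral_hasDerivAt_right (hgc.intervalIntegrable _ _)
      (hgc.stronglyMeasurableAtFilter _ _) hgc.continuousAt).const_add v
  refine ⟨y, continuous_iff_continuousAt.2 fun t => (hder t).continuousAt, by simp [hy],
    fun t ht => ?_⟩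
  have hyt : y t = IccExtend hT Y t := by
    rw [IccExtend_of_mem hT _ ht]
    have h := DFunLike.congr_fun (hR (ContinuousMap.const _ v)) ⟨t, ht⟩
    rw [ContinuousMap.sub_apply, primitive_apply, ContinuousMap.const_apply, sub_eq_iff_eq_add]
      at h
    rw [hY, h, hy]
    simp only
    congr 1
    refine intervalIntegral.integral_congr fun s hs => ?_
    rw [uIcc_of_le ht.1] at hs
    have hs' : s ∈ Icc 0 T := ⟨hs.1, hs.2.trans ht.2⟩
    simp only [hg]
    rw [IccExtend_of_mem hT _ hs', IccExtend_of_mem hT _ hs']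
    rfl
  have := hder t
  simp only [hg] at this
  rwa [hyt]

/-! ### Duality consequences of a unique multiplier. -/

section Abstract

variable {ι κ : Type*}

open Classical in
/-- Slack on the coordinates where `α` vanishes. -/
def slack (α : ι → ℝ) : (ι → ℝ) →ₗ[ℝ] ι → ℝ where
  toFun s i := if α i = 0 then s i else 0
  map_add' s s' := by ext i; by_cases h : α i = 0 <;> simp [h]
  map_smul' c s := by ext i; by_cases h : α i = 0 <;> simp [h]

theorem slack_apply_of_eq_zero {α : ι → ℝ} (s : ι → ℝ) {i : ι} (h : α i = 0) : slack α s i = s i := by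
  simp [slack, h]

theorem slack_apply_of_ne_zero {α : ι → ℝ} (s : ι → ℝ) {i : ι} (h : α i ≠ 0) : slack α s i = 0 := by
  simp [slack, h]

variable [Fintype ι] [Fintype κ]

/-- Adding a large multiple of `α` makes a vector nonnegative. -/
theorem exists_nonneg_add_mul (α μ : ι → ℝ) (hα : ∀ i, 0 ≤ α i)
    (hμ : ∀ i, α i = 0 → 0 ≤ μ i) : ∃ c : ℝ, ∀ i, 0 ≤ μ i + c * α i := by
  -- Indices with `α i = 0` contribute nothing, since division by zero gives zero.
  refine ⟨∑ i, |μ i| / α i, fun i => ?_⟩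
  rcases (hα i).eq_or_lt with h | h
  · simp [← h, hμ i h.symm]
  · have h1 : |μ i| / α i ≤ ∑ i, |μ i| / α i :=
      Finset.single_le_sum (f := fun i => |μ i| / α i)
        (fun j _ => div_nonneg (abs_nonneg _) (hα j)) (Finset.mem_univ i)
    have h2 : |μ i| ≤ (∑ i, |μ i| / α i) * α i := by rwa [div_le_iff₀ h] at h1
    linarith [neg_abs_le (μ i)]

/-- `(α, β)` annihilates the subspace `M`. -/
def Annihilates (M : Submodule ℝ ((ι → ℝ) × (κ → ℝ))) (α : ι → ℝ) (β : κ → ℝ) : Prop :=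
  ∀ y ∈ M, ∑ i, α i * y.1 i + ∑ j, β j * y.2 j = 0

/-- `(α, β)` spans the cone of the annihilators of `M` with nonnegative first part. -/
structure IsUniqueAnnihilator (M : Submodule ℝ ((ι → ℝ) × (κ → ℝ))) (α : ι → ℝ) (β : κ → ℝ) :
    Prop where
  annihilates : Annihilates M α β
  nonneg : ∀ i, 0 ≤ α i
  ne_zero : α ≠ 0 ∨ β ≠ 0
  unique : ∀ α' β', (∀ i, 0 ≤ α' i) → Annihilates M α' β' → ∃ c : ℝ, 0 ≤ c ∧ α' = c • α ∧ β' = c • β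

variable {M : Submodule ℝ ((ι → ℝ) × (κ → ℝ))} {α : ι → ℝ} {β : κ → ℝ}

/-- If `α` were zero, `(0, -β)` would also be an admissible annihilator, so `-β = c • β` with `c ≥
0`, and `β` would vanish too. -/
theorem IsUniqueAnnihilator.sum_pos (h : IsUniqueAnnihilator M α β) : 0 < ∑ i, α i := by
  refine lt_of_le_of_ne (Finset.sum_nonneg fun i _ => h.nonneg i) fun h0 => ?_
  have hα : α = 0 := by
    funext i
    exact (Finset.sum_eq_zero_iff_of_nonneg fun i _ => h.nonneg i).1 h0.symm i (Finset.mem_univ i)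
  obtain ⟨c, hc, -, h2⟩ := h.unique α (-β) h.nonneg fun y hy => by
    have := h.annihilates y hy
    simp only [hα, Pi.zero_apply, zero_mul, Finset.sum_const_zero, zero_add, Pi.neg_apply, neg_mul,
      Finset.sum_neg_distrib] at this ⊢
    rw [this, neg_zero]
  have hβ : β = 0 := by
    funext j
    have := congrFun h2 j
    simp only [Pi.neg_apply, Pi.smul_apply, smul_eq_mul] at this
    have h3 : (1 + c) * β j = 0 := by linarith
    exact (mul_eq_zero.1 h3).resolve_left (by positivity)
  exact h.ne_zero.elim (fun h => h hα) fun h => h hβ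

/-- An annihilator which is nonnegative where `α` vanishes is a multiple of `(α, β)`. -/
theorem IsUniqueAnnihilator.exists_eq_smul (h : IsUniqueAnnihilator M α β) {μ : ι → ℝ} {ν : κ → ℝ}
    (hμ : ∀ i, α i = 0 → 0 ≤ μ i) (hM : Annihilates M μ ν) :
    ∃ c : ℝ, μ = c • α ∧ ν = c • β := by
  obtain ⟨t, ht⟩ := exists_nonneg_add_mul α μ h.nonneg hμ
  obtain ⟨c, -, h1, h2⟩ := h.unique (μ + t • α) (ν + t • β) ht fun y hy => by
    have e1 := h.annihilates y hy
    have e2 := hM y hy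
    simp only [Pi.add_apply, Pi.smul_apply, smul_eq_mul, add_mul, Finset.sum_add_distrib, mul_assoc,
      ← Finset.mul_sum]
    linear_combination e2 + t * e1
  refine ⟨c - t, ?_, ?_⟩
  · rw [sub_smul, ← h1, add_sub_cancel_right]
  · rw [sub_smul, ← h2, add_sub_cancel_right]

open Classical in
/-- A linear form on `(ι → ℝ) × (κ → ℝ)` in coordinates. -/
theorem linearForm_apply (f : Module.Dual ℝ ((ι → ℝ) × (κ → ℝ))) (y : (ι → ℝ) × (κ → ℝ)) :
    f y = ∑ i, f (Pi.single i 1, 0) * y.1 i + ∑ j, f (0, Pi.single j 1) * y.2 j := by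
  have h1 := pi_eq_sum_univ' y.1
  have h2 := pi_eq_sum_univ' y.2
  have h : f y = f (y.1, 0) + f (0, y.2) := by rw [← map_add]; simp
  rw [h]
  congr 1
  · have := LinearMap.pi_apply_eq_sum_univ (f ∘ₗ LinearMap.inl ℝ (ι → ℝ) (κ → ℝ)) y.1
    simp only [LinearMap.comp_apply, LinearMap.inl_apply, smul_eq_mul] at this
    rw [this]
    refine Finset.sum_congr rfl fun i _ => ?_
    rw [mul_comm]
    congr 3
    ext j
    simp [Pi.single_apply, eq_comm]
  · have := LinearMap.pi_apply_eq_sum_univ (f ∘ₗ LinearMap.inr ℝ (ι → ℝ) (κ → ℝ)) y.2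
    simp only [LinearMap.comp_apply, LinearMap.inr_apply, smul_eq_mul] at this
    rw [this]
    refine Finset.sum_congr rfl fun i _ => ?_
    rw [mul_comm]
    congr 3
    ext j
    simp [Pi.single_apply, eq_comm]

-- A linear form that kills `M` and the added directions has zero coordinates where `α` vanishes, so
-- it is a multiple `c • (α, β)`. Killing the constant vector gives `c * ∑ α i = 0`, hence `c = 0`.
-- This is the surjectivity needed for Lyusternik's theorem.
open Classical in
theorem IsUniqueAnnihilator.exists_add_slack (h : IsUniqueAnnihilator M α β)
    (y : (ι → ℝ) × (κ → ℝ)) :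
    ∃ m ∈ M, ∃ (s : ι → ℝ) (τ : ℝ), y = m + (slack α s + fun _ => τ, 0) := by
  let D : ((ι → ℝ) × ℝ) →ₗ[ℝ] (ι → ℝ) × (κ → ℝ) :=
    (LinearMap.inl ℝ (ι → ℝ) (κ → ℝ)).comp
      ((slack α).coprod (LinearMap.pi fun _ => LinearMap.id))
  have htop : M ⊔ LinearMap.range D = ⊤ := by
    by_contra hne
    obtain ⟨f, hf0, hf⟩ := Submodule.exists_le_ker_of_lt_top _ (lt_top_iff_ne_top.2 hne)
    have hfM : ∀ m ∈ M, f m = 0 := fun m hm => hf (Submodule.mem_sup_left hm)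
    have hfD : ∀ v, f (D v) = 0 := fun v => hf (Submodule.mem_sup_right ⟨v, rfl⟩)
    have h0 : ∀ i, α i = 0 → f (Pi.single i 1, 0) = 0 := by
      intro i hi
      have := hfD (Pi.single i 1, 0)
      have e : D (Pi.single i 1, 0) = (Pi.single i 1, 0) := by
        ext j
        · by_cases hij : j = i
          · subst hij; simp [D, slack, hi]
          · simp [D, slack, hij]
        · simp [D]
      rwa [e] at this
    obtain ⟨c, hc1, hc2⟩ := h.exists_eq_smul (μ := fun i => f (Pi.single i 1, 0))
      (ν := fun j => f (0, Pi.single j 1)) (fun i hi => (h0 i hi).ge)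
      (fun m hm => by rw [← linearForm_apply, hfM m hm])
    have h1 := hfD (0, 1)
    have e : D (0, 1) = (fun _ => 1, 0) := by
      ext j <;> simp [D]
    rw [e, linearForm_apply] at h1
    simp only [mul_one, Pi.zero_apply, mul_zero, Finset.sum_const_zero, add_zero] at h1
    have h2 : ∑ i, f (Pi.single i 1, 0) = c * ∑ i, α i := by
      rw [Finset.mul_sum]
      exact Finset.sum_congr rfl fun i _ => congrFun hc1 i
    rw [h2] at h1
    have hc : c = 0 := (mul_eq_zero.1 h1).resolve_right h.sum_pos.ne'
    refine hf0 (LinearMap.ext fun y => ?_)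
    have e1 : ∀ i, f (Pi.single i 1, 0) = 0 := fun i => by
      simpa [hc] using congrFun hc1 i
    have e2 : ∀ j, f (0, Pi.single j 1) = 0 := fun j => by
      simpa [hc] using congrFun hc2 j
    rw [linearForm_apply]
    simp [e1, e2]
  obtain ⟨m, hm, _, ⟨v, rfl⟩, hmv⟩ := Submodule.mem_sup.1 (htop ▸ Submodule.mem_top : y ∈ _)
  refine ⟨m, hm, v.1, v.2, ?_⟩
  rw [← hmv]
  congr 1

-- Otherwise the open convex set `O` of vectors negative where `α` vanishes misses `M ⊓ Z`, where
-- `Z` is the space of vectors supported on those coordinates of the first factor. A separating form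
-- gives an annihilator of `M` that is nonnegative there and not identically zero there, whereas
-- every such annihilator is a multiple of `(α, β)` and so vanishes there.
open Classical in
theorem IsUniqueAnnihilator.exists_pos_slack (h : IsUniqueAnnihilator M α β) :
    ∃ s : ι → ℝ, (∀ i, α i = 0 → 0 < s i) ∧ (-slack α s, (0 : κ → ℝ)) ∈ M := by
  by_contra hcon
  push Not at hcon
  let Z : Submodule ℝ ((ι → ℝ) × (κ → ℝ)) :=
    { carrier := {y | (∀ i, α i ≠ 0 → y.1 i = 0) ∧ y.2 = 0}
      add_mem' := fun {a b} ha hb => ⟨fun i hi => by simp [ha.1 i hi, hb.1 i hi],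
        by simp [ha.2, hb.2]⟩
      zero_mem' := by simp
      smul_mem' := fun c a ha => ⟨fun i hi => by simp [ha.1 i hi], by simp [ha.2]⟩ }
  let O : Set ((ι → ℝ) × (κ → ℝ)) := {y | ∀ i, α i = 0 → y.1 i < 0}
  have hOopen : IsOpen O := by
    have : O = ⋂ i, {y | α i = 0 → y.1 i < 0} := by ext y; simp [O]
    rw [this]
    refine isOpen_iInter_of_finite fun i => ?_
    by_cases hi : α i = 0
    · simp only [hi, forall_const]
      exact isOpen_lt (by fun_prop) continuous_const
    · simp [hi]
  have hOconv : Convex ℝ O := by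
    intro x hx y hy a b ha hb hab i hi
    have h1 := hx i hi
    have h2 := hy i hi
    simp only [Prod.fst_add, Prod.smul_fst, Pi.add_apply, Pi.smul_apply, smul_eq_mul]
    rcases ha.eq_or_lt with h0 | h0
    · rw [← h0] at hab ⊢
      have : b = 1 := by linarith
      rw [this]; linarith
    · nlinarith [mul_neg_of_pos_of_neg h0 h1, mul_nonpos_of_nonneg_of_nonpos hb h2.le]
  have hdisj : Disjoint O ((M ⊓ Z : Submodule ℝ _) : Set ((ι → ℝ) × (κ → ℝ))) := by
    rw [Set.disjoint_left]
    rintro y hyO ⟨hyM, hyZ⟩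
    refine hcon (-y.1) (fun i hi => by simpa using hyO i hi) ?_
    suffices hy : (-slack α (-y.1), (0 : κ → ℝ)) = y by rw [hy]; exact hyM
    ext j
    · by_cases hj : α j = 0
      · simp [slack, hj]
      · simp [slack, hj, hyZ.1 j hj]
    · simp [hyZ.2]
  obtain ⟨f, u, hfO, hfM⟩ := geometric_hahn_banach_open hOconv hOopen (M ⊓ Z).convex hdisj
  have hu : u ≤ 0 := by simpa using hfM 0 (Submodule.zero_mem _)
  have hfMZ : ∀ y ∈ M ⊓ Z, f y = 0 := by
    intro y hy
    by_contra hne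
    have := hfM (((u - 1) / f y) • y) (Submodule.smul_mem _ _ hy)
    rw [map_smul, smul_eq_mul, div_mul_cancel₀ _ hne] at this
    linarith
  let y₀ : (ι → ℝ) × (κ → ℝ) := (fun _ => -1, 0)
  have hy₀ : y₀ ∈ O := fun i _ => by simp [y₀]
  -- A linear form bounded above on `O` is nonpositive on the recession directions of `O`; the signs
  -- of the coordinates of `f` follow from this.
  have hray : ∀ d : (ι → ℝ) × (κ → ℝ), (∀ c : ℝ, 0 ≤ c → y₀ + c • d ∈ O) → f d ≤ 0 := by
    intro d hd
    by_contra! hpos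
    have := hfO _ (hd ((|f y₀|) / f d) (by positivity))
    rw [map_add, map_smul, smul_eq_mul, div_mul_cancel₀ _ hpos.ne'] at this
    linarith [neg_abs_le (f y₀)]
  have hf0 : ∀ i, α i = 0 → 0 ≤ f (Pi.single i 1, 0) := by
    intro i hi
    have := hray (-(Pi.single i 1, 0)) fun c hc k hk => by
      have : 0 ≤ c * (Pi.single i 1 : ι → ℝ) k :=
        mul_nonneg hc (by by_cases hki : k = i <;> simp [hki])
      simp [y₀]
      linarith
    rw [map_neg] at this
    linarith
  have hf1 : ∀ i, α i ≠ 0 → f (Pi.single i 1, 0) = 0 := by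
    intro i hi
    have hO : ∀ c : ℝ, y₀ + c • ((Pi.single i 1, 0) : (ι → ℝ) × (κ → ℝ)) ∈ O := by
      intro c k hk
      have : k ≠ i := fun e => hi (e ▸ hk)
      simp [y₀, this]
    have h1 := hray _ fun c _ => hO c
    have h2 := hray (-(Pi.single i 1, 0)) fun c _ => by
      rw [smul_neg, ← neg_smul]; exact hO (-c)
    rw [map_neg] at h2
    linarith
  have hf2 : ∀ j, f (0, Pi.single j 1) = 0 := by
    intro j
    have hO : ∀ c : ℝ, y₀ + c • ((0, Pi.single j 1) : (ι → ℝ) × (κ → ℝ)) ∈ O := by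
      intro c k hk
      simp [y₀]
    have h1 := hray _ fun c _ => hO c
    have h2 := hray (-(0, Pi.single j 1)) fun c _ => by
      rw [smul_neg, ← neg_smul]; exact hO (-c)
    rw [map_neg] at h2
    linarith
  have hpos : ∃ i, α i = 0 ∧ f (Pi.single i 1, 0) ≠ 0 := by
    by_contra! hall
    have hfz := hfO y₀ hy₀
    have := linearForm_apply (f : Module.Dual ℝ ((ι → ℝ) × (κ → ℝ))) y₀
    have e1 : ∀ i, f (Pi.single i 1, 0) = 0 := fun i =>
      (Classical.em (α i = 0)).elim (hall i) (hf1 i)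
    simp only [ContinuousLinearMap.coe_coe, e1, hf2, zero_mul, Finset.sum_const_zero, add_zero]
      at this
    linarith
  have hann : (f : Module.Dual ℝ ((ι → ℝ) × (κ → ℝ))) ∈ (M ⊓ Z).dualAnnihilator :=
    (Submodule.mem_dualAnnihilator _).2 hfMZ
  -- The annihilator of an intersection is the sum of the annihilators. The part `ζ` is zero on the
  -- coordinates where `α` vanishes, so `f` and `μ` agree there.
  rw [Subspace.dualAnnihilator_inf_eq, Submodule.mem_sup] at hann
  obtain ⟨μ, hμ, ζ, hζ, hsum⟩ := hann
  have hμf : ∀ i, α i = 0 → μ (Pi.single i 1, 0) = f (Pi.single i 1, 0) := by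
    intro i hi
    have hz : ζ (Pi.single i 1, 0) = 0 := (Submodule.mem_dualAnnihilator _).1 hζ _
      ⟨fun k hk => Pi.single_eq_of_ne (fun e : k = i => hk (by rw [e]; exact hi)) _, rfl⟩
    have := LinearMap.congr_fun hsum (Pi.single i 1, 0)
    simp only [LinearMap.add_apply, hz, add_zero] at this
    exact this
  obtain ⟨c, hc, -⟩ := h.exists_eq_smul (μ := fun i => μ (Pi.single i 1, 0))
      (ν := fun j => μ (0, Pi.single j 1)) (fun i hi => by rw [hμf i hi]; exact hf0 i hi)
      (fun m hm => by rw [← linearForm_apply, (Submodule.mem_dualAnnihilator _).1 hμ m hm])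
  obtain ⟨i, hi, hne⟩ := hpos
  refine hne ?_
  rw [← hμf i hi]
  simpa [hi] using congrFun hc i

end Abstract

/-! ### The abstract second order condition. -/

/-- Second order expansion along a curve tangent to `z`. -/
theorem tendsto_div_sq_of_isLittleO {W : Type*} [NormedAddCommGroup W] [NormedSpace ℝ W]
    {L : W → ℝ} {Q : W →L[ℝ] W →L[ℝ] ℝ} {w₀ z : W} {r : ℝ → W}
    (hQ : (fun w => L w - (1 / 2 : ℝ) * Q (w - w₀) (w - w₀)) =o[𝓝 w₀] fun w => ‖w - w₀‖ ^ 2)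
    (hr : r =o[𝓝[>] 0] fun σ : ℝ => σ) :
    Tendsto (fun σ : ℝ => L (w₀ + σ • z + r σ) / σ ^ 2) (𝓝[>] 0) (𝓝 (1 / 2 * Q z z)) := by
  have hpos : ∀ᶠ σ : ℝ in 𝓝[>] 0, 0 < σ := self_mem_nhdsWithin
  have hv0 : Tendsto (fun σ : ℝ => z + σ⁻¹ • r σ) (𝓝[>] 0) (𝓝 z) := by
    have h1 : Tendsto (fun σ : ℝ => σ⁻¹ • r σ) (𝓝[>] 0) (𝓝 0) := hr.tendsto_inv_smul_nhds_zero
    simpa using h1.const_add z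
  have hid : Tendsto (fun σ : ℝ => σ) (𝓝[>] 0) (𝓝 0) := tendsto_nhdsWithin_of_tendsto_nhds tendsto_id
  have hw : ∀ᶠ σ : ℝ in 𝓝[>] 0, w₀ + σ • z + r σ = w₀ + σ • (z + σ⁻¹ • r σ) := by
    filter_upwards [hpos] with σ hσ
    rw [smul_add, smul_inv_smul₀ hσ.ne', add_assoc]
  have hcurve : Tendsto (fun σ : ℝ => w₀ + σ • (z + σ⁻¹ • r σ)) (𝓝[>] 0) (𝓝 w₀) := by
    simpa using (hid.smul hv0).const_add w₀
  have h2 := hQ.comp_tendsto hcurve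
  have h3 : (fun σ : ℝ => ‖w₀ + σ • (z + σ⁻¹ • r σ) - w₀‖ ^ 2) =O[𝓝[>] 0] fun σ : ℝ => σ ^ 2 := by
    refine IsBigO.pow ?_ 2
    have : (fun σ : ℝ => σ • (z + σ⁻¹ • r σ)) =O[𝓝[>] 0] fun σ : ℝ => σ • (1 : ℝ) :=
      (isBigO_refl _ _).smul (hv0.isBigO_one ℝ)
    simpa using this.norm_left
  have h4 := (h2.trans_isBigO h3).tendsto_div_nhds_zero
  have h5 : Tendsto (fun σ : ℝ => (1 / 2 : ℝ) * Q (z + σ⁻¹ • r σ) (z + σ⁻¹ • r σ)) (𝓝[>] 0)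
      (𝓝 (1 / 2 * Q z z)) := by
    have hc : Continuous fun v : W => (1 / 2 : ℝ) * Q v v := by fun_prop
    exact (hc.tendsto z).comp hv0
  have h6 := h4.add h5
  rw [zero_add] at h6
  refine h6.congr' ?_
  filter_upwards [hpos, hw] with σ hσ hwσ
  simp only [Function.comp_apply, ← hwσ]
  rw [hwσ]
  simp only [add_sub_cancel_left, map_smul, smul_apply, smul_eq_mul]
  field_simp
  ring

section

variable {ι κ : Type*} [Fintype ι] [Fintype κ] {W X : Type*}
  [NormedAddCommGroup W] [NormedSpace ℝ W] [CompleteSpace W]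
  [NormedAddCommGroup X] [NormedSpace ℝ X] [CompleteSpace X]

/-- Second order necessary condition for an abstract problem with a unique multiplier: if no point
near `w₀` satisfies `Φ = 0`, `η = 0` and `φ < 0`, then the second derivative of the Lagrangian is
nonnegative on the common kernel of the derivatives. -/
theorem second_order_necessary {Φ : W → X} {φ : W → ι → ℝ} {η : W → κ → ℝ}
    {dΦ : W →L[ℝ] X} {dφ : W →L[ℝ] ι → ℝ} {dη : W →L[ℝ] κ → ℝ} {w₀ : W}
    (hΦ : HasStrictFDerivAt Φ dΦ w₀) (hφ : HasStrictFDerivAt φ dφ w₀)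
    (hη : HasStrictFDerivAt η dη w₀) (hΦ0 : Φ w₀ = 0) (hφ0 : φ w₀ = 0) (hη0 : η w₀ = 0)
    (hsurj : Function.Surjective dΦ) {α : ι → ℝ} {β : κ → ℝ}
    (hu : IsUniqueAnnihilator
      ((LinearMap.ker (dΦ : W →ₗ[ℝ] X)).map
        ((dφ : W →ₗ[ℝ] ι → ℝ).prod (dη : W →ₗ[ℝ] κ → ℝ))) α β)
    {L : W → ℝ} (hL : ∀ w, Φ w = 0 → ∑ i, α i * φ w i + ∑ j, β j * η w j = L w)
    {Q : W →L[ℝ] W →L[ℝ] ℝ}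
    (hQ : (fun w => L w - (1 / 2 : ℝ) * Q (w - w₀) (w - w₀)) =o[𝓝 w₀] fun w => ‖w - w₀‖ ^ 2)
    (hmin : ∀ᶠ w in 𝓝 w₀, Φ w = 0 → η w = 0 → ¬ ∀ i, φ w i < 0)
    {z : W} (hz : dΦ z = 0) (hzφ : dφ z = 0) (hzη : dη z = 0) : 0 ≤ Q z z := by
  by_contra! hneg
  obtain ⟨s, hs, hsM⟩ := hu.exists_pos_slack
  obtain ⟨z₁, hz₁, hz₁e⟩ := hsM
  have hz₁Φ : dΦ z₁ = 0 := hz₁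
  have hz₁φ : dφ z₁ = -slack α s := congrArg Prod.fst hz₁e
  have hz₁η : dη z₁ = 0 := congrArg Prod.snd hz₁e
  -- The functions with `α i = 0` do not enter the Lagrangian, and along `z` they are stationary, so
  -- their sign would be uncontrolled. Tilting by `z₁` makes them decrease to first order and keeps
  -- the second derivative negative.
  obtain ⟨δ, hδneg, hδ⟩ : ∃ δ : ℝ, Q (z + δ • z₁) (z + δ • z₁) < 0 ∧ 0 < δ := by
    have hc : Continuous fun δ : ℝ => Q (z + δ • z₁) (z + δ • z₁) := by fun_prop
    have h0 : Tendsto (fun δ : ℝ => Q (z + δ • z₁) (z + δ • z₁)) (𝓝[>] 0) (𝓝 (Q z z)) := by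
      have := (hc.tendsto 0).mono_left (nhdsWithin_le_nhds (s := Ioi (0 : ℝ)))
      simpa using this
    exact ((h0.eventually (gt_mem_nhds hneg)).and self_mem_nhdsWithin).exists
  set z' := z + δ • z₁ with hz'
  let sl : (ι → ℝ) →L[ℝ] ι → ℝ := (slack α).toContinuousLinearMap
  let one : ℝ →L[ℝ] ι → ℝ := ContinuousLinearMap.pi fun _ => ContinuousLinearMap.id ℝ ℝ
  -- The slack lives only where `α i = 0` and `τ` is shared by all indices. This is enough to make
  -- the derivative onto, yet on the zero set the weighted sum of the `φ i` depends on `τ` alone.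
  let H : W × (ι → ℝ) × ℝ → X × (ι → ℝ) × (κ → ℝ) :=
    fun a => (Φ a.1, φ a.1 + (sl a.2.1 + one a.2.2), η a.1)
  let p₁ : W × (ι → ℝ) × ℝ →L[ℝ] W := ContinuousLinearMap.fst ℝ W ((ι → ℝ) × ℝ)
  let p₂ : W × (ι → ℝ) × ℝ →L[ℝ] (ι → ℝ) × ℝ := ContinuousLinearMap.snd ℝ W ((ι → ℝ) × ℝ)
  let dH : W × (ι → ℝ) × ℝ →L[ℝ] X × (ι → ℝ) × (κ → ℝ) :=
    (dΦ.comp p₁).prod ((dφ.comp p₁ + (sl.coprod one).comp p₂).prod (dη.comp p₁))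
  have hp₁ : HasStrictFDerivAt (fun a : W × (ι → ℝ) × ℝ => a.1) p₁ (w₀, 0, 0) :=
    p₁.hasStrictFDerivAt
  have hH : HasStrictFDerivAt H dH (w₀, 0, 0) :=
    (HasStrictFDerivAt.comp (w₀, (0 : ι → ℝ), (0 : ℝ)) hΦ hp₁).prodMk
      (((HasStrictFDerivAt.comp (w₀, (0 : ι → ℝ), (0 : ℝ)) hφ hp₁).add
        ((sl.coprod one).comp p₂).hasStrictFDerivAt).prodMk
        (HasStrictFDerivAt.comp (w₀, (0 : ι → ℝ), (0 : ℝ)) hη hp₁))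
  have hdH : Function.Surjective dH := by
    rintro ⟨ξ, y⟩
    obtain ⟨a, ha⟩ := hsurj ξ
    obtain ⟨m, ⟨b, hb, rfl⟩, s', τ, hy⟩ := hu.exists_add_slack (y - (dφ a, dη a))
    refine ⟨(a + b, s', τ), ?_⟩
    have hb' : dΦ b = 0 := hb
    have h1 : y.1 - dφ a = dφ b + (slack α s' + fun _ => τ) := congrArg Prod.fst hy
    have h2 : y.2 - dη a = dη b + 0 := congrArg Prod.snd hy
    refine Prod.ext ?_ (Prod.ext ?_ ?_)
    · change dΦ (a + b) = ξ
      rw [map_add, ha, hb', add_zero]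
    · change dφ (a + b) + (slack α s' + fun _ => τ) = y.1
      rw [map_add, add_assoc, ← h1]; abel
    · change dη (a + b) = y.2
      rw [add_zero] at h2
      rw [map_add, ← h2]; abel
  obtain ⟨r, hr, hr0⟩ := exists_tangent_curve (z := (z', δ • s, (0 : ℝ))) hH hdH
    (by
      refine Prod.ext hΦ0 (Prod.ext ?_ hη0)
      change φ w₀ + (sl 0 + one 0) = 0
      rw [hφ0, map_zero, map_zero]; simp)
    (by
      refine Prod.ext ?_ (Prod.ext ?_ ?_)
      · change dΦ z' = 0
        rw [hz', map_add, map_smul, hz, hz₁Φ]; simp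
      · change dφ z' + (slack α (δ • s) + one 0) = 0
        rw [hz', map_add, map_smul, hzφ, hz₁φ, map_smul, map_zero]; simp
      · change dη z' = 0
        rw [hz', map_add, map_smul, hzη, hz₁η]; simp)
  have hr' := hr.mono (nhdsWithin_le_nhds (s := Ioi (0 : ℝ)))
  have hpos : ∀ᶠ σ : ℝ in 𝓝[>] 0, 0 < σ := self_mem_nhdsWithin
  have hid : Tendsto (fun σ : ℝ => σ) (𝓝[>] 0) (𝓝 0) :=
    tendsto_nhdsWithin_of_tendsto_nhds tendsto_id
  have hr1 : (fun σ => (r σ).1) =o[𝓝[>] 0] fun σ : ℝ => σ := by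
    exact (isBigO_fst_prod' (f' := r)).trans_isLittleO hr'
  have hr2 : (fun σ => (r σ).2) =o[𝓝[>] 0] fun σ : ℝ => σ := by
    exact (isBigO_snd_prod' (f' := r)).trans_isLittleO hr'
  have hlim := tendsto_div_sq_of_isLittleO (z := z') hQ hr1
  have hLneg : ∀ᶠ σ : ℝ in 𝓝[>] 0, L (w₀ + σ • z' + (r σ).1) < 0 := by
    filter_upwards [hlim.eventually (gt_mem_nhds (by linarith : 1 / 2 * Q z' z' < 0)), hpos]
      with σ h1 h2
    by_contra! h3
    exact absurd h1 (not_lt.2 (by positivity))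
  have hcurve : Tendsto (fun σ : ℝ => w₀ + σ • z' + (r σ).1) (𝓝[>] 0) (𝓝 w₀) := by
    have h1 := hr1.trans_tendsto hid
    have h2 : Tendsto (fun σ : ℝ => w₀ + σ • z') (𝓝[>] 0) (𝓝 w₀) := by
      simpa using (hid.smul_const z').const_add w₀
    simpa using h2.add h1
  have hslack : ∀ᶠ σ : ℝ in 𝓝[>] 0, ∀ i, α i = 0 → 0 < (σ • δ • s + (r σ).2.1) i := by
    rw [eventually_all]
    intro i
    by_cases hi : α i = 0
    · have h1 : (fun σ => (r σ).2.1 i) =o[𝓝[>] 0] fun σ : ℝ => σ := by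
        refine IsBigO.trans_isLittleO (IsBigO.of_bound 1 (Eventually.of_forall fun σ => ?_)) hr2
        rw [one_mul]
        exact (norm_le_pi_norm _ i).trans (norm_fst_le _)
      have h2 := (isLittleO_iff.1 h1) (half_pos (mul_pos hδ (hs i hi)))
      filter_upwards [h2, hpos] with σ h3 h4 _
      have h5 := hs i hi
      rw [Real.norm_eq_abs, Real.norm_of_nonneg h4.le] at h3
      have h6 := neg_abs_le ((r σ).2.1 i)
      simp only [Pi.add_apply, Pi.smul_apply, smul_eq_mul]
      have h7 : 0 < δ * s i * σ := by positivity
      nlinarith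
    · exact Eventually.of_forall fun σ h => absurd h hi
  have hall := (hcurve.eventually hmin).and (hLneg.and (hslack.and
    ((hr0.filter_mono nhdsWithin_le_nhds).and hpos)))
  obtain ⟨σ, h1, h2, h3, h4, h5⟩ := hall.exists
  have e1 : Φ (w₀ + σ • z' + (r σ).1) = 0 := congrArg Prod.fst h4
  have e2 : φ (w₀ + σ • z' + (r σ).1) + (slack α (0 + σ • δ • s + (r σ).2.1)
      + fun _ => (0 + σ • 0 + (r σ).2.2)) = 0 := congrArg (fun a => a.2.1) h4
  have e3 : η (w₀ + σ • z' + (r σ).1) = 0 := congrArg (fun a => a.2.2) h4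
  rw [zero_add] at e2
  set w := w₀ + σ • z' + (r σ).1
  set τ := 0 + σ • 0 + (r σ).2.2
  set s' := σ • δ • s + (r σ).2.1
  have e4 : ∀ i, φ w i = -(slack α s' i) - τ := fun i => by
    have := congrFun e2 i
    simp only [Pi.add_apply, Pi.zero_apply] at this
    linarith
  have e5 := hL w e1
  have e6 : ∑ i, α i * φ w i = -(τ * ∑ i, α i) := by
    rw [Finset.mul_sum, ← Finset.sum_neg_distrib]
    refine Finset.sum_congr rfl fun i _ => ?_
    by_cases hi : α i = 0
    · simp [hi]
    · rw [e4, slack_apply_of_ne_zero _ hi]; ring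
  rw [e6, e3] at e5
  simp only [Pi.zero_apply, mul_zero, Finset.sum_const_zero, add_zero] at e5
  -- The Lagrangian equals `-(τ * ∑ i, α i)` on the curve and is negative, while the sum is
  -- positive.
  have hτ : 0 < τ := by
    have h6 : 0 < τ * ∑ i, α i := by linarith
    exact (pos_iff_pos_of_mul_pos h6).2 hu.sum_pos
  refine h1 e1 e3 fun i => ?_
  rw [e4]
  by_cases hi : α i = 0
  · rw [slack_apply_of_eq_zero _ hi]
    linarith [h3 i hi]
  · rw [slack_apply_of_ne_zero _ hi]
    linarith

end

/-! ### The state equation as an operator equation. -/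

section ControlSystem

variable {E G : Type*} [NormedAddCommGroup E] [NormedSpace ℝ E]
  [NormedAddCommGroup G] [NormedSpace ℝ G] {T : ℝ} (hT : 0 ≤ T)

/-- Constant functions. -/
def constMap (K : Type*) [TopologicalSpace K] [CompactSpace K] : E →L[ℝ] C(K, E) :=
  LinearMap.mkContinuous
    { toFun := fun v => ContinuousMap.const K v
      map_add' := fun _ _ => rfl
      map_smul' := fun _ _ => rfl } 1
    (fun v => by
      rw [one_mul]
      exact (ContinuousMap.norm_le _ (norm_nonneg v)).2 fun _ => le_rfl)

@[simp]
theorem constMap_apply {K : Type*} [TopologicalSpace K] [CompactSpace K] (v : E) (t : K) :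
    constMap K v t = v := rfl

/-- The functional `x ↦ ∫₀ᵀ q x`. -/
def pairing (q : C(Icc 0 T, StrongDual ℝ E)) : C(Icc 0 T, E) →L[ℝ] ℝ :=
  (ContinuousMap.evalCLM ℝ ⟨T, hT, le_rfl⟩).comp ((primitive hT).comp (pointwiseApply q))

theorem pairing_apply (q : C(Icc 0 T, StrongDual ℝ E)) (x : C(Icc 0 T, E)) :
    pairing hT q x = ∫ t in (0 : ℝ)..T, IccExtend hT q t (IccExtend hT x t) := rfl

/-- Testing against all continuous functions detects a continuous covector field. -/
theorem eq_zero_of_pairing_eq_zero (hT' : 0 < T) (q : C(Icc 0 T, StrongDual ℝ E))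
    (h : ∀ x, pairing hT'.le q x = 0) : q = 0 := by
  ext t g
  -- This test function turns the pairing into the integral of the continuous nonnegative function
  -- `(q g) ^ 2`.
  let x : C(Icc 0 T, E) := ⟨fun t => q t g • g, by fun_prop⟩
  have hx := h x
  rw [pairing_apply] at hx
  have hc : Continuous fun t => IccExtend hT'.le q t (IccExtend hT'.le x t) :=
    (continuous_extend _ q).clm_apply (continuous_extend _ x)
  have he : ∀ s, IccExtend hT'.le q s (IccExtend hT'.le x s) = (IccExtend hT'.le q s g) ^ 2 := by
    intro s
    simp only [IccExtend, Function.comp_apply, x, ContinuousMap.coe_mk, map_smul, smul_eq_mul]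
    ring
  simp only [ContinuousMap.zero_apply, zero_apply]
  by_contra hne
  refine absurd hx (ne_of_gt ?_)
  refine intervalIntegral.integral_pos hT' hc.continuousOn (fun s _ => ?_) ⟨t, t.2, ?_⟩
  · rw [he]; positivity
  · rw [he, IccExtend_val]; positivity

/-- Integration by parts between a costate and a state. -/
theorem pairing_add_pairing [CompleteSpace E] {p : ℝ → StrongDual ℝ E}
    {pc pd : C(Icc 0 T, StrongDual ℝ E)}
    (hpc : ∀ t : Icc 0 T, pc t = p t) (hp : ∀ t : Icc 0 T, HasDerivAt p (pd t) t)
    {x g : C(Icc 0 T, E)} {x₀ : E} (hx : x = constMap _ x₀ + primitive hT g) :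
    p T (x ⟨T, hT, le_rfl⟩) - p 0 x₀ = pairing hT pd x + pairing hT pc g := by
  have hgc := continuous_extend hT g
  set X : ℝ → E := fun t => x₀ + ∫ s in (0 : ℝ)..t, IccExtend hT g s with hX
  have hXx : ∀ t : Icc 0 T, X t = x t := fun t => by rw [hx]; rfl
  have hder : ∀ t : ℝ, HasDerivAt X (IccExtend hT g t) t := fun t =>
    (intervalIntegral.integral_hasDerivAt_right (hgc.intervalIntegrable _ _)
      (hgc.stronglyMeasurableAtFilter _ _) hgc.continuousAt).const_add x₀
  have hc1 : Continuous fun t => IccExtend hT pd t (IccExtend hT x t) :=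
    (continuous_extend _ _).clm_apply (continuous_extend _ _)
  have hc2 : Continuous fun t => IccExtend hT pc t (IccExtend hT g t) :=
    (continuous_extend _ _).clm_apply (continuous_extend _ _)
  have hftc := intervalIntegral.integral_eq_sub_of_hasDerivAt (a := 0) (b := T)
    (f := fun t => p t (X t))
    (f' := fun t => IccExtend hT pd t (IccExtend hT x t) + IccExtend hT pc t (IccExtend hT g t))
    (fun t ht => by
      rw [uIcc_of_le hT] at ht
      have h := (hp ⟨t, ht⟩).clm_apply (hder t)
      rw [IccExtend_of_mem hT _ ht, IccExtend_of_mem hT _ ht, IccExtend_of_mem hT _ ht,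
        IccExtend_of_mem hT _ ht, ← hXx, hpc]
      rw [IccExtend_of_mem hT _ ht] at h
      exact h)
    ((hc1.add hc2).intervalIntegrable _ _)
  rw [pairing_apply, pairing_apply, ← intervalIntegral.integral_add (hc1.intervalIntegrable _ _)
    (hc2.intervalIntegrable _ _), hftc, ← hXx]
  simp [hX]

variable (f : E × G → E)

/-- First component of a continuous function. -/
def stateOf : C(Icc 0 T, E × G) →L[ℝ] C(Icc 0 T, E) :=
  (ContinuousLinearMap.fst ℝ E G).compLeftContinuous ℝ (Icc 0 T)

@[simp]
theorem stateOf_apply (y : C(Icc 0 T, E × G)) (t : Icc 0 T) : stateOf y t = (y t).1 := rfl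

/-- The state equation in integral form: `x - x₀ - ∫₀ f (x, c)`. -/
def stateEq (hf : Continuous f) (w : E × C(Icc 0 T, E × G)) : C(Icc 0 T, E) :=
  stateOf w.2 - constMap _ w.1 - primitive hT (composeLeft f hf w.2)

/-- The linearized state equation with coefficients `A`. -/
def linStateEq (A : C(Icc 0 T, E × G →L[ℝ] E)) : E × C(Icc 0 T, E × G) →L[ℝ] C(Icc 0 T, E) :=
  stateOf.comp (ContinuousLinearMap.snd ℝ _ _) - (constMap _).comp (ContinuousLinearMap.fst ℝ _ _)
    - (primitive hT).comp ((pointwiseApply A).comp (ContinuousLinearMap.snd ℝ _ _))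

theorem linStateEq_apply (A : C(Icc 0 T, E × G →L[ℝ] E)) (w : E × C(Icc 0 T, E × G)) :
    linStateEq hT A w = stateOf w.2 - constMap _ w.1 - primitive hT (pointwiseApply A w.2) := rfl

theorem hasStrictFDerivAt_stateEq (hf : ContDiff ℝ 1 f) (w : E × C(Icc 0 T, E × G)) :
    HasStrictFDerivAt (stateEq hT f hf.continuous)
      (linStateEq hT (composeLeft (fderiv ℝ f) (hf.continuous_fderiv one_ne_zero) w.2)) w := by
  have hsnd : HasStrictFDerivAt (fun w : E × C(Icc 0 T, E × G) => w.2)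
    (ContinuousLinearMap.snd ℝ _ _) w := hasStrictFDerivAt_snd
  have hcomp := HasStrictFDerivAt.comp w (hasStrictFDerivAt_composeLeft hf w.2) hsnd
  have hcomp' := HasStrictFDerivAt.comp w (primitive hT).hasStrictFDerivAt hcomp
  have hlin := (stateOf.comp (ContinuousLinearMap.snd ℝ E C(Icc 0 T, E × G))
    - (constMap _).comp (ContinuousLinearMap.fst ℝ E C(Icc 0 T, E × G))).hasStrictFDerivAt (x := w)
  exact hlin.sub hcomp'

/-- Once the initial state and the control are fixed, the state solves a Volterra equation with
kernel `A` restricted to `E`. The freedom in `ξ` gives surjectivity of the linearization; the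
freedom in `x₀` and `c` gives the test trajectories for the costate. -/
theorem exists_linStateEq [CompleteSpace E] (A : C(Icc 0 T, E × G →L[ℝ] E)) (x₀ : E)
    (ξ : C(Icc 0 T, E)) (c : C(Icc 0 T, G)) :
    ∃ y : C(Icc 0 T, E × G), (∀ t, (y t).2 = c t) ∧ linStateEq hT A (x₀, y) = ξ := by
  let A₁ : C(Icc 0 T, E →L[ℝ] E) :=
    ⟨fun t => (A t).comp (ContinuousLinearMap.inl ℝ E G), by fun_prop⟩
  let d : C(Icc 0 T, E) := ⟨fun t => A t (0, c t), by fun_prop⟩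
  obtain ⟨R, hR⟩ := exists_resolvent hT A₁
  set x := R (ξ + constMap _ x₀ + primitive hT d) with hx
  have hRx := hR (ξ + constMap _ x₀ + primitive hT d)
  rw [← hx] at hRx
  refine ⟨⟨fun t => (x t, c t), by fun_prop⟩, fun t => rfl, ?_⟩
  set y : C(Icc 0 T, E × G) := ⟨fun t => (x t, c t), by fun_prop⟩
  have hAy : pointwiseApply A y = pointwiseApply A₁ x + d := by
    ext t
    change A t (x t, c t) = A t (x t, 0) + A t (0, c t)
    rw [← map_add]; simp
  have hsy : stateOf y = x := by ext t; rfl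
  rw [linStateEq_apply, hAy, hsy, map_add]
  simp only
  rw [← sub_eq_iff_eq_add] at hRx
  rw [← sub_eq_zero] at hRx ⊢
  rw [← hRx]
  abel

end ControlSystem

/-! ### Multipliers as annihilators of the endpoint image. -/

section EndpointProblem

variable {E G ι κ : Type*} [NormedAddCommGroup E] [NormedSpace ℝ E]
  [NormedAddCommGroup G] [NormedSpace ℝ G] [Fintype ι] [Fintype κ] {T : ℝ} (hT : 0 ≤ T)

/-- Endpoints `(x₀, x_T)`. -/
def endpoints : E × C(Icc 0 T, E × G) →L[ℝ] E × E :=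
  (ContinuousLinearMap.fst ℝ _ _).prod
    ((ContinuousLinearMap.fst ℝ E G).comp
      ((ContinuousMap.evalCLM ℝ ⟨T, hT, le_rfl⟩).comp (ContinuousLinearMap.snd ℝ _ _)))

theorem endpoints_apply (w : E × C(Icc 0 T, E × G)) :
    endpoints hT w = (w.1, (w.2 ⟨T, hT, le_rfl⟩).1) := rfl

/-- A linear combination of the endpoint functions. -/
def endpointSum (φ : ι → E × E → ℝ) (η : κ → E × E → ℝ) (α : ι → ℝ) (β : κ → ℝ) (q : E × E) : ℝ :=
  ∑ i, α i * φ i q + ∑ j, β j * η j q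

variable {φ : ι → E × E → ℝ} {η : κ → E × E → ℝ}

theorem hasFDerivAt_endpointSum (hφ : ∀ i, ContDiff ℝ 2 (φ i)) (hη : ∀ j, ContDiff ℝ 2 (η j))
    (α : ι → ℝ) (β : κ → ℝ) (q : E × E) :
    HasFDerivAt (endpointSum φ η α β)
      (∑ i, α i • fderiv ℝ (φ i) q + ∑ j, β j • fderiv ℝ (η j) q) q := by
  refine (HasFDerivAt.fun_sum fun i _ => ?_).add (HasFDerivAt.fun_sum fun j _ => ?_)
  · exact (((hφ i).differentiable two_ne_zero) q).hasFDerivAt.const_mul (α i)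
  · exact (((hη j).differentiable two_ne_zero) q).hasFDerivAt.const_mul (β j)

theorem contDiff_endpointSum (hφ : ∀ i, ContDiff ℝ 2 (φ i)) (hη : ∀ j, ContDiff ℝ 2 (η j))
    (α : ι → ℝ) (β : κ → ℝ) : ContDiff ℝ 2 (endpointSum φ η α β) := by
  refine (ContDiff.sum fun i _ => ?_).add (ContDiff.sum fun j _ => ?_)
  · exact contDiff_const.mul (hφ i)
  · exact contDiff_const.mul (hη j)

/-- The costate equation, transversality and stationarity conditions for the covector field `p`
along `y`. -/
structure IsCostate (f : E × G → E) (φ : ι → E × E → ℝ) (η : κ → E × E → ℝ) (x₀ : E)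
    (y : C(Icc 0 T, E × G)) (α : ι → ℝ) (β : κ → ℝ) (p : ℝ → StrongDual ℝ E) : Prop where
  deriv : ∀ t : Icc 0 T,
    HasDerivAt p (-(p t).comp ((fderiv ℝ f (y t)).comp (ContinuousLinearMap.inl ℝ E G))) t
  left : p 0 = -(fderiv ℝ (endpointSum φ η α β) (endpoints hT (x₀, y))).comp
    (ContinuousLinearMap.inl ℝ E E)
  right : p T = (fderiv ℝ (endpointSum φ η α β) (endpoints hT (x₀, y))).comp
    (ContinuousLinearMap.inr ℝ E E)
  stationary : ∀ t : Icc 0 T,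
    (p t).comp ((fderiv ℝ f (y t)).comp (ContinuousLinearMap.inr ℝ E G)) = 0

/-- The derivatives of the endpoint functions on the kernel of the linearized state equation. -/
def endpointImage (f : E × G → E) (hf : ContDiff ℝ 2 f) (φ : ι → E × E → ℝ) (η : κ → E × E → ℝ)
    (x₀ : E) (y : C(Icc 0 T, E × G)) : Submodule ℝ ((ι → ℝ) × (κ → ℝ)) :=
  (LinearMap.ker (linStateEq hT (composeLeft (fderiv ℝ f) (hf.continuous_fderiv two_ne_zero) y) :
      E × C(Icc 0 T, E × G) →ₗ[ℝ] C(Icc 0 T, E))).map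
    ((((ContinuousLinearMap.pi fun i => fderiv ℝ (φ i) (endpoints hT (x₀, y))).comp (endpoints hT) :
        E × C(Icc 0 T, E × G) →L[ℝ] ι → ℝ) : E × C(Icc 0 T, E × G) →ₗ[ℝ] ι → ℝ).prod
      (((ContinuousLinearMap.pi fun j => fderiv ℝ (η j) (endpoints hT (x₀, y))).comp
        (endpoints hT) :
        E × C(Icc 0 T, E × G) →L[ℝ] κ → ℝ) : E × C(Icc 0 T, E × G) →ₗ[ℝ] κ → ℝ))

variable {f : E × G → E} (hf : ContDiff ℝ 2 f)
  {x₀ : E} {y : C(Icc 0 T, E × G)} {α : ι → ℝ} {β : κ → ℝ}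

theorem annihilates_endpointImage_iff (hφ : ∀ i, ContDiff ℝ 2 (φ i))
    (hη : ∀ j, ContDiff ℝ 2 (η j)) :
    Annihilates (endpointImage hT f hf φ η x₀ y) α β ↔
      ∀ z, linStateEq hT (composeLeft (fderiv ℝ f) (hf.continuous_fderiv two_ne_zero) y) z = 0 →
        fderiv ℝ (endpointSum φ η α β) (endpoints hT (x₀, y)) (endpoints hT z) = 0 := by
  have key : ∀ z : E × C(Icc 0 T, E × G), fderiv ℝ (endpointSum φ η α β) (endpoints hT (x₀, y)) (endpoints hT z)
      = ∑ i, α i * fderiv ℝ (φ i) (endpoints hT (x₀, y)) (endpoints hT z)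
        + ∑ j, β j * fderiv ℝ (η j) (endpoints hT (x₀, y)) (endpoints hT z) := fun z => by
    rw [(hasFDerivAt_endpointSum hφ hη α β _).fderiv]
    simp
  constructor
  · intro h z hz
    rw [key]
    exact h _ ⟨z, hz, rfl⟩
  · rintro h _ ⟨z, hz, rfl⟩
    exact (key z).symm.trans (h z hz)

/-- Duality between the costate and the linearized states. -/
theorem costate_duality [CompleteSpace E] {p : ℝ → StrongDual ℝ E}
    (hp : ∀ t : Icc 0 T,
      HasDerivAt p (-(p t).comp ((fderiv ℝ f (y t)).comp (ContinuousLinearMap.inl ℝ E G))) t)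
    (pc : C(Icc 0 T, StrongDual ℝ E)) (hpc : ∀ t : Icc 0 T, pc t = p t)
    {z : E × C(Icc 0 T, E × G)}
    (hz : linStateEq hT (composeLeft (fderiv ℝ f) (hf.continuous_fderiv two_ne_zero) y) z = 0) :
    p T (z.2 ⟨T, hT, le_rfl⟩).1 - p 0 z.1 =
      ∫ t in (0 : ℝ)..T, IccExtend hT pc t
        (fderiv ℝ f (IccExtend hT y t) (0, (IccExtend hT z.2 t).2)) := by
  have hdf := hf.continuous_fderiv two_ne_zero
  let pd : C(Icc 0 T, StrongDual ℝ E) :=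
    ⟨fun t => -(pc t).comp ((fderiv ℝ f (y t)).comp (ContinuousLinearMap.inl ℝ E G)), by fun_prop⟩
  have hx : stateOf z.2 = constMap _ z.1 + primitive hT
      (pointwiseApply (composeLeft (fderiv ℝ f) hdf y) z.2) := by
    rw [linStateEq_apply, sub_sub, sub_eq_zero] at hz
    exact hz
  have h := pairing_add_pairing hT (pd := pd) hpc
    (fun t => by simp only [pd, ContinuousMap.coe_mk, hpc]; exact hp t) hx
  rw [stateOf_apply] at h
  rw [h, pairing_apply, pairing_apply, ← intervalIntegral.integral_add]
  · refine intervalIntegral.integral_congr fun t _ => ?_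
    simp only [IccExtend, Function.comp_apply, pd, ContinuousMap.coe_mk, pointwiseApply_apply,
      composeLeft_apply, stateOf_apply, neg_apply, ContinuousLinearMap.comp_apply,
      ContinuousLinearMap.inl_apply]
    rw [← map_neg, ← map_add, ← map_neg, ← map_add]
    congr 2
    ext <;> simp
  · exact ((continuous_extend _ _).clm_apply (continuous_extend _ _)).intervalIntegrable _ _
  · exact ((continuous_extend _ _).clm_apply (continuous_extend _ _)).intervalIntegrable _ _

/-- On a linearized trajectory, duality and transversality express the derivative of the endpoint
sum as an integral whose integrand vanishes by stationarity. -/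
theorem IsCostate.annihilates [CompleteSpace E] (hφ : ∀ i, ContDiff ℝ 2 (φ i))
    (hη : ∀ j, ContDiff ℝ 2 (η j)) {p : ℝ → StrongDual ℝ E}
    (hp : IsCostate hT f φ η x₀ y α β p) :
    Annihilates (endpointImage hT f hf φ η x₀ y) α β := by
  rw [annihilates_endpointImage_iff hT hf hφ hη]
  intro z hz
  let pc : C(Icc 0 T, StrongDual ℝ E) :=
    ⟨fun t => p t, continuous_iff_continuousAt.2 fun t =>
      (hp.deriv t).continuousAt.comp continuous_subtype_val.continuousAt⟩
  have h := costate_duality hT hf hp.deriv pc (fun _ => rfl) hz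
  rw [intervalIntegral.integral_zero_ae (Eventually.of_forall fun t _ => ?_)] at h
  · rw [hp.left, hp.right] at h
    simp only [neg_apply, ContinuousLinearMap.comp_apply, ContinuousLinearMap.inl_apply,
      ContinuousLinearMap.inr_apply, sub_neg_eq_add] at h
    rw [← map_add] at h
    refine Eq.trans ?_ h
    congr 1
    rw [endpoints_apply]
    simp
  · exact DFunLike.congr_fun (hp.stationary (projIcc 0 T hT t)) _

/-- Every annihilator of the endpoint image comes with a costate. -/
theorem exists_isCostate [CompleteSpace E] (hT' : 0 < T) (hφ : ∀ i, ContDiff ℝ 2 (φ i))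
    (hη : ∀ j, ContDiff ℝ 2 (η j))
    (h : Annihilates (endpointImage hT'.le f hf φ η x₀ y) α β) :
    ∃ p, IsCostate hT'.le f φ η x₀ y α β p := by
  rw [annihilates_endpointImage_iff hT'.le hf hφ hη] at h
  have hdf := hf.continuous_fderiv two_ne_zero
  set D := fderiv ℝ (endpointSum φ η α β) (endpoints hT'.le (x₀, y)) with hD
  -- The costate equation is solved backwards from the transversality condition at `T`: `A`
  -- generates the time-reversed equation.
  let A : ℝ → StrongDual ℝ E →L[ℝ] StrongDual ℝ E := fun t =>
    (ContinuousLinearMap.compL ℝ E E ℝ).flip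
      ((fderiv ℝ f (IccExtend hT'.le y (T - t))).comp (ContinuousLinearMap.inl ℝ E G))
  have hA : Continuous A := by
    have h1 : Continuous fun t => IccExtend hT'.le y (T - t) :=
      (continuous_extend _ y).comp (by fun_prop)
    have h2 : Continuous fun t => (fderiv ℝ f (IccExtend hT'.le y (T - t))).comp
        (ContinuousLinearMap.inl ℝ E G) := (hdf.comp h1).clm_comp continuous_const
    exact (ContinuousLinearMap.continuous _).comp h2
  obtain ⟨q, hqc, hq0, hq⟩ := exists_linear_ode hT'.le A hA (D.comp (ContinuousLinearMap.inr ℝ E E))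
  set p : ℝ → StrongDual ℝ E := fun t => q (T - t) with hp
  have hder : ∀ t : Icc 0 T, HasDerivAt p
      (-(p t).comp ((fderiv ℝ f (y t)).comp (ContinuousLinearMap.inl ℝ E G))) t := by
    intro t
    have h1 := hq (T - t) ⟨by linarith [t.2.2], by linarith [t.2.1]⟩
    have h2 := h1.scomp_of_eq (t : ℝ) ((hasDerivAt_id (t : ℝ)).const_sub T) rfl
    have h3 : A (T - t) (q (T - t))
        = (p t).comp ((fderiv ℝ f (y t)).comp (ContinuousLinearMap.inl ℝ E G)) := by
      simp only [A, hp, sub_sub_cancel]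
      rw [IccExtend_val]
      rfl
    rw [h3, neg_one_smul] at h2
    exact h2
  let pc : C(Icc 0 T, StrongDual ℝ E) := ⟨fun t => p t, by fun_prop⟩
  have hpT : p T = D.comp (ContinuousLinearMap.inr ℝ E E) := by simp [hp, hq0]
  have hdual : ∀ z, linStateEq hT'.le (composeLeft (fderiv ℝ f) hdf y) z = 0 →
      D (z.1, 0) + p 0 z.1 + ∫ t in (0 : ℝ)..T, IccExtend hT'.le pc t
        (fderiv ℝ f (IccExtend hT'.le y t) (0, (IccExtend hT'.le z.2 t).2)) = 0 := by
    intro z hz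
    rw [← costate_duality hT'.le hf hder pc (fun _ => rfl) hz, hpT]
    have h1 := h z hz
    rw [endpoints_apply (w := z)] at h1
    have h2 : D (z.1, (z.2 ⟨T, hT'.le, le_rfl⟩).1)
        = D (z.1, 0) + D (0, (z.2 ⟨T, hT'.le, le_rfl⟩).1) := by rw [← map_add]; simp
    rw [h2] at h1
    simp only [ContinuousLinearMap.comp_apply, ContinuousLinearMap.inr_apply]
    linarith
  -- Tested with an arbitrary initial state and zero control.
  have hleft : p 0 = -D.comp (ContinuousLinearMap.inl ℝ E E) := by
    ext v
    obtain ⟨c, hc, hz⟩ := exists_linStateEq hT'.le (composeLeft (fderiv ℝ f) hdf y) v 0 0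
    have h1 := hdual _ hz
    rw [intervalIntegral.integral_zero_ae (Eventually.of_forall fun t _ => ?_)] at h1
    · simp only [neg_apply, ContinuousLinearMap.comp_apply, ContinuousLinearMap.inl_apply]
      linarith
    · simp only [IccExtend, Function.comp_apply, hc, ContinuousMap.zero_apply]
      rw [← Prod.zero_eq_mk, map_zero, map_zero]
  refine ⟨p, hder, hleft, hpT, fun t => ?_⟩
  let qs : C(Icc 0 T, StrongDual ℝ G) :=
    ⟨fun t => (pc t).comp ((fderiv ℝ f (y t)).comp (ContinuousLinearMap.inr ℝ E G)), by fun_prop⟩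
  -- Tested with zero initial state and an arbitrary continuous control.
  have hqs : qs = 0 := eq_zero_of_pairing_eq_zero hT' qs fun c => by
    obtain ⟨d, hd, hz⟩ := exists_linStateEq hT'.le (composeLeft (fderiv ℝ f) hdf y) 0 0 c
    have h1 := hdual _ hz
    rw [← Prod.zero_eq_mk, map_zero, map_zero, zero_add, zero_add] at h1
    rw [pairing_apply]
    refine Eq.trans ?_ h1
    refine intervalIntegral.integral_congr fun s _ => ?_
    simp only [IccExtend, Function.comp_apply, hd, qs]
    rfl
  exact DFunLike.congr_fun hqs t

end EndpointProblem

/-! ### The Lagrangian and the second variation. -/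

theorem exists_hasFDerivAt_comp_comp {W X Y Z : Type*} [NormedAddCommGroup W] [NormedSpace ℝ W]
    [NormedAddCommGroup X] [NormedSpace ℝ X] [NormedAddCommGroup Y] [NormedSpace ℝ Y]
    [NormedAddCommGroup Z] [NormedSpace ℝ Z] (P : Y →L[ℝ] Z) (s : W →L[ℝ] X)
    {g : W → X →L[ℝ] Y} {g' : W →L[ℝ] X →L[ℝ] Y} {w : W} (h : HasFDerivAt g g' w) :
    ∃ Q : W →L[ℝ] W →L[ℝ] Z, HasFDerivAt (fun w => (P.comp (g w)).comp s) Q w ∧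
      ∀ z z', Q z z' = P (g' z (s z')) := by
  let Ψ : (X →L[ℝ] Y) →L[ℝ] W →L[ℝ] Z :=
    ((ContinuousLinearMap.compL ℝ W X Z).flip s).comp (ContinuousLinearMap.compL ℝ X Y Z P)
  have hΨ : HasFDerivAt (fun a => Ψ a) Ψ (g w) := Ψ.hasFDerivAt
  exact ⟨Ψ.comp g', HasFDerivAt.comp w hΨ h, fun _ _ => rfl⟩

theorem hasFDerivAt_add_const_add {W Y : Type*} [NormedAddCommGroup W] [NormedSpace ℝ W]
    [NormedAddCommGroup Y] [NormedSpace ℝ Y] {g g₁ g₂ : W → Y} {Q₁ Q₂ : W →L[ℝ] Y} {w : W} {c : Y}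
    (h₁ : HasFDerivAt g₁ Q₁ w) (h₂ : HasFDerivAt g₂ Q₂ w) (h : ∀ w, g w = g₁ w + c + g₂ w) :
    HasFDerivAt g (Q₁ + Q₂) w := by
  rw [funext h]
  exact (h₁.add_const c).add h₂

section SecondVariation

variable {E G : Type*} [NormedAddCommGroup E] [NormedSpace ℝ E]
  [NormedAddCommGroup G] [NormedSpace ℝ G] {T : ℝ} (hT : 0 ≤ T)

theorem hasStrictFDerivAt_endpoints (w : E × C(Icc 0 T, E × G)) :
    HasStrictFDerivAt (fun w : E × C(Icc 0 T, E × G) => endpoints hT w) (endpoints hT) w :=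
  ContinuousLinearMap.hasStrictFDerivAt _

/-- The Lagrangian with the state equation integrated by parts: `ℓ` at the endpoints, a linear
functional, and `∫ p f`. -/
def lagrangian (f : E × G → E) (hf : Continuous f) (ℓ : E × E → ℝ)
    (Λ : E × C(Icc 0 T, E × G) →L[ℝ] ℝ) (P : C(Icc 0 T, E) →L[ℝ] ℝ)
    (w : E × C(Icc 0 T, E × G)) : ℝ :=
  ℓ (endpoints hT w) + Λ w + P (composeLeft f hf w.2)

/-- First derivative of the Lagrangian. -/
def lagrangianDeriv (f : E × G → E) (hf : ContDiff ℝ 2 f) (ℓ : E × E → ℝ)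
    (Λ : E × C(Icc 0 T, E × G) →L[ℝ] ℝ) (P : C(Icc 0 T, E) →L[ℝ] ℝ)
    (w : E × C(Icc 0 T, E × G)) : E × C(Icc 0 T, E × G) →L[ℝ] ℝ :=
  (fderiv ℝ ℓ (endpoints hT w)).comp (endpoints hT) + Λ +
    (P.comp (pointwiseApply (composeLeft (fderiv ℝ f) (hf.continuous_fderiv two_ne_zero) w.2))).comp
      (ContinuousLinearMap.snd ℝ _ _)

theorem hasFDerivAt_lagrangian {f : E × G → E} (hf : ContDiff ℝ 2 f) {ℓ : E × E → ℝ}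
    (hℓ : ContDiff ℝ 2 ℓ) (Λ : E × C(Icc 0 T, E × G) →L[ℝ] ℝ) (P : C(Icc 0 T, E) →L[ℝ] ℝ)
    (w : E × C(Icc 0 T, E × G)) :
    HasFDerivAt (lagrangian hT f hf.continuous ℓ Λ P) (lagrangianDeriv hT f hf ℓ Λ P w) w := by
  have h1 := ((hℓ.differentiable two_ne_zero) (endpoints hT w)).hasFDerivAt.comp w
    (hasStrictFDerivAt_endpoints hT w).hasFDerivAt
  have h2 := ((hasStrictFDerivAt_composeLeft (hf.of_le one_le_two) w.2).hasFDerivAt).comp w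
    (hasFDerivAt_snd (𝕜 := ℝ) (E := E) (F := C(Icc 0 T, E × G)) (p := w))
  have h3 := P.hasFDerivAt.comp w h2
  exact (h1.add Λ.hasFDerivAt).add h3

/-- The only infinite-dimensional nonlinearity is the superposition operator of `fderiv ℝ f`, which
is differentiable because `fderiv ℝ f` is `C¹`. Only the diagonal values of the second derivative
are recorded. -/
theorem exists_hasFDerivAt_lagrangianDeriv {f : E × G → E} (hf : ContDiff ℝ 2 f) {ℓ : E × E → ℝ}
    (hℓ : ContDiff ℝ 2 ℓ) (Λ : E × C(Icc 0 T, E × G) →L[ℝ] ℝ) (P : C(Icc 0 T, E) →L[ℝ] ℝ)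
    (w : E × C(Icc 0 T, E × G)) :
    ∃ Q : E × C(Icc 0 T, E × G) →L[ℝ] E × C(Icc 0 T, E × G) →L[ℝ] ℝ,
      HasFDerivAt (lagrangianDeriv hT f hf ℓ Λ P) Q w ∧
      ∀ z, Q z z = fderiv ℝ (fderiv ℝ ℓ) (endpoints hT w) (endpoints hT z) (endpoints hT z)
        + P (pointwiseApply (pointwiseApply (composeLeft (fderiv ℝ (fderiv ℝ f))
          ((hf.fderiv_right (m := 1) (by norm_num)).continuous_fderiv one_ne_zero) w.2) z.2)
            z.2) := by
  have hf1 : ContDiff ℝ 1 (fderiv ℝ f) := hf.fderiv_right (by norm_num)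
  have hℓ1 : ContDiff ℝ 1 (fderiv ℝ ℓ) := hℓ.fderiv_right (by norm_num)
  have h0 := (((hℓ1.differentiable one_ne_zero) (endpoints hT w)).hasFDerivAt).comp w
    (hasStrictFDerivAt_endpoints hT w).hasFDerivAt
  have h2 := ((hasStrictFDerivAt_composeLeft hf1 w.2).hasFDerivAt).comp w
    (hasFDerivAt_snd (𝕜 := ℝ) (E := E) (F := C(Icc 0 T, E × G)) (p := w))
  have h2' : HasFDerivAt (fun w : E × C(Icc 0 T, E × G) =>
        pointwiseApply (composeLeft (fderiv ℝ f) hf1.continuous w.2))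
      (pointwiseApply.comp ((pointwiseApply (composeLeft (fderiv ℝ (fderiv ℝ f))
        (hf1.continuous_fderiv one_ne_zero) w.2)).comp (ContinuousLinearMap.snd ℝ _ _))) w := by
    refine HasFDerivAt.comp (g := fun a => pointwiseApply a)
      (f := fun w : E × C(Icc 0 T, E × G) => composeLeft (fderiv ℝ f) hf1.continuous w.2) w ?_ h2
    exact ContinuousLinearMap.hasFDerivAt _
  obtain ⟨Q₁, hQ₁, hQ₁z⟩ := exists_hasFDerivAt_comp_comp (ContinuousLinearMap.id ℝ ℝ)
    (endpoints hT) h0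
  obtain ⟨Q₂, hQ₂, hQ₂z⟩ := exists_hasFDerivAt_comp_comp P
    (ContinuousLinearMap.snd ℝ E C(Icc 0 T, E × G)) h2'
  refine ⟨Q₁ + Q₂, hasFDerivAt_add_const_add (c := Λ) hQ₁ hQ₂ fun v => ?_, fun z => ?_⟩
  · rw [ContinuousLinearMap.id_comp]
    rfl
  rw [add_apply, add_apply, hQ₁z, hQ₂z]
  rfl

variable {ι κ : Type*} [Fintype ι] [Fintype κ] {φ : ι → E × E → ℝ} {η : κ → E × E → ℝ}

/-- Second order necessary condition for an optimal control problem with a unique multiplier, on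
the linearized trajectories with vanishing endpoints. -/
theorem second_variation_nonneg [CompleteSpace E] [CompleteSpace G] (hT : 0 < T) {f : E × G → E}
    (hf : ContDiff ℝ 2 f) (hφ : ∀ i, ContDiff ℝ 2 (φ i)) (hη : ∀ j, ContDiff ℝ 2 (η j))
    {x₀ : E} {y : C(Icc 0 T, E × G)} (hs : stateEq hT.le f hf.continuous (x₀, y) = 0)
    (hη0 : ∀ j, η j (endpoints hT.le (x₀, y)) = 0) {α : ι → ℝ} {β : κ → ℝ} {p : ℝ → StrongDual ℝ E}
    (hα : ∀ i, 0 ≤ α i) (hne : α ≠ 0 ∨ β ≠ 0) (hp : IsCostate hT.le f φ η x₀ y α β p)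
    (huniq : ∀ α' β' p', (∀ i, 0 ≤ α' i) → (α' ≠ 0 ∨ β' ≠ 0) →
      IsCostate hT.le f φ η x₀ y α' β' p' → ∃ c : ℝ, 0 ≤ c ∧ α' = c • α ∧ β' = c • β)
    (hmin : ∃ ε > 0, ∀ w, ‖w - (x₀, y)‖ < ε → stateEq hT.le f hf.continuous w = 0 →
      (∀ j, η j (endpoints hT.le w) = 0) →
        ¬ ∀ i, φ i (endpoints hT.le w) < φ i (endpoints hT.le (x₀, y)))
    {z : C(Icc 0 T, E × G)}
    (hz : linStateEq hT.le (composeLeft (fderiv ℝ f) (hf.continuous_fderiv two_ne_zero) y) (0, z)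
      = 0) (hzT : (z ⟨T, hT.le, le_rfl⟩).1 = 0) :
    0 ≤ ∫ t in (0 : ℝ)..T, p t (fderiv ℝ (fderiv ℝ f) (IccExtend hT.le y t)
      (IccExtend hT.le z t) (IccExtend hT.le z t)) := by
  have hdf := hf.continuous_fderiv two_ne_zero
  set e := endpoints hT.le (x₀, y) with he
  let pc : C(Icc 0 T, StrongDual ℝ E) :=
    ⟨fun t => p t, continuous_iff_continuousAt.2 fun t =>
      (hp.deriv t).continuousAt.comp continuous_subtype_val.continuousAt⟩
  let pd : C(Icc 0 T, StrongDual ℝ E) :=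
    ⟨fun t => -(pc t).comp ((fderiv ℝ f (y t)).comp (ContinuousLinearMap.inl ℝ E G)), by fun_prop⟩
  -- The optimal cost need not be zero; it is subtracted so that the Lagrangian vanishes at the
  -- reference.
  let ℓ : E × E → ℝ := fun q => endpointSum φ η α β q - endpointSum φ η α β e
  have hℓ : ContDiff ℝ 2 ℓ := (contDiff_endpointSum hφ hη α β).sub contDiff_const
  have hℓ' : fderiv ℝ ℓ e = fderiv ℝ (endpointSum φ η α β) e := fderiv_sub_const _
  -- This is `p 0 x₀ - p T x_T + ∫ p' x`. By integration by parts its sum with `∫ p f` vanishes on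
  -- every solution of the state equation, so the Lagrangian equals `ℓ` there.
  let Λ : E × C(Icc 0 T, E × G) →L[ℝ] ℝ :=
    (p 0).comp ((ContinuousLinearMap.fst ℝ E E).comp (endpoints hT.le))
      - (p T).comp ((ContinuousLinearMap.snd ℝ E E).comp (endpoints hT.le))
      + (pairing hT.le pd).comp (stateOf.comp (ContinuousLinearMap.snd ℝ _ _))
  let L := lagrangian hT.le f hf.continuous ℓ Λ (pairing hT.le pc)
  obtain ⟨Q, hQ, hQz⟩ := exists_hasFDerivAt_lagrangianDeriv hT.le hf hℓ Λ (pairing hT.le pc) (x₀, y)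
  have hLdual : ∀ w, stateEq hT.le f hf.continuous w = 0 →
      Λ w + pairing hT.le pc (composeLeft f hf.continuous w.2) = 0 := by
    intro w hw
    rw [stateEq, sub_sub, sub_eq_zero] at hw
    have h := pairing_add_pairing hT.le (pc := pc) (pd := pd) (fun _ => rfl) hp.deriv hw
    change p 0 w.1 - p T (w.2 ⟨T, hT.le, le_rfl⟩).1 + pairing hT.le pd (stateOf w.2) + _ = 0
    rw [stateOf_apply] at h
    linarith
  have hL0 : L (x₀, y) = 0 := by
    have h1 : ℓ e = 0 := sub_self _
    have h2 := hLdual _ hs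
    change ℓ e + Λ (x₀, y) + _ = 0
    rw [h1, zero_add]
    exact h2
  -- Endpoint terms cancel by transversality, state terms by the costate equation, control terms by
  -- stationarity.
  have hL' : lagrangianDeriv hT.le f hf ℓ Λ (pairing hT.le pc) (x₀, y) = 0 := by
    refine ContinuousLinearMap.ext fun v => ?_
    change fderiv ℝ ℓ e (endpoints hT.le v) + (p 0 v.1 - p T (v.2 ⟨T, hT.le, le_rfl⟩).1
      + pairing hT.le pd (stateOf v.2))
      + pairing hT.le pc (pointwiseApply (composeLeft (fderiv ℝ f) hdf y) v.2) = 0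
    have h1 : fderiv ℝ ℓ e (endpoints hT.le v) = -p 0 v.1 + p T (v.2 ⟨T, hT.le, le_rfl⟩).1 := by
      rw [hp.left, hp.right, hℓ', endpoints_apply (w := v)]
      simp only [neg_apply, ContinuousLinearMap.comp_apply, ContinuousLinearMap.inl_apply,
        ContinuousLinearMap.inr_apply, neg_neg]
      rw [← map_add]
      simp [he]
    have h2 : pairing hT.le pd (stateOf v.2)
        + pairing hT.le pc (pointwiseApply (composeLeft (fderiv ℝ f) hdf y) v.2) = 0 := by
      rw [pairing_apply, pairing_apply, ← intervalIntegral.integral_add]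
      · refine intervalIntegral.integral_zero_ae (Eventually.of_forall fun t _ => ?_)
        have hst := DFunLike.congr_fun (hp.stationary (projIcc 0 T hT.le t))
          (v.2 (projIcc 0 T hT.le t)).2
        simp only [ContinuousLinearMap.comp_apply, ContinuousLinearMap.inr_apply, zero_apply] at hst
        simp only [IccExtend, Function.comp_apply, pd, ContinuousMap.coe_mk,
          pointwiseApply_apply, composeLeft_apply, stateOf_apply, neg_apply,
          ContinuousLinearMap.comp_apply, ContinuousLinearMap.inl_apply, pc]
        refine Eq.trans ?_ hst
        rw [← map_neg, ← map_add, ← map_neg, ← map_add]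
        congr 2
        ext <;> simp
      · exact ((continuous_extend _ _).clm_apply (continuous_extend _ _)).intervalIntegrable _ _
      · exact ((continuous_extend _ _).clm_apply (continuous_extend _ _)).intervalIntegrable _ _
    rw [h1]
    linarith
  have htaylor := isLittleO_taylor_two (Eventually.of_forall
    (hasFDerivAt_lagrangian hT.le hf hℓ Λ (pairing hT.le pc))) hQ
  have hQo : (fun w => L w - (1 / 2 : ℝ) * Q (w - (x₀, y)) (w - (x₀, y)))
      =o[𝓝 (x₀, y)] fun w => ‖w - (x₀, y)‖ ^ 2 := by
    refine htaylor.congr_left fun w => ?_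
    rw [hL']
    change L w - L (x₀, y) - _ - _ = _
    rw [hL0]
    simp
  have hφs : HasStrictFDerivAt
      (fun (w : E × C(Icc 0 T, E × G)) i => φ i (endpoints hT.le w) - φ i e)
      ((ContinuousLinearMap.pi fun i => fderiv ℝ (φ i) e).comp (endpoints hT.le)) (x₀, y) := by
    refine hasStrictFDerivAt_pi'' fun i => ?_
    exact ((((hφ i).contDiffAt.hasStrictFDerivAt two_ne_zero).comp (x₀, y)
      (hasStrictFDerivAt_endpoints hT.le _))).sub_const _
  have hηs : HasStrictFDerivAt
      (fun (w : E × C(Icc 0 T, E × G)) j => η j (endpoints hT.le w))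
      ((ContinuousLinearMap.pi fun j => fderiv ℝ (η j) e).comp (endpoints hT.le)) (x₀, y) := by
    refine hasStrictFDerivAt_pi'' fun j => ?_
    exact (((hη j).contDiffAt.hasStrictFDerivAt two_ne_zero).comp (x₀, y)
      (hasStrictFDerivAt_endpoints hT.le _))
  have hu : IsUniqueAnnihilator (endpointImage hT.le f hf φ η x₀ y) α β :=
    { annihilates := hp.annihilates hT.le hf hφ hη
      nonneg := hα
      ne_zero := hne
      unique := fun α' β' hα' hann => by
        by_cases h0 : α' = 0 ∧ β' = 0
        · exact ⟨0, le_rfl, by simp [h0.1], by simp [h0.2]⟩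
        · obtain ⟨p', hp'⟩ := exists_isCostate hf hT hφ hη hann
          exact huniq α' β' p' hα' (not_and_or.1 h0) hp' }
  -- Zero endpoints put `z` in the kernel of all endpoint derivatives and remove `D²ℓ` from the
  -- second derivative.
  have hez : endpoints hT.le (0, z) = 0 := by
    rw [endpoints_apply, hzT]; rfl
  have hfin := second_order_necessary (hasStrictFDerivAt_stateEq hT.le f (hf.of_le one_le_two)
    (x₀, y)) hφs hηs hs (by ext i; exact sub_self _) (by ext j; exact hη0 j)
    (fun ξ => by
      obtain ⟨d, -, hd⟩ := exists_linStateEq hT.le (composeLeft (fderiv ℝ f) hdf y) 0 ξ 0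
      exact ⟨(0, d), hd⟩)
    hu (L := L) (fun w hw => by
      have h1 := hLdual w hw
      change _ = endpointSum φ η α β (endpoints hT.le w) - endpointSum φ η α β e + Λ w + _
      rw [add_assoc, h1]
      simp only [endpointSum, hη0, mul_sub, Finset.sum_sub_distrib, mul_zero, Finset.sum_const_zero]
      ring)
    hQo
    (by
      obtain ⟨ε, hε, h⟩ := hmin
      filter_upwards [Metric.ball_mem_nhds (x₀, y) hε] with w hw h1 h2 h3
      rw [mem_ball_iff_norm] at hw
      exact h w hw h1 (fun j => congrFun h2 j) fun i => sub_neg.1 (h3 i))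
    hz (by simp only [ContinuousLinearMap.comp_apply, hez, map_zero])
    (by simp only [ContinuousLinearMap.comp_apply, hez, map_zero])
  rw [hQz, hez] at hfin
  simp only [map_zero, zero_add] at hfin
  rw [pairing_apply] at hfin
  refine hfin.trans (le_of_eq (intervalIntegral.integral_congr fun t ht => ?_))
  rw [uIcc_of_le hT.le] at ht
  simp only [IccExtend, Function.comp_apply, pc, ContinuousMap.coe_mk, pointwiseApply_apply,
    composeLeft_apply, projIcc_of_mem hT.le ht]

end SecondVariation

/-! ### Goh transformation of a linear-quadratic functional. -/

/-- Coefficients of a linear-quadratic functional of `(x, u, v)` on `[0, T]`, without term of second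
order in `v`. The fields `Fv'` and `Qvx'` are the time derivatives of `Fv` and `Qvx`. -/
structure LQCoeffs (E U V : Type*) [NormedAddCommGroup E] [NormedSpace ℝ E]
    [NormedAddCommGroup U] [NormedSpace ℝ U] [NormedAddCommGroup V] [NormedSpace ℝ V] where
  T : ℝ
  pos : 0 < T
  Fx : ℝ → E →L[ℝ] E
  Fu : ℝ → U →L[ℝ] E
  Fv : ℝ → V →L[ℝ] E
  Fv' : ℝ → V →L[ℝ] E
  Qxx : ℝ → E →L[ℝ] E →L[ℝ] ℝ
  Qux : ℝ → U →L[ℝ] E →L[ℝ] ℝ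
  Quu : ℝ → U →L[ℝ] U →L[ℝ] ℝ
  Qvu : ℝ → V →L[ℝ] U →L[ℝ] ℝ
  Qvx : ℝ → V →L[ℝ] E →L[ℝ] ℝ
  Qvx' : ℝ → V →L[ℝ] E →L[ℝ] ℝ
  continuous_Fx : Continuous Fx
  continuous_Fu : Continuous Fu
  continuous_Fv : Continuous Fv
  continuous_Fv' : Continuous Fv'
  continuous_Qxx : Continuous Qxx
  continuous_Qux : Continuous Qux
  continuous_Quu : Continuous Quu
  continuous_Qvu : Continuous Qvu
  continuous_Qvx : Continuous Qvx
  continuous_Qvx' : Continuous Qvx'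
  hasDerivAt_Fv : ∀ t ∈ Ioo 0 T, HasDerivAt Fv (Fv' t) t
  hasDerivAt_Qvx : ∀ t ∈ Ioo 0 T, HasDerivAt Qvx (Qvx' t) t

namespace LQCoeffs

attribute [fun_prop] continuous_Fx continuous_Fu continuous_Fv continuous_Fv' continuous_Qxx
  continuous_Qux continuous_Quu continuous_Qvu continuous_Qvx continuous_Qvx'

variable {E U V : Type*} [NormedAddCommGroup E] [NormedSpace ℝ E]
  [NormedAddCommGroup U] [NormedSpace ℝ U] [NormedAddCommGroup V] [NormedSpace ℝ V]
  (D : LQCoeffs E U V)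

/-- The integrand of the quadratic functional. -/
def cost (t : ℝ) (x : E) (u : U) (v : V) : ℝ :=
  D.Qxx t x x + 2 * D.Qux t u x + D.Quu t u u + 2 * D.Qvu t v u + 2 * D.Qvx t v x

/-- The forcing term `F_u u + B y` of the transformed state. -/
def rate (t : ℝ) (y : V) (u : U) : E :=
  D.Fu t u + D.Fx t (D.Fv t y) - D.Fv' t y

/-- The quadratic form of the transformed functional. -/
def gohForm (t : ℝ) (y : V) (u : U) : ℝ :=
  D.Qxx t (D.Fv t y) (D.Fv t y) + 2 * D.Qux t u (D.Fv t y) + D.Quu t u u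
    - 2 * D.Qvx t y (D.rate t y u) - (D.Qvx' t y (D.Fv t y) + D.Qvx t y (D.Fv' t y))

/-- The terms of the transformed functional which involve the derivative `v` of `y`. -/
def skewForm (t : ℝ) (v y : V) (u : U) : ℝ :=
  D.Qvx t v (D.Fv t y) - D.Qvx t y (D.Fv t v) + 2 * D.Qvu t v u

/-- The terms of the transformed functional which are linear in the transformed state. -/
def crossForm (t : ℝ) (ξ : E) (y : V) (u : U) : ℝ :=
  D.Qxx t ξ (D.Fv t y) + D.Qxx t (D.Fv t y) ξ + 2 * D.Qux t u ξ - 2 * D.Qvx' t y ξ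
    - 2 * D.Qvx t y (D.Fx t ξ)

/-- The quadratic functional is nonnegative on the trajectories with zero endpoints. -/
def IsNonneg : Prop :=
  ∀ (x : ℝ → E) (u : ℝ → U) (v : ℝ → V), Continuous x → Continuous u → Continuous v →
    (∀ t ∈ Icc 0 D.T, x t = ∫ s in (0 : ℝ)..t, (D.Fx s (x s) + D.Fu s (u s) + D.Fv s (v s))) →
    x D.T = 0 → 0 ≤ ∫ t in (0 : ℝ)..D.T, D.cost t (x t) (u t) (v t)

/-- If `y' = v` and `ξ' = F_x ξ + rate`, the last bracket is the time derivative of `2 Q_vx(y, ξ) +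
Q_vx(y, F_v y)`. In `2 Q_vx(v, F_v y)` only the symmetric part can be integrated away; the
antisymmetric part remains in `skewForm`. -/
theorem cost_eq (t : ℝ) (ξ : E) (u : U) (y v : V) :
    D.cost t (ξ + D.Fv t y) u v =
      D.gohForm t y u + D.skewForm t v y u + D.Qxx t ξ ξ + D.crossForm t ξ y u
      + (2 * (D.Qvx' t y ξ + D.Qvx t v ξ + D.Qvx t y (D.Fx t ξ + D.rate t y u))
        + (D.Qvx' t y (D.Fv t y) + D.Qvx t v (D.Fv t y)
          + D.Qvx t y (D.Fv' t y + D.Fv t v))) := by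
  simp only [cost, gohForm, skewForm, crossForm, map_add, add_apply]
  ring

variable {D} [CompleteSpace E]

/-- **Goh transformation** of the second variation. -/
theorem IsNonneg.goh (hD : D.IsNonneg)
    {R : C(Icc 0 D.T, E) →L[ℝ] C(Icc 0 D.T, E)}
    (hR : ∀ x, R x - primitive D.pos.le (pointwiseApply
      ⟨fun t : Icc 0 D.T => D.Fx t, D.continuous_Fx.comp continuous_subtype_val⟩ (R x)) = x)
    {y v : ℝ → V} {u : ℝ → U} (hy : ∀ t, HasDerivAt y (v t) t) (hv : Continuous v)
    (hu : Continuous u) (hy0 : y 0 = 0) (hyT : y D.T = 0) {r : C(Icc 0 D.T, E)}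
    (hr : ∀ t : Icc 0 D.T, r t = D.rate t (y t) (u t))
    (hξ : R (primitive D.pos.le r) ⟨D.T, D.pos.le, le_rfl⟩ = 0) :
    0 ≤ ∫ t in (0 : ℝ)..D.T, (D.gohForm t (y t) (u t) + D.skewForm t (v t) (y t) (u t)
      + D.Qxx t (IccExtend D.pos.le (R (primitive D.pos.le r)) t)
          (IccExtend D.pos.le (R (primitive D.pos.le r)) t)
      + D.crossForm t (IccExtend D.pos.le (R (primitive D.pos.le r)) t) (y t) (u t)) := by
  have hyc : Continuous y := continuous_iff_continuousAt.2 fun t => (hy t).continuousAt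
  set ξ := R (primitive D.pos.le r) with hξdef
  have hξc := continuous_extend D.pos.le ξ
  have hrc := continuous_extend D.pos.le r
  set g : ℝ → E := fun t => D.Fx t (IccExtend D.pos.le ξ t) + IccExtend D.pos.le r t with hg
  have hgc : Continuous g := by fun_prop
  set X : ℝ → E := fun t => ∫ s in (0 : ℝ)..t, g s with hX
  have hXder : ∀ t, HasDerivAt X (g t) t := fun t =>
    intervalIntegral.integral_hasDerivAt_right (hgc.intervalIntegrable _ _)
      (hgc.stronglyMeasurableAtFilter _ _) hgc.continuousAt
  have hXc : Continuous X := continuous_iff_continuousAt.2 fun t => (hXder t).continuousAt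
  have hXξ : ∀ t ∈ Icc 0 D.T, X t = IccExtend D.pos.le ξ t := by
    intro t ht
    have h₀ := hR (primitive D.pos.le r)
    rw [← hξdef, sub_eq_iff_eq_add, ← map_add] at h₀
    have h := DFunLike.congr_fun h₀ ⟨t, ht⟩
    rw [IccExtend_of_mem _ _ ht, h, primitive_apply]
    refine intervalIntegral.integral_congr fun s hs => ?_
    rw [uIcc_of_le ht.1] at hs
    have hs' : s ∈ Icc 0 D.T := ⟨hs.1, hs.2.trans ht.2⟩
    simp only [hg, IccExtend_of_mem _ _ hs']
    rw [add_comm]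
    rfl
  have hgt : ∀ t ∈ Icc 0 D.T, g t = D.Fx t (X t) + D.rate t (y t) (u t) := by
    intro t ht
    rw [hXξ t ht]
    simp only [hg, IccExtend_of_mem _ _ ht, hr]
  have hx := hD (fun t => X t + D.Fv t (y t)) u v (by fun_prop) hu hv (fun t ht => by
      have h := intervalIntegral.integral_eq_sub_of_hasDerivAt_of_le (a := 0) (b := t) ht.1
        (f := fun t => X t + D.Fv t (y t))
        (f' := fun s => D.Fx s (X s + D.Fv s (y s)) + D.Fu s (u s) + D.Fv s (v s))
        (by fun_prop)
        (fun s hs => by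
          have hs' : s ∈ Ioo 0 D.T := ⟨hs.1, hs.2.trans_le ht.2⟩
          have h1 := (hXder s).add ((D.hasDerivAt_Fv s hs').clm_apply (hy s))
          refine h1.congr_deriv ?_
          rw [hgt s ⟨hs'.1.le, hs'.2.le⟩, rate, map_add]
          abel)
        (Continuous.intervalIntegrable (by fun_prop) _ _)
      rw [h]
      simp [hX, hy0])
    (by rw [hyT, map_zero, add_zero, hXξ _ ⟨D.pos.le, le_rfl⟩, IccExtend_of_mem _ _
      ⟨D.pos.le, le_rfl⟩, hξ])
  -- The boundary terms vanish because `y` is zero at `0` and at `T`.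
  have hder := intervalIntegral.integral_eq_sub_of_hasDerivAt_of_le (a := 0) (b := D.T) D.pos.le
    (f := fun t => 2 * D.Qvx t (y t) (X t) + D.Qvx t (y t) (D.Fv t (y t)))
    (f' := fun t => 2 * (D.Qvx' t (y t) (X t) + D.Qvx t (v t) (X t)
        + D.Qvx t (y t) (D.Fx t (X t) + D.rate t (y t) (u t)))
        + (D.Qvx' t (y t) (D.Fv t (y t)) + D.Qvx t (v t) (D.Fv t (y t))
          + D.Qvx t (y t) (D.Fv' t (y t) + D.Fv t (v t))))
    (by fun_prop)
    (fun t ht => by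
      have h1 := (D.hasDerivAt_Qvx t ht).clm_apply (hy t)
      have h2 := h1.clm_apply (hXder t)
      have h3 := h1.clm_apply ((D.hasDerivAt_Fv t ht).clm_apply (hy t))
      refine ((h2.const_mul 2).add h3).congr_deriv ?_
      rw [hgt t ⟨ht.1.le, ht.2.le⟩]
      simp only [add_apply])
    (Continuous.intervalIntegrable (by unfold rate; fun_prop) _ _)
  simp only [hyT, hy0, map_zero, zero_apply, mul_zero, add_zero, sub_zero] at hder
  have hsub : ∫ t in (0 : ℝ)..D.T, D.cost t (X t + D.Fv t (y t)) (u t) (v t)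
      = ∫ t in (0 : ℝ)..D.T, (D.gohForm t (y t) (u t) + D.skewForm t (v t) (y t) (u t)
        + D.Qxx t (X t) (X t) + D.crossForm t (X t) (y t) (u t)) := by
    simp only [cost_eq]
    rw [intervalIntegral.integral_add, hder, add_zero]
    · exact Continuous.intervalIntegrable
        (by unfold gohForm skewForm crossForm rate; fun_prop) _ _
    · exact Continuous.intervalIntegrable (by unfold rate; fun_prop) _ _
  rw [hsub] at hx
  refine hx.trans (le_of_eq (intervalIntegral.integral_congr fun t ht => ?_))
  rw [uIcc_of_le D.pos.le] at ht
  simp only [hXξ t ht]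

end LQCoeffs

/-! ### Variations concentrated near one time. -/

theorem integral_eq_of_support {g : ℝ → ℝ} {T a b : ℝ} (hg : Continuous g) (ha : 0 ≤ a)
    (hb : b ≤ T) (h : ∀ t, t ∉ Ioo a b → g t = 0) :
    ∫ t in (0 : ℝ)..T, g t = ∫ t in a..b, g t := by
  have h1 : ∫ t in (0 : ℝ)..a, g t = 0 := intervalIntegral.integral_zero_ae
    (Eventually.of_forall fun t ht => h t fun ht' => by
      rw [uIoc_of_le ha] at ht; exact absurd ht.2 (not_le.2 ht'.1))
  have h2 : ∫ t in b..T, g t = 0 := intervalIntegral.integral_zero_ae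
    (Eventually.of_forall fun t ht => h t fun ht' => by
      rw [uIoc_of_le hb] at ht; exact absurd ht.1 (not_lt.2 ht'.2.le))
  rw [← intervalIntegral.integral_add_adjacent_intervals (hg.intervalIntegrable 0 a)
    (hg.intervalIntegrable a T), ← intervalIntegral.integral_add_adjacent_intervals
    (hg.intervalIntegrable a b) (hg.intervalIntegrable b T), h1, h2, zero_add, add_zero]

theorem integral_le_of_support {g : ℝ → ℝ} {T a b C : ℝ} (hg : Continuous g) (ha : 0 ≤ a)
    (hab : a ≤ b) (hb : b ≤ T) (hC : ∀ t ∈ Icc 0 T, g t ≤ C) (h : ∀ t, t ∉ Ioo a b → g t = 0) :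
    ∫ t in (0 : ℝ)..T, g t ≤ C * (b - a) := by
  rw [integral_eq_of_support hg ha hb h]
  calc ∫ t in a..b, g t ≤ ∫ _ in a..b, C :=
        intervalIntegral.integral_mono_on hab (hg.intervalIntegrable _ _)
          (continuous_const.intervalIntegrable _ _)
          fun t ht => hC t ⟨ha.trans ht.1, ht.2.trans hb⟩
    _ = C * (b - a) := by rw [intervalIntegral.integral_const, smul_eq_mul, mul_comm]

/-- A variation supported in `[0, 1]`: a function `y` with derivative `v`, and a function `u`. -/
structure Profile (U V : Type*) [NormedAddCommGroup U] [NormedAddCommGroup V]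
    [NormedSpace ℝ V] where
  y : ℝ → V
  v : ℝ → V
  u : ℝ → U
  hasDerivAt : ∀ s, HasDerivAt y (v s) s
  continuous_v : Continuous v
  continuous_u : Continuous u
  y_eq_zero : ∀ s, s ∉ Ioo (0 : ℝ) 1 → y s = 0
  v_eq_zero : ∀ s, s ∉ Ioo (0 : ℝ) 1 → v s = 0
  u_eq_zero : ∀ s, s ∉ Ioo (0 : ℝ) 1 → u s = 0

attribute [fun_prop] Profile.continuous_v Profile.continuous_u

/-- At most one of the unit intervals starting at `0, …, n` contains a given point. -/
theorem exists_unit_block (n : ℕ) (s : ℝ) :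
    ∃ j : Fin (n + 1), ∀ k, k ≠ j → s - (k : ℕ) ∉ Ioo (0 : ℝ) 1 := by
  by_cases h : ∃ j : Fin (n + 1), s - (j : ℕ) ∈ Ioo (0 : ℝ) 1
  · obtain ⟨j, hj⟩ := h
    refine ⟨j, fun k hk hks => hk (Fin.ext ?_)⟩
    have h1 : ((k : ℕ) : ℝ) < (j : ℕ) + 1 := by linarith [hks.1, hj.2]
    have h2 : ((j : ℕ) : ℝ) < (k : ℕ) + 1 := by linarith [hks.2, hj.1]
    have h3 : (k : ℕ) < j + 1 := by exact_mod_cast h1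
    have h4 : (j : ℕ) < k + 1 := by exact_mod_cast h2
    omega
  · push Not at h
    exact ⟨0, fun k _ => h k⟩

/-- More vectors than the dimension are linearly dependent. With this normalization the squares `c j
^ 2` are the weights of a convex combination. -/
theorem exists_unit_relation {E : Type*} [NormedAddCommGroup E] [NormedSpace ℝ E]
    [FiniteDimensional ℝ E] (e : Fin (Module.finrank ℝ E + 1) → E) :
    ∃ c : Fin (Module.finrank ℝ E + 1) → ℝ, ∑ j, c j ^ 2 = 1 ∧ ∑ j, c j • e j = 0 := by
  have hker : LinearMap.ker (Fintype.linearCombination ℝ e) ≠ ⊥ :=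
    LinearMap.ker_ne_bot_of_finrank_lt (by simp)
  obtain ⟨c, hc, hne⟩ := (Submodule.ne_bot_iff _).1 hker
  rw [LinearMap.mem_ker, Fintype.linearCombination_apply] at hc
  obtain ⟨k, hk⟩ := Function.ne_iff.1 hne
  have hpos : 0 < ∑ j, c j ^ 2 :=
    Finset.sum_pos' (fun j _ => sq_nonneg _) ⟨k, Finset.mem_univ k, by
      have : c k ≠ 0 := hk
      positivity⟩
  refine ⟨fun j => (√(∑ j, c j ^ 2))⁻¹ * c j, ?_, ?_⟩
  · simp only [mul_pow, ← Finset.mul_sum, inv_pow, Real.sq_sqrt hpos.le]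
    exact inv_mul_cancel₀ hpos.ne'
  · simp only [mul_smul, ← Finset.smul_sum, hc, smul_zero]

namespace Profile

variable {U V : Type*} [NormedAddCommGroup U] [NormedAddCommGroup V] [NormedSpace ℝ V]
  (P : Profile U V)

@[fun_prop]
theorem continuous_y : Continuous P.y := continuous_iff_continuousAt.2 fun s =>
  (P.hasDerivAt s).continuousAt

theorem exists_bound : ∃ M : ℝ, 0 ≤ M ∧ ∀ s, ‖P.y s‖ ≤ M ∧ ‖P.u s‖ ≤ M := by
  obtain ⟨M₁, h₁⟩ := isCompact_Icc.exists_bound_of_continuousOn (s := Icc (0 : ℝ) 1)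
    P.continuous_y.continuousOn
  obtain ⟨M₂, h₂⟩ := isCompact_Icc.exists_bound_of_continuousOn (s := Icc (0 : ℝ) 1)
    P.continuous_u.continuousOn
  have h0 : (0 : ℝ) ∈ Icc (0 : ℝ) 1 := by simp
  have hM : 0 ≤ M₁ := (norm_nonneg _).trans (h₁ 0 h0)
  refine ⟨max M₁ M₂, le_max_of_le_left hM, fun s => ?_⟩
  by_cases hs : s ∈ Ioo (0 : ℝ) 1
  · exact ⟨(h₁ s (Ioo_subset_Icc_self hs)).trans (le_max_left _ _),
      (h₂ s (Ioo_subset_Icc_self hs)).trans (le_max_right _ _)⟩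
  · rw [P.y_eq_zero s hs, P.u_eq_zero s hs, norm_zero, norm_zero]
    exact ⟨le_max_of_le_left hM, le_max_of_le_left hM⟩

end Profile

namespace LQCoeffs

variable {E U V : Type*} [NormedAddCommGroup E] [NormedSpace ℝ E]
  [NormedAddCommGroup U] [NormedSpace ℝ U] [NormedAddCommGroup V] [NormedSpace ℝ V]
  (D : LQCoeffs E U V)

theorem gohForm_smul (t c : ℝ) (y : V) (u : U) :
    D.gohForm t (c • y) (c • u) = c ^ 2 * D.gohForm t y u := by
  simp only [gohForm, rate, map_smul, smul_apply, smul_eq_mul, map_add, map_sub]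
  ring

theorem skewForm_smul (t c : ℝ) (v y : V) (u : U) :
    D.skewForm t (c • v) (c • y) (c • u) = c ^ 2 * D.skewForm t v y u := by
  simp only [skewForm, map_smul, smul_apply, smul_eq_mul]
  ring

theorem skewForm_smul_left (t c : ℝ) (v y : V) (u : U) :
    D.skewForm t (c • v) y u = c * D.skewForm t v y u := by
  simp only [skewForm, map_smul, smul_apply, smul_eq_mul]
  ring

@[simp]
theorem gohForm_zero (t : ℝ) : D.gohForm t 0 0 = 0 := by
  simpa using D.gohForm_smul t 0 0 0

@[simp]
theorem skewForm_zero (t : ℝ) : D.skewForm t 0 0 0 = 0 := by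
  simpa using D.skewForm_smul t 0 0 0 0

theorem rate_sum {ι : Type*} [Fintype ι] (t : ℝ) (c : ι → ℝ) (y : ι → V) (u : ι → U) :
    D.rate t (∑ j, c j • y j) (∑ j, c j • u j) = ∑ j, c j • D.rate t (y j) (u j) := by
  simp only [rate, map_sum, map_smul, smul_sub, smul_add, Finset.sum_add_distrib,
    Finset.sum_sub_distrib]

theorem crossForm_smul_left (t c : ℝ) (ξ : E) (y : V) (u : U) :
    D.crossForm t (c • ξ) y u = c * D.crossForm t ξ y u := by
  simp only [crossForm, map_smul, smul_apply, smul_eq_mul]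
  ring

/-- Contribution of one block of a concentrated variation. -/
def blockValue (P : Profile U V) (t₀ ε j : ℝ) : ℝ :=
  ε * (∫ s in (0 : ℝ)..1, D.gohForm (t₀ + ε * (s + j)) (P.y s) (P.u s))
    + ∫ s in (0 : ℝ)..1, D.skewForm (t₀ + ε * (s + j)) (P.v s) (P.y s) (P.u s)

/-- The substitution `t = t₀ + ε (s + j)` yields a factor `ε`. It cancels the `ε⁻¹` coming from the
derivative of the compressed `y` in the skew form, and it survives in the Goh form; this separates
the two by one order of `ε`. -/
theorem integral_block (P : Profile U V) {t₀ ε j : ℝ} (hε : 0 < ε) (h0 : 0 ≤ t₀ + ε * j)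
    (hT : t₀ + ε * (j + 1) ≤ D.T) :
    ∫ t in (0 : ℝ)..D.T, (D.gohForm t (P.y ((t - t₀) / ε - j)) (P.u ((t - t₀) / ε - j))
      + D.skewForm t (ε⁻¹ • P.v ((t - t₀) / ε - j)) (P.y ((t - t₀) / ε - j))
        (P.u ((t - t₀) / ε - j))) = D.blockValue P t₀ ε j := by
  rw [integral_eq_of_support (a := t₀ + ε * j) (b := t₀ + ε * (j + 1))
    (by unfold gohForm skewForm rate; fun_prop) h0 hT]
  · have h := intervalIntegral.smul_integral_comp_add_mul (a := 0) (b := 1) (fun t =>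
      (D.gohForm t (P.y ((t - t₀) / ε - j)) (P.u ((t - t₀) / ε - j))
        + D.skewForm t (ε⁻¹ • P.v ((t - t₀) / ε - j)) (P.y ((t - t₀) / ε - j))
          (P.u ((t - t₀) / ε - j)))) ε (t₀ + ε * j)
    have e1 : t₀ + ε * j + ε * 0 = t₀ + ε * j := by ring
    have e2 : t₀ + ε * j + ε * 1 = t₀ + ε * (j + 1) := by ring
    rw [e1, e2] at h
    rw [← h]
    have e3 : ∀ s : ℝ, (t₀ + ε * j + ε * s - t₀) / ε - j = s := fun s => by field_simp; ring
    have e4 : ∀ s : ℝ, t₀ + ε * j + ε * s = t₀ + ε * (s + j) := fun s => by ring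
    simp only [e3]
    simp only [e4, skewForm_smul_left]
    rw [intervalIntegral.integral_add, intervalIntegral.integral_const_mul, smul_eq_mul, mul_add,
      mul_inv_cancel_left₀ hε.ne', blockValue]
    · exact Continuous.intervalIntegrable (by unfold gohForm rate; fun_prop) _ _
    · exact Continuous.intervalIntegrable (by unfold skewForm; fun_prop) _ _
  · intro t ht
    have hs : (t - t₀) / ε - j ∉ Ioo (0 : ℝ) 1 := by
      rintro ⟨h1, h2⟩
      refine ht ⟨?_, ?_⟩
      · have := (lt_div_iff₀ hε).1 (sub_pos.1 h1)
        linarith [mul_comm ε j]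
      · have := (div_lt_iff₀ hε).1 (sub_lt_iff_lt_add.1 h2)
        linarith [mul_comm ε (j + 1), add_comm 1 j, mul_comm (1 + j) ε, this]
    simp [P.y_eq_zero _ hs, P.v_eq_zero _ hs, P.u_eq_zero _ hs]

variable [FiniteDimensional ℝ U] [FiniteDimensional ℝ V]

theorem exists_rate_bound (M : ℝ) : ∃ C : ℝ, 0 ≤ C ∧ ∀ t ∈ Icc 0 D.T, ∀ (y : V) (u : U),
    ‖y‖ ≤ M → ‖u‖ ≤ M → ‖D.rate t y u‖ ≤ C := by
  have hc : Continuous fun a : ℝ × V × U => D.rate a.1 a.2.1 a.2.2 := by unfold rate; fun_prop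
  obtain ⟨C, hC⟩ := (isCompact_Icc.prod ((isCompact_closedBall (0 : V) M).prod
    (isCompact_closedBall (0 : U) M))).exists_bound_of_continuousOn (s := Icc 0 D.T ×ˢ _)
    hc.continuousOn
  refine ⟨max C 0, le_max_right _ _, fun t ht y u hy hu => le_max_of_le_left (hC (t, y, u) ?_)⟩
  simp [ht.1, ht.2, hy, hu]

theorem exists_crossForm_bound [FiniteDimensional ℝ E] (M M' : ℝ) : ∃ C : ℝ, 0 ≤ C ∧ ∀ t ∈ Icc 0 D.T,
    ∀ (ξ : E) (y : V) (u : U), ‖ξ‖ ≤ M' → ‖y‖ ≤ M → ‖u‖ ≤ M →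
      |D.crossForm t ξ y u| ≤ C ∧ |D.Qxx t ξ ξ| ≤ C := by
  have hc : Continuous fun a : ℝ × E × V × U =>
    (D.crossForm a.1 a.2.1 a.2.2.1 a.2.2.2, D.Qxx a.1 a.2.1 a.2.1) := by
      unfold crossForm; fun_prop
  obtain ⟨C, hC⟩ := (isCompact_Icc.prod ((isCompact_closedBall (0 : E) M').prod
    ((isCompact_closedBall (0 : V) M).prod
    (isCompact_closedBall (0 : U) M)))).exists_bound_of_continuousOn (s := Icc 0 D.T ×ˢ _)
    hc.continuousOn
  refine ⟨max C 0, le_max_right _ _, fun t ht ξ y u hξ hy hu => ?_⟩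
  have h := hC (t, ξ, y, u) (by simp [ht.1, ht.2, hξ, hy, hu])
  exact ⟨le_max_of_le_left ((norm_fst_le _).trans h), le_max_of_le_left ((norm_snd_le _).trans h)⟩

end LQCoeffs

namespace LQCoeffs

variable {E U V : Type*} [NormedAddCommGroup E] [NormedSpace ℝ E]
  [NormedAddCommGroup U] [NormedSpace ℝ U] [NormedAddCommGroup V] [NormedSpace ℝ V]
  {D : LQCoeffs E U V}
  [FiniteDimensional ℝ E] [FiniteDimensional ℝ U] [FiniteDimensional ℝ V]

/-- Testing the quadratic functional with variations concentrated near `t₀`: consecutive copies of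
a profile at scale `ε`, with coefficients chosen to reach the endpoint `0`. -/
theorem IsNonneg.exists_blockValue_nonneg (hD : D.IsNonneg) (P : Profile U V) {t₀ : ℝ}
    (ht₀ : t₀ ∈ Ioo 0 D.T) :
    ∃ (N : ℕ) (C : ℝ), ∀ᶠ ε in 𝓝[>] (0 : ℝ), ∃ j : Fin N,
      0 ≤ D.blockValue P t₀ ε (j : ℕ) + C * ε ^ 2 := by
  set n := Module.finrank ℝ E with hn
  obtain ⟨M, hM0, hM⟩ := P.exists_bound
  have hT0 := D.pos.le
  obtain ⟨R, hR⟩ := exists_resolvent D.pos.le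
    (⟨fun t : Icc 0 D.T => D.Fx t, D.continuous_Fx.comp continuous_subtype_val⟩ :
      C(Icc 0 D.T, E →L[ℝ] E))
  obtain ⟨Cr, hCr0, hCr⟩ := D.exists_rate_bound M
  obtain ⟨Cc, hCc0, hCc⟩ := D.exists_crossForm_bound M (‖R‖ * (Cr * (n + 1)))
  -- Both remainders are `O(ε²)`: the term quadratic in `ξ = O(ε)` extends over `[0, T]`, while the
  -- term linear in `ξ` is integrated over a support of length `ε (n + 1)`.
  refine ⟨n + 1, Cc * D.T + Cc * (n + 1), ?_⟩
  have hsmall : ∀ᶠ ε in 𝓝[>] (0 : ℝ), ε * (n + 1) < D.T - t₀ := by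
    have hc : Tendsto (fun ε : ℝ => ε * (n + 1)) (𝓝[>] 0) (𝓝 0) := by
      have : Continuous fun ε : ℝ => ε * ((n : ℝ) + 1) := by fun_prop
      simpa using (this.tendsto 0).mono_left (nhdsWithin_le_nhds (s := Ioi (0 : ℝ)))
    exact hc.eventually (gt_mem_nhds (sub_pos.2 ht₀.2))
  filter_upwards [hsmall, self_mem_nhdsWithin] with ε hεT hε
  have hε' : (0 : ℝ) < ε := hε
  let σ : Fin (n + 1) → ℝ → ℝ := fun j t => (t - t₀) / ε - (j : ℕ)
  have hσc : ∀ j, Continuous (σ j) := fun j => by simp only [σ]; fun_prop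
  have hσd : ∀ j t, HasDerivAt (σ j) ε⁻¹ t := fun j t => by
    have := (((hasDerivAt_id t).sub_const t₀).div_const ε).sub_const ((j : ℕ) : ℝ)
    rwa [one_div] at this
  let rj : Fin (n + 1) → C(Icc 0 D.T, E) := fun j =>
    ⟨fun t => D.rate t (P.y (σ j t)) (P.u (σ j t)), by
      have := hσc j
      unfold rate; fun_prop⟩
  -- The terminal transformed states of the `n + 1` blocks are dependent, so a combination of the
  -- blocks reaches the endpoint `0`.
  obtain ⟨c, hc1, hc0⟩ := exists_unit_relation
    fun j => R (primitive D.pos.le (rj j)) ⟨D.T, D.pos.le, le_rfl⟩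
  have hcj : ∀ j, |c j| ≤ 1 := fun j => by
    rw [← sq_le_one_iff_abs_le_one, ← hc1]
    exact Finset.single_le_sum (f := fun j => c j ^ 2) (fun _ _ => sq_nonneg _) (Finset.mem_univ j)
  let y : ℝ → V := fun t => ∑ j, c j • P.y (σ j t)
  let v : ℝ → V := fun t => ∑ j, c j • ε⁻¹ • P.v (σ j t)
  let u : ℝ → U := fun t => ∑ j, c j • P.u (σ j t)
  have hyd : ∀ t, HasDerivAt y (v t) t := fun t =>
    HasDerivAt.fun_sum fun j _ => ((P.hasDerivAt (σ j t)).scomp t (hσd j t)).const_smul (c j)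
  have hvc : Continuous v := by
    refine continuous_finsetSum _ fun j _ => ?_
    have := hσc j
    fun_prop
  have huc : Continuous u := by
    refine continuous_finsetSum _ fun j _ => ?_
    have := hσc j
    fun_prop
  have hyc : Continuous y := continuous_iff_continuousAt.2 fun t => (hyd t).continuousAt
  have hsupp : ∀ t, t ∉ Ioo t₀ (t₀ + ε * (n + 1)) → ∀ j, σ j t ∉ Ioo (0 : ℝ) 1 := by
    rintro t ht j ⟨h1, h2⟩
    have hj : ((j : ℕ) : ℝ) ≤ n := by exact_mod_cast Nat.lt_succ_iff.1 j.2
    have hj0 : (0 : ℝ) ≤ (j : ℕ) := Nat.cast_nonneg _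
    refine ht ⟨?_, ?_⟩
    · have := (lt_div_iff₀ hε').1 (sub_pos.1 h1)
      nlinarith
    · have := (div_lt_iff₀ hε').1 (sub_lt_iff_lt_add.1 h2)
      nlinarith
  have hy0 : ∀ t, t ∉ Ioo t₀ (t₀ + ε * (n + 1)) → y t = 0 := fun t ht =>
    Finset.sum_eq_zero fun j _ => by rw [P.y_eq_zero _ (hsupp t ht j), smul_zero]
  have hu0 : ∀ t, t ∉ Ioo t₀ (t₀ + ε * (n + 1)) → u t = 0 := fun t ht =>
    Finset.sum_eq_zero fun j _ => by rw [P.u_eq_zero _ (hsupp t ht j), smul_zero]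
  have hblock : ∀ t, ∃ j, (∀ k, k ≠ j → σ k t ∉ Ioo (0 : ℝ) 1) ∧ y t = c j • P.y (σ j t) ∧
      v t = c j • ε⁻¹ • P.v (σ j t) ∧ u t = c j • P.u (σ j t) := by
    intro t
    obtain ⟨j, hj⟩ := exists_unit_block n ((t - t₀) / ε)
    refine ⟨j, hj, Finset.sum_eq_single j (fun k _ hk => ?_) (by simp),
      Finset.sum_eq_single j (fun k _ hk => ?_) (by simp),
      Finset.sum_eq_single j (fun k _ hk => ?_) (by simp)⟩
    · rw [P.y_eq_zero _ (hj k hk), smul_zero]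
    · rw [P.v_eq_zero _ (hj k hk), smul_zero, smul_zero]
    · rw [P.u_eq_zero _ (hj k hk), smul_zero]
  have hyM : ∀ t, ‖y t‖ ≤ M ∧ ‖u t‖ ≤ M := by
    intro t
    obtain ⟨j, -, h1, -, h2⟩ := hblock t
    rw [h1, h2, norm_smul, norm_smul, Real.norm_eq_abs]
    exact ⟨(mul_le_of_le_one_left (norm_nonneg _) (hcj j)).trans (hM _).1,
      (mul_le_of_le_one_left (norm_nonneg _) (hcj j)).trans (hM _).2⟩
  set r : C(Icc 0 D.T, E) := ∑ j, c j • rj j with hrdef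
  have hr : ∀ t : Icc 0 D.T, r t = D.rate t (y t) (u t) := by
    intro t
    rw [rate_sum, hrdef, ContinuousMap.sum_apply]
    rfl
  set ξ := R (primitive D.pos.le r) with hξdef
  have hξT : ξ ⟨D.T, D.pos.le, le_rfl⟩ = 0 := by
    rw [hξdef, hrdef, map_sum, map_sum, ContinuousMap.sum_apply, ← hc0]
    refine Finset.sum_congr rfl fun j _ => ?_
    rw [map_smul, map_smul]
    rfl
  have hnpos : (0 : ℝ) < n + 1 := by positivity
  have hend : t₀ + ε * (n + 1) ≤ D.T := by linarith
  have hstart : t₀ ≤ t₀ + ε * (n + 1) := by nlinarith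
  -- The rate is bounded and supported on an interval of length `ε (n + 1)`, so its primitive is
  -- `O(ε)`.
  have hξ : ‖ξ‖ ≤ ε * (‖R‖ * (Cr * (n + 1))) := by
    have h1 : ‖primitive D.pos.le r‖ ≤ Cr * (t₀ + ε * (n + 1) - t₀) := by
      refine (norm_primitive_le D.pos.le r).trans ?_
      have hcong : ∫ s in (0 : ℝ)..D.T, ‖IccExtend D.pos.le r s‖
          = ∫ s in (0 : ℝ)..D.T, ‖D.rate s (y s) (u s)‖ := by
        refine intervalIntegral.integral_congr fun s hs => ?_
        rw [uIcc_of_le D.pos.le] at hs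
        simp only [IccExtend_of_mem _ _ hs, hr]
      rw [hcong]
      refine integral_le_of_support (by unfold rate; fun_prop) ht₀.1.le hstart hend
        (fun t ht => hCr t ht _ _ (hyM t).1 (hyM t).2) fun t ht => ?_
      rw [hy0 t ht, hu0 t ht]
      simp [rate]
    calc ‖ξ‖ ≤ ‖R‖ * ‖primitive D.pos.le r‖ := R.le_opNorm _
      _ ≤ ‖R‖ * (Cr * (t₀ + ε * (n + 1) - t₀)) := by gcongr
      _ = _ := by ring
  set ξe := IccExtend D.pos.le ξ with hξe
  have hξc : Continuous ξe := continuous_extend _ _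
  have hξb : ∀ t, ‖ε⁻¹ • ξe t‖ ≤ ‖R‖ * (Cr * (n + 1)) := by
    intro t
    rw [norm_smul, norm_inv, Real.norm_of_nonneg hε'.le, inv_mul_le_iff₀ hε']
    exact (norm_extend_le D.pos.le ξ t).trans hξ
  have hscale : ∀ t, ξe t = ε • ε⁻¹ • ξe t := fun t => (smul_inv_smul₀ hε'.ne' _).symm
  have hgoh := hD.goh hR hyd hvc huc (hy0 0 fun h => absurd h.1 (not_lt.2 ht₀.1.le))
    (hy0 D.T fun h => absurd h.2 (not_lt.2 hend)) hr hξT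
  rw [← hξdef, ← hξe] at hgoh
  have hcont1 : Continuous fun t => D.gohForm t (y t) (u t) + D.skewForm t (v t) (y t) (u t) := by
    unfold gohForm skewForm rate; fun_prop
  have hcont2 : Continuous fun t => D.Qxx t (ξe t) (ξe t) := by fun_prop
  have hcont3 : Continuous fun t => D.crossForm t (ξe t) (y t) (u t) := by
    unfold crossForm; fun_prop
  have hcont12 : Continuous fun t => D.gohForm t (y t) (u t) + D.skewForm t (v t) (y t) (u t)
      + D.Qxx t (ξe t) (ξe t) := hcont1.add hcont2
  rw [intervalIntegral.integral_add (hcont12.intervalIntegrable _ _)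
    (hcont3.intervalIntegrable _ _), intervalIntegral.integral_add
    (hcont1.intervalIntegrable _ _) (hcont2.intervalIntegrable _ _)] at hgoh
  have hb2 : ∫ t in (0 : ℝ)..D.T, D.Qxx t (ξe t) (ξe t) ≤ (ε ^ 2 * Cc) * (D.T - 0) := by
    have : ∀ t ∈ Icc 0 D.T, D.Qxx t (ξe t) (ξe t) ≤ ε ^ 2 * Cc := by
      intro t ht
      have e : D.Qxx t (ξe t) (ξe t) = ε ^ 2 * D.Qxx t (ε⁻¹ • ξe t) (ε⁻¹ • ξe t) := by
        simp only [map_smul, smul_apply, smul_eq_mul]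
        field_simp
      rw [e]
      gcongr
      exact (le_abs_self _).trans
        (hCc t ht _ 0 0 (hξb t) (by simpa using hM0) (by simpa using hM0)).2
    calc _ ≤ ∫ _ in (0 : ℝ)..D.T, ε ^ 2 * Cc :=
          intervalIntegral.integral_mono_on D.pos.le (hcont2.intervalIntegrable _ _)
            (continuous_const.intervalIntegrable _ _) this
      _ = _ := by rw [intervalIntegral.integral_const, smul_eq_mul, mul_comm]
  have hb3 : ∫ t in (0 : ℝ)..D.T, D.crossForm t (ξe t) (y t) (u t)
      ≤ (ε * Cc) * (t₀ + ε * (n + 1) - t₀) := by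
    refine integral_le_of_support hcont3 ht₀.1.le hstart hend (fun t ht => ?_) fun t ht => ?_
    · rw [hscale t, crossForm_smul_left]
      gcongr
      exact (le_abs_self _).trans (hCc t ht _ _ _ (hξb t) (hyM t).1 (hyM t).2).1
    · rw [hy0 t ht, hu0 t ht]
      simp [crossForm]
  -- At each time at most one block is active, so the quadratic forms produce no products of
  -- different blocks.
  have hdiag : ∫ t in (0 : ℝ)..D.T, (D.gohForm t (y t) (u t) + D.skewForm t (v t) (y t) (u t))
      = ∑ j : Fin (n + 1), c j ^ 2 * D.blockValue P t₀ ε (j : ℕ) := by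
    have hpt : ∀ t, D.gohForm t (y t) (u t) + D.skewForm t (v t) (y t) (u t)
        = ∑ j : Fin (n + 1), c j ^ 2 * (D.gohForm t (P.y (σ j t)) (P.u (σ j t))
          + D.skewForm t (ε⁻¹ • P.v (σ j t)) (P.y (σ j t)) (P.u (σ j t))) := by
      intro t
      obtain ⟨j, hj, h1, h2, h3⟩ := hblock t
      rw [Finset.sum_eq_single j (fun k _ hk => by
        rw [P.y_eq_zero _ (hj k hk), P.v_eq_zero _ (hj k hk), P.u_eq_zero _ (hj k hk), smul_zero,
          gohForm_zero, skewForm_zero, add_zero, mul_zero]) (by simp),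
        h1, h2, h3, gohForm_smul, skewForm_smul, mul_add]
    simp only [hpt]
    rw [intervalIntegral.integral_finsetSum]
    · refine Finset.sum_congr rfl fun j _ => ?_
      rw [intervalIntegral.integral_const_mul]
      congr 1
      have hj : ((j : ℕ) : ℝ) ≤ n := by exact_mod_cast Nat.lt_succ_iff.1 j.2
      have hj0 : (0 : ℝ) ≤ (j : ℕ) := Nat.cast_nonneg _
      exact D.integral_block P hε' (by nlinarith [ht₀.1, mul_nonneg hε'.le hj0])
        (by nlinarith)
    · intro j _
      have := hσc j
      exact Continuous.intervalIntegrable (by unfold gohForm skewForm rate; fun_prop) _ _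
  rw [hdiag] at hgoh
  by_contra! hneg
  obtain ⟨k, hk⟩ : ∃ k, c k ≠ 0 := by
    by_contra! hall
    simp [hall] at hc1
  -- If every block were negative, so would be their average with weights `c j ^ 2`, which is
  -- nonnegative by `hgoh` and the two remainder bounds.
  have hlt : ∑ j : Fin (n + 1), c j ^ 2 * (D.blockValue P t₀ ε (j : ℕ)
      + (Cc * D.T + Cc * (n + 1)) * ε ^ 2) < ∑ _j : Fin (n + 1), (0 : ℝ) :=
    Finset.sum_lt_sum (fun j _ => mul_nonpos_of_nonneg_of_nonpos (sq_nonneg _) (hneg j).le)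
      ⟨k, Finset.mem_univ k, mul_neg_of_pos_of_neg (by positivity) (hneg k)⟩
  simp only [mul_add, Finset.sum_add_distrib, Finset.sum_const_zero] at hlt
  rw [← Finset.sum_mul, hc1] at hlt
  nlinarith

end LQCoeffs

/-! ### Pointwise conditions from special profiles. -/

/-- A twice differentiable bump supported in `(0, 1)`, with its derivatives. -/
theorem exists_bump : ∃ ψ ψ' ψ'' : ℝ → ℝ, (∀ s, HasDerivAt ψ (ψ' s) s) ∧
    (∀ s, HasDerivAt ψ' (ψ'' s) s) ∧ Continuous ψ'' ∧
    (∀ s, s ∉ Ioo (0 : ℝ) 1 → ψ s = 0 ∧ ψ' s = 0 ∧ ψ'' s = 0) ∧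
    0 < ∫ s in (0 : ℝ)..1, ψ s ^ 2 ∧ 0 < ∫ s in (0 : ℝ)..1, ψ' s ^ 2 := by
  let b : ContDiffBump (1 / 2 : ℝ) := ⟨1 / 8, 1 / 4, by norm_num, by norm_num⟩
  have hb : ContDiff ℝ 2 b := b.contDiff
  have hb' : ContDiff ℝ 1 (deriv b) := (contDiff_succ_iff_deriv (n := 1)).1 hb |>.2.2
  have hd : ∀ s, HasDerivAt b (deriv b s) s := fun s =>
    (hb.differentiable two_ne_zero s).hasDerivAt
  have hd' : ∀ s, HasDerivAt (deriv b) (deriv (deriv b) s) s := fun s =>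
    (hb'.differentiable one_ne_zero s).hasDerivAt
  have hbs : tsupport b ⊆ Ioo (0 : ℝ) 1 := by
    rw [b.tsupport_eq, Real.closedBall_eq_Icc]
    intro s hs
    have h1 : (1 / 2 : ℝ) - 1 / 4 ≤ s := hs.1
    have h2 : s ≤ (1 / 2 : ℝ) + 1 / 4 := hs.2
    exact ⟨by linarith, by linarith⟩
  have hz : ∀ s, s ∉ Ioo (0 : ℝ) 1 → b s = 0 ∧ deriv b s = 0 ∧ deriv (deriv b) s = 0 := by
    intro s hs
    have h0 : s ∉ tsupport b := fun h => hs (hbs h)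
    have h1 : s ∉ tsupport (deriv b) := fun h => h0 (tsupport_deriv_subset h)
    have h2 : s ∉ tsupport (deriv (deriv b)) := fun h => h1 (tsupport_deriv_subset h)
    exact ⟨image_eq_zero_of_notMem_tsupport h0, image_eq_zero_of_notMem_tsupport h1,
      image_eq_zero_of_notMem_tsupport h2⟩
  have hhalf : b (1 / 2) = 1 := b.one_of_mem_closedBall (Metric.mem_closedBall_self b.rIn_pos.le)
  refine ⟨b, deriv b, deriv (deriv b), hd, hd', hb'.continuous_deriv le_rfl, hz, ?_, ?_⟩
  · refine intervalIntegral.integral_pos one_pos (hb.continuous.pow 2).continuousOn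
      (fun s _ => sq_nonneg _) ⟨1 / 2, by norm_num, ?_⟩
    rw [hhalf]; norm_num
  -- The bump rises from `0` at `0` to `1` at `1 / 2`, so its derivative takes the value `2`.
  · obtain ⟨s, hs, hslope⟩ := exists_hasDerivAt_eq_slope b (deriv b) (by norm_num : (0 : ℝ) < 1 / 2)
      hb.continuous.continuousOn fun s _ => hd s
    refine intervalIntegral.integral_pos one_pos (hb'.continuous.pow 2).continuousOn
      (fun s _ => sq_nonneg _) ⟨s, ⟨hs.1.le, by linarith [hs.2]⟩, ?_⟩
    rw [hslope, hhalf, (hz 0 (by simp)).1]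
    norm_num

namespace LQCoeffs

variable {E U V : Type*} [NormedAddCommGroup E] [NormedSpace ℝ E]
  [NormedAddCommGroup U] [NormedSpace ℝ U] [NormedAddCommGroup V] [NormedSpace ℝ V]

theorem tendsto_integral_gohForm (D : LQCoeffs E U V) (P : Profile U V) (t₀ j : ℝ) :
    Tendsto (fun ε => ∫ s in (0 : ℝ)..1, D.gohForm (t₀ + ε * (s + j)) (P.y s) (P.u s)) (𝓝[>] 0)
      (𝓝 (∫ s in (0 : ℝ)..1, D.gohForm t₀ (P.y s) (P.u s))) := by
  have hc : Continuous fun ε : ℝ =>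
      ∫ s in (0 : ℝ)..1, D.gohForm (t₀ + ε * (s + j)) (P.y s) (P.u s) :=
    intervalIntegral.continuous_parametric_intervalIntegral_of_continuous'
      (by unfold gohForm rate Function.uncurry; fun_prop) 0 1
  simpa using (hc.tendsto 0).mono_left (nhdsWithin_le_nhds (s := Ioi (0 : ℝ)))

theorem tendsto_integral_skewForm (D : LQCoeffs E U V) (P : Profile U V) (t₀ j : ℝ) :
    Tendsto (fun ε => ∫ s in (0 : ℝ)..1, D.skewForm (t₀ + ε * (s + j)) (P.v s) (P.y s) (P.u s))
      (𝓝[>] 0) (𝓝 (∫ s in (0 : ℝ)..1, D.skewForm t₀ (P.v s) (P.y s) (P.u s))) := by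
  have hc : Continuous fun ε : ℝ =>
      ∫ s in (0 : ℝ)..1, D.skewForm (t₀ + ε * (s + j)) (P.v s) (P.y s) (P.u s) :=
    intervalIntegral.continuous_parametric_intervalIntegral_of_continuous'
      (by unfold skewForm Function.uncurry; fun_prop) 0 1
  simpa using (hc.tendsto 0).mono_left (nhdsWithin_le_nhds (s := Ioi (0 : ℝ)))

variable {D : LQCoeffs E U V}
  [FiniteDimensional ℝ E] [FiniteDimensional ℝ U] [FiniteDimensional ℝ V]

/-- As `ε → 0`, the leading term of each block value is the skew integral at `t₀`. This limit is the
same for all of the finitely many blocks, so it does not matter which of them is the nonnegative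
one. -/
theorem IsNonneg.integral_skewForm_nonneg (hD : D.IsNonneg) (P : Profile U V) {t₀ : ℝ}
    (ht₀ : t₀ ∈ Ioo 0 D.T) : 0 ≤ ∫ s in (0 : ℝ)..1, D.skewForm t₀ (P.v s) (P.y s) (P.u s) := by
  by_contra! hneg
  obtain ⟨N, C, h⟩ := hD.exists_blockValue_nonneg P ht₀
  have hid : Tendsto (fun ε : ℝ => ε) (𝓝[>] 0) (𝓝 0) :=
    tendsto_nhdsWithin_of_tendsto_nhds tendsto_id
  have hev : ∀ᶠ ε in 𝓝[>] (0 : ℝ), ∀ j : Fin N,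
      D.blockValue P t₀ ε (j : ℕ) + C * ε ^ 2 < 0 := by
    rw [eventually_all]
    intro j
    have hlim := (((hid.mul (D.tendsto_integral_gohForm P t₀ (j : ℕ))).add
      (D.tendsto_integral_skewForm P t₀ (j : ℕ))).add ((hid.pow 2).const_mul C))
    refine hlim.eventually (gt_mem_nhds ?_)
    simpa using hneg
  obtain ⟨ε, ⟨j, h1⟩, h2⟩ := (h.and hev).exists
  exact absurd h1 (not_le.2 (h2 j))

/-- When the skew part vanishes, the block values can be divided by `ε`, which leaves the Goh
integral in the limit. The vanishing is required at all interior times because the blocks see times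
near `t₀`, not only `t₀`. -/
theorem IsNonneg.integral_gohForm_nonneg (hD : D.IsNonneg) (P : Profile U V)
    (hP : ∀ t ∈ Ioo 0 D.T, ∀ s, D.skewForm t (P.v s) (P.y s) (P.u s) = 0) {t₀ : ℝ}
    (ht₀ : t₀ ∈ Ioo 0 D.T) : 0 ≤ ∫ s in (0 : ℝ)..1, D.gohForm t₀ (P.y s) (P.u s) := by
  by_contra! hneg
  obtain ⟨N, C, h⟩ := hD.exists_blockValue_nonneg P ht₀
  have hid : Tendsto (fun ε : ℝ => ε) (𝓝[>] 0) (𝓝 0) :=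
    tendsto_nhdsWithin_of_tendsto_nhds tendsto_id
  have hpos : ∀ᶠ ε in 𝓝[>] (0 : ℝ), 0 < ε := self_mem_nhdsWithin
  have hev : ∀ᶠ ε in 𝓝[>] (0 : ℝ), ∀ j : Fin N,
      D.blockValue P t₀ ε (j : ℕ) + C * ε ^ 2 < 0 := by
    rw [eventually_all]
    intro j
    have hlim := (D.tendsto_integral_gohForm P t₀ (j : ℕ)).add (hid.const_mul C)
    rw [mul_zero, add_zero] at hlim
    have hsmall := (hid.mul_const ((j : ℕ) + 1 : ℝ)).eventually
      (gt_mem_nhds (by rw [zero_mul]; exact sub_pos.2 ht₀.2 : 0 * ((j : ℕ) + 1 : ℝ) < D.T - t₀))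
    filter_upwards [hlim.eventually (gt_mem_nhds hneg), hsmall, hpos] with ε h1 h2 hε
    have hskew : ∫ s in (0 : ℝ)..1,
        D.skewForm (t₀ + ε * (s + (j : ℕ))) (P.v s) (P.y s) (P.u s) = 0 := by
      refine intervalIntegral.integral_zero_ae (Eventually.of_forall fun s hs => hP _ ?_ s)
      rw [uIoc_of_le zero_le_one] at hs
      have hj : (0 : ℝ) ≤ (j : ℕ) := Nat.cast_nonneg _
      constructor
      · have := mul_nonneg hε.le (add_nonneg hs.1.le hj)
        linarith [ht₀.1]
      · have := mul_le_mul_of_nonneg_left (add_le_add_left hs.2 ((j : ℕ) : ℝ)) hε.le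
        linarith [add_comm (1 : ℝ) (j : ℕ), mul_add ε 1 (j : ℕ), mul_add ε (j : ℕ) 1]
    rw [blockValue, hskew, add_zero]
    nlinarith [mul_neg_of_pos_of_neg hε h1]
  obtain ⟨ε, ⟨j, h1⟩, h2⟩ := (h.and hev).exists
  exact absurd h1 (not_le.2 (h2 j))

/-- **Goh condition**: `Q_vx F_v` is symmetric. -/
theorem IsNonneg.symm (hD : D.IsNonneg) {t : ℝ} (ht : t ∈ Ioo 0 D.T) (b₁ b₂ : V) :
    D.Qvx t b₁ (D.Fv t b₂) = D.Qvx t b₂ (D.Fv t b₁) := by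
  obtain ⟨ψ, ψ', ψ'', h1, h2, h3, h0, -, hpos⟩ := exists_bump
  have c0 : Continuous ψ := continuous_iff_continuousAt.2 fun s => (h1 s).continuousAt
  have c1 : Continuous ψ' := continuous_iff_continuousAt.2 fun s => (h2 s).continuousAt
  have hparts : ∫ s in (0 : ℝ)..1, (ψ' s ^ 2 - ψ s * ψ'' s) = 2 * ∫ s in (0 : ℝ)..1, ψ' s ^ 2 := by
    have h := intervalIntegral.integral_eq_sub_of_hasDerivAt (a := 0) (b := 1)
      (fun s _ => (h1 s).mul (h2 s)) (Continuous.intervalIntegrable (by fun_prop) _ _)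
    have e0 := h0 0 (by simp)
    have e1 := h0 1 (by simp)
    simp only [Pi.mul_apply, e0.1, e1.1, zero_mul, sub_self] at h
    have hsum : ∫ s in (0 : ℝ)..1, (ψ' s ^ 2 - ψ s * ψ'' s)
        + (ψ' s * ψ' s + ψ s * ψ'' s) = 2 * ∫ s in (0 : ℝ)..1, ψ' s ^ 2 := by
      rw [← intervalIntegral.integral_const_mul]
      refine intervalIntegral.integral_congr fun s _ => ?_
      ring
    rw [intervalIntegral.integral_add (Continuous.intervalIntegrable (by fun_prop) _ _)
      (Continuous.intervalIntegrable (by fun_prop) _ _), h, add_zero] at hsum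
    exact hsum
  have key : ∀ a₁ a₂ : V, 0 ≤ D.Qvx t a₁ (D.Fv t a₂) - D.Qvx t a₂ (D.Fv t a₁) := by
    intro a₁ a₂
    -- Using `ψ` and `ψ'` along two directions makes `y` enclose area in their plane. The skew
    -- integral becomes `2 ∫ ψ' ^ 2` times the antisymmetric expression, whose sign flips when `a₁`
    -- and `a₂` are exchanged.
    let P : Profile U V :=
      { y := fun s => ψ s • a₁ + ψ' s • a₂
        v := fun s => ψ' s • a₁ + ψ'' s • a₂
        u := fun _ => 0
        hasDerivAt := fun s => ((h1 s).smul_const a₁).add ((h2 s).smul_const a₂)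
        continuous_v := by fun_prop
        continuous_u := continuous_const
        y_eq_zero := fun s hs => by simp [h0 s hs]
        v_eq_zero := fun s hs => by simp [h0 s hs]
        u_eq_zero := fun s _ => rfl }
    have h := hD.integral_skewForm_nonneg P ht
    have e : ∀ s, D.skewForm t (P.v s) (P.y s) (P.u s) = (ψ' s ^ 2 - ψ s * ψ'' s)
        * (D.Qvx t a₁ (D.Fv t a₂) - D.Qvx t a₂ (D.Fv t a₁)) := by
      intro s
      simp only [P, skewForm, map_add, map_smul, add_apply, smul_apply, smul_eq_mul, map_zero]
      ring
    simp only [e] at h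
    rw [intervalIntegral.integral_mul_const, hparts] at h
    exact nonneg_of_mul_nonneg_right h (by positivity)
  exact le_antisymm (sub_nonneg.1 (key b₂ b₁)) (sub_nonneg.1 (key b₁ b₂))

/-- **Legendre condition**: there is no mixed term in the two controls. -/
theorem IsNonneg.Qvu_eq_zero (hD : D.IsNonneg) {t : ℝ} (ht : t ∈ Ioo 0 D.T) (b : V) (a : U) :
    D.Qvu t b a = 0 := by
  obtain ⟨ψ, ψ', ψ'', h1, h2, h3, h0, -, hpos⟩ := exists_bump
  have c1 : Continuous ψ' := continuous_iff_continuousAt.2 fun s => (h2 s).continuousAt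
  have key : ∀ a : U, 0 ≤ D.Qvu t b a := by
    intro a
    -- As `y` and `v` are parallel, the antisymmetric part drops out; `u` is in phase with `v`, so
    -- the mixed term is integrated against `ψ' ^ 2`.
    let P : Profile U V :=
      { y := fun s => ψ s • b
        v := fun s => ψ' s • b
        u := fun s => ψ' s • a
        hasDerivAt := fun s => (h1 s).smul_const b
        continuous_v := by fun_prop
        continuous_u := by fun_prop
        y_eq_zero := fun s hs => by simp [h0 s hs]
        v_eq_zero := fun s hs => by simp [h0 s hs]
        u_eq_zero := fun s hs => by simp [h0 s hs] }
    have h := hD.integral_skewForm_nonneg P ht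
    have e : ∀ s, D.skewForm t (P.v s) (P.y s) (P.u s) = ψ' s ^ 2 * (2 * D.Qvu t b a) := by
      intro s
      simp only [P, skewForm, map_smul, smul_apply, smul_eq_mul]
      ring
    simp only [e] at h
    rw [intervalIntegral.integral_mul_const] at h
    linarith [nonneg_of_mul_nonneg_right h hpos]
  have h := key (-a)
  rw [map_neg] at h
  linarith [key a]

/-- The transformed quadratic form is positive semidefinite. -/
theorem IsNonneg.gohForm_nonneg (hD : D.IsNonneg) {t : ℝ} (ht : t ∈ Ioo 0 D.T) (b : V) (a : U) :
    0 ≤ D.gohForm t b a := by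
  obtain ⟨ψ, ψ', ψ'', h1, h2, h3, h0, hpos, -⟩ := exists_bump
  have c0 : Continuous ψ := continuous_iff_continuousAt.2 fun s => (h1 s).continuousAt
  have c1 : Continuous ψ' := continuous_iff_continuousAt.2 fun s => (h2 s).continuousAt
  -- Now `u` is in phase with `y`. The skew form is zero pointwise, since `y` and `v` are parallel
  -- and `Q_vu = 0`.
  let P : Profile U V :=
    { y := fun s => ψ s • b
      v := fun s => ψ' s • b
      u := fun s => ψ s • a
      hasDerivAt := fun s => (h1 s).smul_const b
      continuous_v := by fun_prop
      continuous_u := by fun_prop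
      y_eq_zero := fun s hs => by simp [h0 s hs]
      v_eq_zero := fun s hs => by simp [h0 s hs]
      u_eq_zero := fun s hs => by simp [h0 s hs] }
  have h := hD.integral_gohForm_nonneg P (fun τ hτ s => by
    simp only [P, skewForm, map_smul, smul_apply, smul_eq_mul, hD.Qvu_eq_zero hτ]
    ring) ht
  simp only [P, gohForm_smul] at h
  rw [intervalIntegral.integral_mul_const] at h
  exact nonneg_of_mul_nonneg_right h hpos

end LQCoeffs

/-! ### Dynamics affine in `v`. -/

section Inclusions

variable {X U V : Type*} [NormedAddCommGroup X] [NormedSpace ℝ X] [NormedAddCommGroup U]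
  [NormedSpace ℝ U] [NormedAddCommGroup V] [NormedSpace ℝ V]

/-- The projection `(x, (u, v)) ↦ (x, u)`. -/
def projXU : X × U × V →L[ℝ] X × U :=
  (ContinuousLinearMap.fst ℝ _ _).prod
    ((ContinuousLinearMap.fst ℝ _ _).comp (ContinuousLinearMap.snd ℝ _ _))

/-- The projection `(x, (u, v)) ↦ v`. -/
def projV : X × U × V →L[ℝ] V :=
  (ContinuousLinearMap.snd ℝ _ _).comp (ContinuousLinearMap.snd ℝ _ _)

/-- The inclusion of the state directions. -/
def inX : X →L[ℝ] X × U × V := ContinuousLinearMap.inl ℝ _ _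

/-- The inclusion of the directions of the control `u`. -/
def inU : U →L[ℝ] X × U × V :=
  (ContinuousLinearMap.inr ℝ _ _).comp (ContinuousLinearMap.inl ℝ _ _)

/-- The inclusion of the directions of the control `v`. -/
def inV : V →L[ℝ] X × U × V :=
  (ContinuousLinearMap.inr ℝ _ _).comp (ContinuousLinearMap.inr ℝ _ _)

theorem inX_apply (x : X) : (inX x : X × U × V) = (x, 0, 0) := rfl
theorem inU_apply (u : U) : (inU u : X × U × V) = (0, u, 0) := rfl
theorem inV_apply (v : V) : (inV v : X × U × V) = (0, 0, v) := rfl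
theorem projXU_apply (y : X × U × V) : projXU y = (y.1, y.2.1) := rfl
theorem projXU_inV (v : V) : projXU (inV v : X × U × V) = 0 := rfl
theorem projXU_inX (x : X) : projXU (inX x : X × U × V) = (x, 0) := rfl
theorem projV_inV (v : V) : projV (inV v : X × U × V) = v := rfl

theorem contDiff_projXU : ContDiff ℝ 2 fun y : X × U × V => projXU y :=
  (projXU : X × U × V →L[ℝ] X × U).contDiff

theorem contDiff_projV : ContDiff ℝ 2 fun y : X × U × V => projV y :=
  (projV : X × U × V →L[ℝ] V).contDiff

theorem hasFDerivAt_projXU (y : X × U × V) :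
    HasFDerivAt (fun y : X × U × V => projXU y) projXU y :=
  (projXU : X × U × V →L[ℝ] X × U).hasFDerivAt

theorem eq_add_inclusions (x : X) (u : U) (v : V) :
    (x, u, v) = inX x + inU u + inV v := by
  simp [inX_apply, inU_apply, inV_apply]

variable {ι : Type*} [Fintype ι]

/-- Dynamics which are affine in `v`. -/
def affineField (c : ι → StrongDual ℝ V) (g₀ : X × U → X) (g : ι → X × U → X) (y : X × U × V) : X :=
  g₀ (projXU y) + ∑ i, c i (projV y) • g i (projXU y)

variable {c : ι → StrongDual ℝ V} {g₀ : X × U → X} {g : ι → X × U → X}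

theorem contDiff_affineField (hg₀ : ContDiff ℝ 2 g₀) (hg : ∀ i, ContDiff ℝ 2 (g i)) :
    ContDiff ℝ 2 (affineField c g₀ g) :=
  (hg₀.comp contDiff_projXU).add (ContDiff.sum fun i _ =>
    ((c i).contDiff.comp contDiff_projV).smul ((hg i).comp contDiff_projXU))

theorem fderiv_affineField_apply (hg₀ : ContDiff ℝ 2 g₀) (hg : ∀ i, ContDiff ℝ 2 (g i))
    (y z : X × U × V) :
    fderiv ℝ (affineField c g₀ g) y z = fderiv ℝ g₀ (projXU y) (projXU z) +
      ∑ i, (c i (projV z) • g i (projXU y) +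
        c i (projV y) • fderiv ℝ (g i) (projXU y) (projXU z)) := by
  have hd : ∀ h : X × U → X, ContDiff ℝ 2 h → HasFDerivAt (fun y : X × U × V => h (projXU y))
      ((fderiv ℝ h (projXU y)).comp projXU) y := fun h hh =>
    ((hh.differentiable two_ne_zero _).hasFDerivAt).comp y (hasFDerivAt_projXU y)
  have h : HasFDerivAt (affineField c g₀ g) _ y := (hd _ hg₀).add
    (HasFDerivAt.fun_sum fun i _ => ((c i).comp projV).hasFDerivAt.smul (hd _ (hg i)))
  rw [h.fderiv]
  simp only [add_apply, sum_apply, ContinuousLinearMap.comp_apply,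
    smul_apply, ContinuousLinearMap.smulRight_apply]
  congr 1
  exact Finset.sum_congr rfl fun i _ => add_comm _ _

theorem fderiv_fderiv_affineField_apply (hg₀ : ContDiff ℝ 2 g₀) (hg : ∀ i, ContDiff ℝ 2 (g i))
    (y z z' : X × U × V) :
    fderiv ℝ (fderiv ℝ (affineField c g₀ g)) y z z' =
      fderiv ℝ (fderiv ℝ g₀) (projXU y) (projXU z) (projXU z') +
      ∑ i, (c i (projV z') • fderiv ℝ (g i) (projXU y) (projXU z) +
        (c i (projV z) • fderiv ℝ (g i) (projXU y) (projXU z') +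
        c i (projV y) • fderiv ℝ (fderiv ℝ (g i)) (projXU y) (projXU z) (projXU z'))) := by
  have hd : ∀ h : X × U → X, ContDiff ℝ 2 h → HasFDerivAt (fun y : X × U × V => h (projXU y))
      ((fderiv ℝ h (projXU y)).comp projXU) y := fun h hh =>
    ((hh.differentiable two_ne_zero _).hasFDerivAt).comp y (hasFDerivAt_projXU y)
  have hd' : ∀ h : X × U → X, ContDiff ℝ 2 h →
      HasFDerivAt (fun y : X × U × V => fderiv ℝ h (projXU y) (projXU z'))
      (((fderiv ℝ (fderiv ℝ h) (projXU y)).comp projXU).flip (projXU z')) y := fun h hh => by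
    have h1 : HasFDerivAt (fun y : X × U × V => fderiv ℝ h (projXU y))
        ((fderiv ℝ (fderiv ℝ h) (projXU y)).comp projXU) y :=
      (((hh.fderiv_right (m := 1) le_rfl).differentiable one_ne_zero _).hasFDerivAt).comp y
        (hasFDerivAt_projXU y)
    simpa using h1.clm_apply (hasFDerivAt_const (projXU z') y)
  have h1 : HasFDerivAt (fun y => fderiv ℝ (affineField c g₀ g) y z')
      ((fderiv ℝ (fderiv ℝ (affineField c g₀ g)) y).flip z') y := by
    simpa using ((((contDiff_affineField hg₀ hg).fderiv_right (m := 1) le_rfl).differentiable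
      one_ne_zero y).hasFDerivAt).clm_apply (hasFDerivAt_const z' y)
  have h2 := (hd' _ hg₀).add (HasFDerivAt.fun_sum (u := Finset.univ) fun i _ =>
    ((hd _ (hg i)).const_smul (c i (projV z'))).add
      (((c i).comp projV).hasFDerivAt.smul (hd' _ (hg i))))
  have h3 : (fun y => fderiv ℝ (affineField c g₀ g) y z') = _ :=
    funext fun y => fderiv_affineField_apply hg₀ hg y z'
  rw [h3] at h1
  have h4 := DFunLike.congr_fun (h1.unique h2) z
  rw [ContinuousLinearMap.flip_apply] at h4
  rw [h4]
  simp only [add_apply, sum_apply, ContinuousLinearMap.comp_apply,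
    smul_apply, ContinuousLinearMap.smulRight_apply, ContinuousLinearMap.flip_apply]
  congr 1
  exact Finset.sum_congr rfl fun i _ => by rw [add_comm (c i (projV z) • _)]

theorem fderiv_affineField_inV (hg₀ : ContDiff ℝ 2 g₀) (hg : ∀ i, ContDiff ℝ 2 (g i))
    (y : X × U × V) (v : V) :
    fderiv ℝ (affineField c g₀ g) y (inV v) = ∑ i, c i v • g i (projXU y) := by
  simp only [fderiv_affineField_apply hg₀ hg, projXU_inV, map_zero, smul_zero, add_zero, zero_add,
    projV_inV]

theorem fderiv_fderiv_affineField_inV_inV (hg₀ : ContDiff ℝ 2 g₀) (hg : ∀ i, ContDiff ℝ 2 (g i))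
    (y : X × U × V) (v v' : V) :
    fderiv ℝ (fderiv ℝ (affineField c g₀ g)) y (inV v) (inV v') = 0 := by
  simp only [fderiv_fderiv_affineField_apply hg₀ hg, projXU_inV, map_zero, smul_zero, add_zero,
    Finset.sum_const_zero]

/-- Only first derivatives of the `g i` occur. This block therefore remains differentiable in time
along a `C¹` process, whereas the full second derivative is only known to be continuous. -/
theorem fderiv_fderiv_affineField_inV_inX (hg₀ : ContDiff ℝ 2 g₀) (hg : ∀ i, ContDiff ℝ 2 (g i))
    (y : X × U × V) (v : V) (x : X) :
    fderiv ℝ (fderiv ℝ (affineField c g₀ g)) y (inV v) (inX x) =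
      ∑ i, c i v • fderiv ℝ (g i) (projXU y) (x, 0) := by
  simp only [fderiv_fderiv_affineField_apply hg₀ hg, projXU_inV, projXU_inX, projV_inV, map_zero,
    smul_zero, add_zero, zero_add, zero_apply]

end Inclusions

section MixedForm

variable {X U V W Z ι : Type*} [NormedAddCommGroup X] [NormedSpace ℝ X] [NormedAddCommGroup U]
  [NormedSpace ℝ U] [NormedAddCommGroup V] [NormedSpace ℝ V] [NormedAddCommGroup W]
  [NormedSpace ℝ W] [NormedAddCommGroup Z] [NormedSpace ℝ Z] [Fintype ι]

omit [NormedSpace ℝ W] in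
theorem continuous_sum_univ {h : ι → ℝ → W} (hh : ∀ i, Continuous (h i)) :
    Continuous fun t => ∑ i, h i t :=
  continuous_finsetSum _ fun i _ => hh i

theorem hasDerivWithinAt_sum_univ {h : ι → ℝ → W} {h' : ι → W} {s : Set ℝ} {t : ℝ}
    (hh : ∀ i, HasDerivWithinAt (h i) (h' i) s t) :
    HasDerivWithinAt (fun t => ∑ i, h i t) (∑ i, h' i) s t :=
  HasDerivWithinAt.fun_sum fun i _ => hh i

theorem hasDerivWithinAt_smulRight (c : StrongDual ℝ V) {h : ℝ → W} {h' : W} {s : Set ℝ} {t : ℝ}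
    (hh : HasDerivWithinAt h h' s t) :
    HasDerivWithinAt (fun t => c.smulRight (h t)) (c.smulRight h') s t :=
  (ContinuousLinearMap.smulRightL ℝ V W c).hasFDerivAt.comp_hasDerivWithinAt t hh

theorem continuous_smulRight (c : StrongDual ℝ V) {h : ℝ → W} (hh : Continuous h) :
    Continuous fun t => c.smulRight (h t) :=
  (ContinuousLinearMap.smulRightL ℝ V W c).continuous.comp hh

theorem hasDerivAt_of_Icc {h : ℝ → W} {h' : W} {a b t : ℝ} (ht : t ∈ Ioo a b)
    (hh : HasDerivWithinAt h h' (Icc a b) t) : HasDerivAt h h' t :=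
  hh.hasDerivAt (Icc_mem_nhds ht.1 ht.2)

/-- A vector-valued bilinear map composed with a linear form and restricted to two families of
directions. -/
def restrictForm (p : StrongDual ℝ W) (Q : Z →L[ℝ] Z →L[ℝ] W) (a : X →L[ℝ] Z) (b : U →L[ℝ] Z) :
    X →L[ℝ] U →L[ℝ] ℝ :=
  ((ContinuousLinearMap.compL ℝ U W ℝ p).comp ((ContinuousLinearMap.compL ℝ U Z W).flip b)).comp
    (Q.comp a)

theorem restrictForm_apply (p : StrongDual ℝ W) (Q : Z →L[ℝ] Z →L[ℝ] W) (a : X →L[ℝ] Z)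
    (b : U →L[ℝ] Z) (x : X) (u : U) : restrictForm p Q a b x u = p (Q (a x) (b u)) := rfl

theorem continuous_restrictForm {p : ℝ → StrongDual ℝ W} {Q : ℝ → Z →L[ℝ] Z →L[ℝ] W}
    (hp : Continuous p) (hQ : Continuous Q) (a : X →L[ℝ] Z) (b : U →L[ℝ] Z) :
    Continuous fun t => restrictForm (p t) (Q t) a b :=
  (((ContinuousLinearMap.compL ℝ U W ℝ).continuous.comp hp).clm_comp continuous_const).clm_comp
    (hQ.clm_comp continuous_const)

/-- The bilinear form `(v, x) ↦ ∑ i, c i v * p (D_x g_i x)`. -/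
def mixedForm (c : ι → StrongDual ℝ V) (g : ι → X × U → X) (p : StrongDual ℝ X) (q : X × U) :
    V →L[ℝ] X →L[ℝ] ℝ :=
  ∑ i, (c i).smulRight
    (p.comp ((fderiv ℝ (g i) q).comp (ContinuousLinearMap.inl ℝ _ _)))

/-- The derivative of `mixedForm` in the direction of `(p', q')`. -/
def mixedFormDeriv (c : ι → StrongDual ℝ V) (g : ι → X × U → X) (p p' : StrongDual ℝ X)
    (q q' : X × U) : V →L[ℝ] X →L[ℝ] ℝ :=
  ∑ i, (c i).smulRight
    (p'.comp ((fderiv ℝ (g i) q).comp (ContinuousLinearMap.inl ℝ _ _)) +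
      p.comp ((fderiv ℝ (fderiv ℝ (g i)) q q').comp (ContinuousLinearMap.inl ℝ _ _)))

variable {c : ι → StrongDual ℝ V} {g : ι → X × U → X}

theorem mixedForm_apply (p : StrongDual ℝ X) (q : X × U) (v : V) (x : X) :
    mixedForm c g p q v x = ∑ i, c i v * p (fderiv ℝ (g i) q (x, 0)) := by
  simp only [mixedForm, sum_apply]
  rfl

variable (hg : ∀ i, ContDiff ℝ 2 (g i))
include hg

theorem hasDerivWithinAt_mixedForm {p : ℝ → StrongDual ℝ X} {q : ℝ → X × U} {p' : StrongDual ℝ X}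
    {q' : X × U} {s : Set ℝ} {t : ℝ} (hp : HasDerivWithinAt p p' s t)
    (hq : HasDerivWithinAt q q' s t) :
    HasDerivWithinAt (fun t => mixedForm c g (p t) (q t)) (mixedFormDeriv c g (p t) p' (q t) q')
      s t := by
  refine hasDerivWithinAt_sum_univ (ι := ι) (W := V →L[ℝ] X →L[ℝ] ℝ) fun i => ?_
  have h2 : HasDerivWithinAt (fun t => fderiv ℝ (g i) (q t))
      (fderiv ℝ (fderiv ℝ (g i)) (q t) q') s t :=
    ((((hg i).fderiv_right (m := 1) le_rfl).differentiable one_ne_zero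
      _).hasFDerivAt).comp_hasDerivWithinAt t hq
  have h3 := hp.clm_comp (h2.clm_comp
    (hasDerivWithinAt_const t s (ContinuousLinearMap.inl ℝ X U)))
  rw [ContinuousLinearMap.comp_zero, add_zero] at h3
  exact hasDerivWithinAt_smulRight (c i) h3

variable {p p' : ℝ → StrongDual ℝ X} {q q' : ℝ → X × U}

theorem continuous_mixedForm (hp : Continuous p) (hq : Continuous q) :
    Continuous fun t => mixedForm c g (p t) (q t) := by
  refine continuous_sum_univ (ι := ι) (W := V →L[ℝ] X →L[ℝ] ℝ) fun i => ?_
  have h1 : Continuous fun t => fderiv ℝ (g i) (q t) :=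
    ((hg i).continuous_fderiv two_ne_zero).comp hq
  exact continuous_smulRight (c i)
    (hp.clm_comp (h1.clm_comp continuous_const))

theorem continuous_mixedFormDeriv (hp : Continuous p) (hp' : Continuous p') (hq : Continuous q)
    (hq' : Continuous q') : Continuous fun t => mixedFormDeriv c g (p t) (p' t) (q t) (q' t) := by
  refine continuous_sum_univ (ι := ι) (W := V →L[ℝ] X →L[ℝ] ℝ) fun i => ?_
  have h1 : Continuous fun t => fderiv ℝ (g i) (q t) :=
    ((hg i).continuous_fderiv two_ne_zero).comp hq
  have h2 : Continuous fun t => fderiv ℝ (fderiv ℝ (g i)) (q t) :=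
    (((hg i).fderiv_right (m := 1) le_rfl).continuous_fderiv one_ne_zero).comp hq
  exact continuous_smulRight (c i)
    ((hp'.clm_comp (h1.clm_comp continuous_const)).add
      (hp.clm_comp ((h2.clm_apply hq').clm_comp continuous_const)))

end MixedForm

/-! ### The linear-quadratic functional along a reference process. -/

/-- A continuously differentiable process and costate, for dynamics which are affine in `v`. -/
structure Reference (X U V ι : Type*) [NormedAddCommGroup X] [NormedSpace ℝ X]
    [NormedAddCommGroup U] [NormedSpace ℝ U] [NormedAddCommGroup V] [NormedSpace ℝ V]
    [Fintype ι] where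
  T : ℝ
  pos : 0 < T
  g₀ : X × U → X
  g : ι → X × U → X
  c : ι → StrongDual ℝ V
  contDiff_g₀ : ContDiff ℝ 2 g₀
  contDiff_g : ∀ i, ContDiff ℝ 2 (g i)
  y : ℝ → X × U × V
  y' : ℝ → X × U × V
  p : ℝ → StrongDual ℝ X
  p' : ℝ → StrongDual ℝ X
  continuous_y : Continuous y
  continuous_y' : Continuous y'
  continuous_p : Continuous p
  continuous_p' : Continuous p'
  hasDerivWithinAt_y : ∀ t ∈ Icc 0 T, HasDerivWithinAt y (y' t) (Icc 0 T) t
  hasDerivWithinAt_p : ∀ t ∈ Icc 0 T, HasDerivWithinAt p (p' t) (Icc 0 T) t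

namespace Reference

variable {X U V ι : Type*} [NormedAddCommGroup X] [NormedSpace ℝ X] [NormedAddCommGroup U]
  [NormedSpace ℝ U] [NormedAddCommGroup V] [NormedSpace ℝ V] [Fintype ι] (r : Reference X U V ι)

/-- The dynamics. -/
def F : X × U × V → X := affineField r.c r.g₀ r.g

theorem contDiff_F : ContDiff ℝ 2 r.F := contDiff_affineField r.contDiff_g₀ r.contDiff_g

theorem continuous_fderiv : Continuous fun t => fderiv ℝ r.F (r.y t) :=
  (r.contDiff_F.continuous_fderiv two_ne_zero).comp r.continuous_y

theorem continuous_fderiv_fderiv : Continuous fun t => fderiv ℝ (fderiv ℝ r.F) (r.y t) :=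
  ((r.contDiff_F.fderiv_right (m := 1) le_rfl).continuous_fderiv one_ne_zero).comp r.continuous_y

theorem hasDerivWithinAt_Fv (t : ℝ) (ht : t ∈ Icc 0 r.T) :
    HasDerivWithinAt (fun t => (fderiv ℝ r.F (r.y t)).comp inV)
      ((fderiv ℝ (fderiv ℝ r.F) (r.y t) (r.y' t)).comp inV) (Icc 0 r.T) t := by
  have h : HasDerivWithinAt (fun t => fderiv ℝ r.F (r.y t))
      (fderiv ℝ (fderiv ℝ r.F) (r.y t) (r.y' t)) (Icc 0 r.T) t :=
    (((r.contDiff_F.fderiv_right (m := 1) le_rfl).differentiable one_ne_zero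
      _).hasFDerivAt).comp_hasDerivWithinAt t (r.hasDerivWithinAt_y t ht)
  simpa using h.clm_comp (hasDerivWithinAt_const t _ inV)

theorem hasDerivWithinAt_Qvx (t : ℝ) (ht : t ∈ Icc 0 r.T) :
    HasDerivWithinAt (fun t => mixedForm r.c r.g (r.p t) (projXU (r.y t)))
      (mixedFormDeriv r.c r.g (r.p t) (r.p' t) (projXU (r.y t)) (projXU (r.y' t)))
      (Icc 0 r.T) t :=
  hasDerivWithinAt_mixedForm r.contDiff_g (r.hasDerivWithinAt_p t ht)
    ((projXU : X × U × V →L[ℝ] X × U).hasFDerivAt.comp_hasDerivWithinAt t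
      (r.hasDerivWithinAt_y t ht))

theorem hasDerivAt_Fv (t : ℝ) (ht : t ∈ Ioo 0 r.T) :
    HasDerivAt (fun t => (fderiv ℝ r.F (r.y t)).comp inV)
      ((fderiv ℝ (fderiv ℝ r.F) (r.y t) (r.y' t)).comp inV) t :=
  hasDerivAt_of_Icc (W := V →L[ℝ] X) ht (r.hasDerivWithinAt_Fv t (Ioo_subset_Icc_self ht))

theorem hasDerivAt_Qvx (t : ℝ) (ht : t ∈ Ioo 0 r.T) :
    HasDerivAt (fun t => mixedForm r.c r.g (r.p t) (projXU (r.y t)))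
      (mixedFormDeriv r.c r.g (r.p t) (r.p' t) (projXU (r.y t)) (projXU (r.y' t))) t :=
  hasDerivAt_of_Icc (W := V →L[ℝ] X →L[ℝ] ℝ) ht (r.hasDerivWithinAt_Qvx t (Ioo_subset_Icc_self ht))

/-- The second variation along a reference process. -/
def lqCoeffs : LQCoeffs X U V where
  T := r.T
  pos := r.pos
  Fx t := (fderiv ℝ r.F (r.y t)).comp inX
  Fu t := (fderiv ℝ r.F (r.y t)).comp inU
  Fv t := (fderiv ℝ r.F (r.y t)).comp inV
  Fv' t := (fderiv ℝ (fderiv ℝ r.F) (r.y t) (r.y' t)).comp inV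
  Qxx t := restrictForm (r.p t) (fderiv ℝ (fderiv ℝ r.F) (r.y t)) inX inX
  Qux t := restrictForm (r.p t) (fderiv ℝ (fderiv ℝ r.F) (r.y t)) inU inX
  Quu t := restrictForm (r.p t) (fderiv ℝ (fderiv ℝ r.F) (r.y t)) inU inU
  Qvu t := restrictForm (r.p t) (fderiv ℝ (fderiv ℝ r.F) (r.y t)) inV inU
  -- Not written with `restrictForm` like the other blocks, because this one is differentiated in
  -- time.
  Qvx t := mixedForm r.c r.g (r.p t) (projXU (r.y t))
  Qvx' t := mixedFormDeriv r.c r.g (r.p t) (r.p' t) (projXU (r.y t)) (projXU (r.y' t))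
  continuous_Fx := r.continuous_fderiv.clm_comp continuous_const
  continuous_Fu := r.continuous_fderiv.clm_comp continuous_const
  continuous_Fv := r.continuous_fderiv.clm_comp continuous_const
  continuous_Fv' := (r.continuous_fderiv_fderiv.clm_apply r.continuous_y').clm_comp continuous_const
  continuous_Qxx := continuous_restrictForm r.continuous_p r.continuous_fderiv_fderiv _ _
  continuous_Qux := continuous_restrictForm r.continuous_p r.continuous_fderiv_fderiv _ _
  continuous_Quu := continuous_restrictForm r.continuous_p r.continuous_fderiv_fderiv _ _
  continuous_Qvu := continuous_restrictForm r.continuous_p r.continuous_fderiv_fderiv _ _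
  continuous_Qvx := continuous_mixedForm r.contDiff_g r.continuous_p
    (projXU.continuous.comp r.continuous_y)
  continuous_Qvx' := continuous_mixedFormDeriv r.contDiff_g r.continuous_p r.continuous_p'
    (projXU.continuous.comp r.continuous_y) (projXU.continuous.comp r.continuous_y')
  hasDerivAt_Fv := r.hasDerivAt_Fv
  hasDerivAt_Qvx := r.hasDerivAt_Qvx

theorem mixedForm_eq (p : StrongDual ℝ X) (y : X × U × V) (v : V) (x : X) :
    mixedForm r.c r.g p (projXU y) v x = p (fderiv ℝ (fderiv ℝ r.F) y (inV v) (inX x)) := by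
  rw [mixedForm_apply, F, fderiv_fderiv_affineField_inV_inX r.contDiff_g₀ r.contDiff_g, map_sum]
  simp only [map_smul, smul_eq_mul]

theorem fderiv_fderiv_inV_inV (y : X × U × V) (v v' : V) :
    fderiv ℝ (fderiv ℝ r.F) y (inV v) (inV v') = 0 :=
  fderiv_fderiv_affineField_inV_inV r.contDiff_g₀ r.contDiff_g y v v'

theorem symm (y z z' : X × U × V) :
    fderiv ℝ (fderiv ℝ r.F) y z z' = fderiv ℝ (fderiv ℝ r.F) y z' z :=
  (r.contDiff_F.contDiffAt.isSymmSndFDerivAt (by simp)).eq z z'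

theorem cost_eq (t : ℝ) (x : X) (u : U) (v : V) :
    r.lqCoeffs.cost t x u v =
      r.p t (fderiv ℝ (fderiv ℝ r.F) (r.y t) (x, u, v) (x, u, v)) := by
  rw [eq_add_inclusions]
  simp only [LQCoeffs.cost, lqCoeffs, restrictForm_apply, mixedForm_eq, map_add, add_apply,
    r.fderiv_fderiv_inV_inV, map_zero]
  rw [r.symm _ (inX x) (inU u), r.symm _ (inX x) (inV v), r.symm _ (inU u) (inV v)]
  ring

end Reference

theorem hasDerivAt_integral_of_continuous {E : Type*} [NormedAddCommGroup E] [NormedSpace ℝ E]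
    [CompleteSpace E] {g : ℝ → E} (hg : Continuous g) (t : ℝ) :
    HasDerivAt (fun t => ∫ s in (0 : ℝ)..t, g s) (g t) t :=
  intervalIntegral.integral_hasDerivAt_right (hg.intervalIntegrable _ _)
    (hg.stronglyMeasurableAtFilter _ _) hg.continuousAt

/-- A Lipschitz function is the integral of its almost everywhere derivative, if this derivative
agrees with a continuous function. -/
theorem eq_add_integral_of_ae_hasDerivAt {E : Type*} [NormedAddCommGroup E] [NormedSpace ℝ E]
    [CompleteSpace E] {f g : ℝ → E} {T : ℝ} {K : NNReal} (hf : LipschitzOnWith K f (Icc 0 T))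
    (hg : Continuous g) (hT : 0 ≤ T) (h : ∀ᵐ t ∂volume.restrict (Icc 0 T), HasDerivAt f (g t) t)
    {t : ℝ} (ht : t ∈ Icc 0 T) : f t = f 0 + ∫ s in (0 : ℝ)..t, g s := by
  have hI : ContDiff ℝ 1 fun t => ∫ s in (0 : ℝ)..t, g s := by
    rw [contDiff_one_iff_deriv]
    refine ⟨fun t => (hasDerivAt_integral_of_continuous hg t).differentiableAt, ?_⟩
    rwa [funext fun t => (hasDerivAt_integral_of_continuous hg t).deriv]
  rw [← uIcc_of_le hT] at hf
  have hac := hf.absolutelyContinuousOnInterval.sub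
    (hI.contDiffOn (s := uIcc 0 T)).absolutelyContinuousOnInterval
  rw [ae_restrict_iff' measurableSet_Icc] at h
  obtain ⟨C, hC⟩ := hac.const_of_ae_hasDerivAt_zero (by
    filter_upwards [h] with t ht hmem
    rw [uIcc_of_le hT] at hmem
    simpa using (ht hmem).sub (hasDerivAt_integral_of_continuous hg t))
  rw [uIcc_of_le hT] at hC
  have h0 := hC 0 ⟨le_rfl, hT⟩
  have h1 := hC t ht
  simp only [Pi.sub_apply, intervalIntegral.integral_same, sub_zero] at h0 h1
  rw [h0, ← h1, sub_add_cancel]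

namespace Reference

variable {X U V ι : Type*} [NormedAddCommGroup X] [NormedSpace ℝ X] [NormedAddCommGroup U]
  [NormedSpace ℝ U] [NormedAddCommGroup V] [NormedSpace ℝ V] [Fintype ι] (r : Reference X U V ι)

/-- A zero-endpoint trajectory of the linear-quadratic system restricts to a kernel element of the
linearized state equation, and there its cost is the integral of `p D²F`. -/
theorem isNonneg (y : C(Icc 0 r.T, X × U × V)) (hy : ∀ t : Icc 0 r.T, y t = r.y t)
    (h : ∀ z : C(Icc 0 r.T, X × U × V),
      linStateEq r.pos.le (composeLeft (fderiv ℝ r.F) (r.contDiff_F.continuous_fderiv two_ne_zero)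
        y) (0, z) = 0 → (z ⟨r.T, r.pos.le, le_rfl⟩).1 = 0 →
      0 ≤ ∫ t in (0 : ℝ)..r.T, r.p t (fderiv ℝ (fderiv ℝ r.F) (IccExtend r.pos.le y t)
        (IccExtend r.pos.le z t) (IccExtend r.pos.le z t))) : r.lqCoeffs.IsNonneg := by
  intro x u v hx hu hv hxt hxT
  let z : C(Icc 0 r.T, X × U × V) := ⟨fun t => (x t, u t, v t), by fun_prop⟩
  refine (h z ?_ hxT).trans (le_of_eq (intervalIntegral.integral_congr fun t ht => ?_))
  · ext t
    have h1 := hxt t t.2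
    have h2 : (stateOf z - constMap _ 0 - primitive r.pos.le (pointwiseApply (composeLeft
        (fderiv ℝ r.F) (r.contDiff_F.continuous_fderiv two_ne_zero) y) z) : C(Icc 0 r.T, X)) t
        = 0 := by
      rw [map_zero, sub_zero, ContinuousMap.sub_apply, sub_eq_zero, stateOf_apply, primitive_apply]
      refine h1.trans (intervalIntegral.integral_congr fun s hs => ?_)
      rw [uIcc_of_le t.2.1] at hs
      have hs' : s ∈ Icc 0 r.T := ⟨hs.1, hs.2.trans t.2.2⟩
      rw [IccExtend_of_mem _ _ hs', pointwiseApply_apply, composeLeft_apply, hy]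
      change _ = fderiv ℝ r.F (r.y s) (x s, u s, v s)
      rw [eq_add_inclusions, map_add, map_add]
      rfl
    exact h2
  · rw [uIcc_of_le r.pos.le] at ht
    have ht' : t ∈ Icc 0 r.T := ht
    rw [r.cost_eq, IccExtend_of_mem _ _ ht', IccExtend_of_mem _ _ ht', hy]
    rfl

end Reference

/-! ### Partial derivatives of the pre-Hamiltonian. -/

section PartialDerivatives

variable {X U V Y : Type*} [NormedAddCommGroup X] [NormedSpace ℝ X] [NormedAddCommGroup U]
  [NormedSpace ℝ U] [NormedAddCommGroup V] [NormedSpace ℝ V] [NormedAddCommGroup Y]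
  [NormedSpace ℝ Y] {Φ : X × U × V → Y} {x : X} {u : U} {v : V}

theorem hasFDerivAt_insertX : HasFDerivAt (fun x : X => (x, u, v)) inX x :=
  hasFDerivAt_prodMk_left x (u, v)

theorem hasFDerivAt_insertU : HasFDerivAt (fun u : U => (x, u, v)) inU u :=
  (hasFDerivAt_prodMk_right x (u, v)).comp u (hasFDerivAt_prodMk_left u v)

theorem hasFDerivAt_insertV : HasFDerivAt (fun v : V => (x, u, v)) inV v :=
  (hasFDerivAt_prodMk_right x (u, v)).comp v (hasFDerivAt_prodMk_right u v)

theorem fderiv_insertX (h : DifferentiableAt ℝ Φ (x, u, v)) :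
    fderiv ℝ (fun x => Φ (x, u, v)) x = (fderiv ℝ Φ (x, u, v)).comp inX :=
  (h.hasFDerivAt.comp x (hasFDerivAt_insertX (x := x) (u := u) (v := v))).fderiv

theorem fderiv_insertU (h : DifferentiableAt ℝ Φ (x, u, v)) :
    fderiv ℝ (fun u => Φ (x, u, v)) u = (fderiv ℝ Φ (x, u, v)).comp inU :=
  (h.hasFDerivAt.comp u (hasFDerivAt_insertU (x := x) (u := u) (v := v))).fderiv

theorem fderiv_insertV (h : DifferentiableAt ℝ Φ (x, u, v)) :
    fderiv ℝ (fun v => Φ (x, u, v)) v = (fderiv ℝ Φ (x, u, v)).comp inV :=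
  (h.hasFDerivAt.comp v (hasFDerivAt_insertV (x := x) (u := u) (v := v))).fderiv

variable {F : X × U × V → X} (hF : ContDiff ℝ 2 F) (p : StrongDual ℝ X)
include hF

theorem fderiv_comp_linearForm (y : X × U × V) :
    fderiv ℝ (fun y => p (F y)) y = p.comp (fderiv ℝ F y) :=
  (p.hasFDerivAt.comp y (hF.differentiable two_ne_zero y).hasFDerivAt).fderiv

theorem differentiable_comp_linearForm : Differentiable ℝ fun y => p (F y) :=
  fun y => p.differentiableAt.comp y (hF.differentiable two_ne_zero y)

theorem hasFDerivAt_linearForm_fderiv (y z : X × U × V) :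
    HasFDerivAt (fun y => p (fderiv ℝ F y z)) (p.comp ((fderiv ℝ (fderiv ℝ F) y).flip z)) y := by
  have h := (((hF.fderiv_right (m := 1) le_rfl).differentiable one_ne_zero y).hasFDerivAt).clm_apply
    (hasFDerivAt_const z y)
  rw [ContinuousLinearMap.comp_zero, zero_add] at h
  exact p.hasFDerivAt.comp y h

theorem fderiv_form_insertX (y z z' : X) :
    fderiv ℝ (fun x => fderiv ℝ (fun x' => p (F (x', u, v))) x z) y z' =
      p (fderiv ℝ (fderiv ℝ F) (y, u, v) (inX z') (inX z)) := by
  have h : (fun x => fderiv ℝ (fun x' => p (F (x', u, v))) x z) =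
      fun x => p (fderiv ℝ F (x, u, v) (inX z)) := by
    funext x
    rw [fderiv_insertX (Φ := fun y => p (F y)) (differentiable_comp_linearForm hF p _),
      fderiv_comp_linearForm hF p]
    rfl
  rw [h, fderiv_insertX (Φ := fun y => p (fderiv ℝ F y (inX z)))
    (hasFDerivAt_linearForm_fderiv hF p _ _).differentiableAt,
    (hasFDerivAt_linearForm_fderiv hF p _ _).fderiv]
  rfl

theorem fderiv_form_insertU_insertX (y : U) (z : X) (z' : U) :
    fderiv ℝ (fun u => fderiv ℝ (fun x' => p (F (x', u, v))) x z) y z' =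
      p (fderiv ℝ (fderiv ℝ F) (x, y, v) (inU z') (inX z)) := by
  have h : (fun u => fderiv ℝ (fun x' => p (F (x', u, v))) x z) =
      fun u => p (fderiv ℝ F (x, u, v) (inX z)) := by
    funext u
    rw [fderiv_insertX (Φ := fun y => p (F y)) (differentiable_comp_linearForm hF p _),
      fderiv_comp_linearForm hF p]
    rfl
  rw [h, fderiv_insertU (Φ := fun y => p (fderiv ℝ F y (inX z)))
    (hasFDerivAt_linearForm_fderiv hF p _ _).differentiableAt,
    (hasFDerivAt_linearForm_fderiv hF p _ _).fderiv]
  rfl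

theorem fderiv_form_insertV_insertX (y : V) (z : X) (z' : V) :
    fderiv ℝ (fun v => fderiv ℝ (fun x' => p (F (x', u, v))) x z) y z' =
      p (fderiv ℝ (fderiv ℝ F) (x, u, y) (inV z') (inX z)) := by
  have h : (fun v => fderiv ℝ (fun x' => p (F (x', u, v))) x z) =
      fun v => p (fderiv ℝ F (x, u, v) (inX z)) := by
    funext v
    rw [fderiv_insertX (Φ := fun y => p (F y)) (differentiable_comp_linearForm hF p _),
      fderiv_comp_linearForm hF p]
    rfl
  rw [h, fderiv_insertV (Φ := fun y => p (fderiv ℝ F y (inX z)))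
    (hasFDerivAt_linearForm_fderiv hF p _ _).differentiableAt,
    (hasFDerivAt_linearForm_fderiv hF p _ _).fderiv]
  rfl

theorem fderiv_form_insertU (y z z' : U) :
    fderiv ℝ (fun u => fderiv ℝ (fun u' => p (F (x, u', v))) u z) y z' =
      p (fderiv ℝ (fderiv ℝ F) (x, y, v) (inU z') (inU z)) := by
  have h : (fun u => fderiv ℝ (fun u' => p (F (x, u', v))) u z) =
      fun u => p (fderiv ℝ F (x, u, v) (inU z)) := by
    funext u
    rw [fderiv_insertU (Φ := fun y => p (F y)) (differentiable_comp_linearForm hF p _),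
      fderiv_comp_linearForm hF p]
    rfl
  rw [h, fderiv_insertU (Φ := fun y => p (fderiv ℝ F y (inU z)))
    (hasFDerivAt_linearForm_fderiv hF p _ _).differentiableAt,
    (hasFDerivAt_linearForm_fderiv hF p _ _).fderiv]
  rfl

end PartialDerivatives

namespace Problem

variable {n l m dφ dη : ℕ} (P : Problem n l m dφ dη)

/-- The coordinates of `v`. -/
def coordV : Fin m → StrongDual ℝ (Vec m) := fun i => EuclideanSpace.proj i

theorem coordV_apply (i : Fin m) (v : Vec m) : coordV i v = v i := rfl

/-- The dynamics as a function of the point `(x, (u, v))`. -/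
def dyn : Vec n × Vec l × Vec m → Vec n := affineField coordV (P.f 0) fun i => P.f i.succ

theorem dyn_apply (x : Vec n) (u : Vec l) (v : Vec m) : P.dyn (x, u, v) = P.F x u v := rfl

variable {P} (hreg : P.IsRegular)
include hreg

theorem IsRegular.contDiff_dyn : ContDiff ℝ 2 P.dyn :=
  contDiff_affineField (hreg.1 0).1 fun i => (hreg.1 i.succ).1

variable (w : Triple n l m) (p : ℝ → RowVec n) (t : ℝ)

theorem IsRegular.fderiv_H_x (q : RowVec n) (x : Vec n) (u : Vec l) (v : Vec m) :
    fderiv ℝ (fun x => P.H q x u v) x = q.comp ((fderiv ℝ P.dyn (x, u, v)).comp inX) := by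
  refine (fderiv_insertX (Φ := fun y => q (P.dyn y))
    (differentiable_comp_linearForm hreg.contDiff_dyn q _)).trans ?_
  rw [fderiv_comp_linearForm hreg.contDiff_dyn]
  rfl

theorem IsRegular.fderiv_H_u (q : RowVec n) (x : Vec n) (u : Vec l) (v : Vec m) :
    fderiv ℝ (fun u => P.H q x u v) u = q.comp ((fderiv ℝ P.dyn (x, u, v)).comp inU) := by
  refine (fderiv_insertU (Φ := fun y => q (P.dyn y))
    (differentiable_comp_linearForm hreg.contDiff_dyn q _)).trans ?_
  rw [fderiv_comp_linearForm hreg.contDiff_dyn]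
  rfl

theorem IsRegular.fderiv_H_v (q : RowVec n) (x : Vec n) (u : Vec l) (v : Vec m) :
    fderiv ℝ (fun v => P.H q x u v) v = q.comp ((fderiv ℝ P.dyn (x, u, v)).comp inV) := by
  refine (fderiv_insertV (Φ := fun y => q (P.dyn y))
    (differentiable_comp_linearForm hreg.contDiff_dyn q _)).trans ?_
  rw [fderiv_comp_linearForm hreg.contDiff_dyn]
  rfl

theorem IsRegular.Fx_apply (a b : Fin n) :
    P.Fx w t a b = fderiv ℝ P.dyn (w.x t, w.u t, w.v t) (inX (stdVec b)) a := by
  have h := fderiv_insertX (hreg.contDiff_dyn.differentiable two_ne_zero (w.x t, w.u t, w.v t))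
  exact congrArg (fun L : Vec n →L[ℝ] Vec n => L (stdVec b) a) h

theorem IsRegular.Fu_apply (a : Fin n) (b : Fin l) :
    P.Fu w t a b = fderiv ℝ P.dyn (w.x t, w.u t, w.v t) (inU (stdVec b)) a := by
  have h := fderiv_insertU (hreg.contDiff_dyn.differentiable two_ne_zero (w.x t, w.u t, w.v t))
  exact congrArg (fun L : Vec l →L[ℝ] Vec n => L (stdVec b) a) h

theorem IsRegular.Fv_apply (a : Fin n) (b : Fin m) :
    P.Fv w t a b = fderiv ℝ P.dyn (w.x t, w.u t, w.v t) (inV (stdVec b)) a := by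
  have h := fderiv_insertV (hreg.contDiff_dyn.differentiable two_ne_zero (w.x t, w.u t, w.v t))
  exact congrArg (fun L : Vec m →L[ℝ] Vec n => L (stdVec b) a) h

theorem IsRegular.Hxx_apply (a b : Fin n) :
    P.Hxx w p t a b = p t (fderiv ℝ (fderiv ℝ P.dyn) (w.x t, w.u t, w.v t)
      (inX (stdVec a)) (inX (stdVec b))) :=
  fderiv_form_insertX hreg.contDiff_dyn (p t) _ _ _

theorem IsRegular.Hux_apply (a : Fin l) (b : Fin n) :
    P.Hux w p t a b = p t (fderiv ℝ (fderiv ℝ P.dyn) (w.x t, w.u t, w.v t)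
      (inU (stdVec a)) (inX (stdVec b))) :=
  fderiv_form_insertU_insertX hreg.contDiff_dyn (p t) _ _ _

theorem IsRegular.Hvx_apply (a : Fin m) (b : Fin n) :
    P.Hvx w p t a b = p t (fderiv ℝ (fderiv ℝ P.dyn) (w.x t, w.u t, w.v t)
      (inV (stdVec a)) (inX (stdVec b))) :=
  fderiv_form_insertV_insertX hreg.contDiff_dyn (p t) _ _ _

theorem IsRegular.Huu_apply (a b : Fin l) :
    P.Huu w p t a b = p t (fderiv ℝ (fderiv ℝ P.dyn) (w.x t, w.u t, w.v t)
      (inU (stdVec a)) (inU (stdVec b))) :=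
  fderiv_form_insertU hreg.contDiff_dyn (p t) _ _ _

end Problem

/-! ### From the original problem to continuous controls. -/

theorem exists_lipschitzOnWith_of_hasDerivAt {E : Type*} [NormedAddCommGroup E] [NormedSpace ℝ E]
    {f g : ℝ → E} {a b : ℝ} (hg : ContinuousOn g (Icc a b))
    (h : ∀ t ∈ Icc a b, HasDerivAt f (g t) t) : ∃ K, LipschitzOnWith K f (Icc a b) := by
  obtain ⟨C, hC⟩ := isCompact_Icc.exists_bound_of_continuousOn hg
  refine ⟨C.toNNReal, (convex_Icc a b).lipschitzOnWith_of_nnnorm_hasDerivWithin_le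
    (fun t ht => (h t ht).hasDerivWithinAt) fun t ht => ?_⟩
  rw [← NNReal.coe_le_coe, coe_nnnorm]
  exact (hC t ht).trans (Real.le_coe_toNNReal C)

theorem eLpNorm_top_lt_ofReal {E : Type*} [NormedAddCommGroup E] {μ : Measure ℝ} {f : ℝ → E}
    {C ε : ℝ} (hC : C < ε) (hε : 0 < ε) (h : ∀ᵐ t ∂μ, ‖f t‖ ≤ C) :
    eLpNorm f ⊤ μ < ENNReal.ofReal ε := by
  rw [eLpNorm_exponent_top]
  exact (eLpNormEssSup_le_of_ae_bound h).trans_lt ((ENNReal.ofReal_lt_ofReal_iff hε).2 hC)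

section Costate

variable {E G ι κ : Type*} [NormedAddCommGroup E] [NormedSpace ℝ E]
  [NormedAddCommGroup G] [NormedSpace ℝ G] [Fintype ι] [Fintype κ] {T : ℝ} {hT : 0 ≤ T}
  {f : E × G → E} {φ : ι → E × E → ℝ} {η : κ → E × E → ℝ}
  {x₀ : E} {y : C(Icc 0 T, E × G)} {α : ι → ℝ} {β : κ → ℝ} {p : ℝ → StrongDual ℝ E}

theorem IsCostate.smul (hφ : ∀ i, ContDiff ℝ 2 (φ i)) (hη : ∀ j, ContDiff ℝ 2 (η j))
    (h : IsCostate hT f φ η x₀ y α β p) (c : ℝ) :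
    IsCostate hT f φ η x₀ y (c • α) (c • β) (fun t => c • p t) := by
  have hl : fderiv ℝ (endpointSum φ η (c • α) (c • β)) (endpoints hT (x₀, y))
      = c • fderiv ℝ (endpointSum φ η α β) (endpoints hT (x₀, y)) := by
    rw [(hasFDerivAt_endpointSum hφ hη _ _ _).fderiv, (hasFDerivAt_endpointSum hφ hη _ _ _).fderiv,
      smul_add, Finset.smul_sum, Finset.smul_sum]
    simp only [Pi.smul_apply, smul_eq_mul, mul_smul]
  refine ⟨fun t => ?_, ?_, ?_, fun t => ?_⟩
  · refine ((h.deriv t).const_smul c).congr_deriv ?_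
    rw [smul_neg, ContinuousLinearMap.smul_comp]
  · rw [hl, h.left, ContinuousLinearMap.smul_comp, smul_neg]
  · rw [hl, h.right, ContinuousLinearMap.smul_comp]
  · rw [ContinuousLinearMap.smul_comp, h.stationary t, smul_zero]

end Costate

namespace Problem

variable {n l m dφ dη : ℕ} {P : Problem n l m dφ dη} (hreg : P.IsRegular) (hT : 0 < P.T)
  {w : Triple n l m} {y : C(Icc 0 P.T, Vec n × Vec l × Vec m)}
  (hy : ∀ t : Icc 0 P.T, y t = (w.x t, w.u t, w.v t))

include hreg

theorem IsRegular.contDiff_φ (i) : ContDiff ℝ 2 (P.φ i) := (hreg.2.1 i).1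
theorem IsRegular.contDiff_η (i) : ContDiff ℝ 2 (P.η i) := (hreg.2.2 i).1

include hy

/-- Continuity of the reference controls enters here: the right-hand side is continuous, so a
Lipschitz solution almost everywhere satisfies the integral equation at every time. -/
theorem IsTrajectory.stateEq_eq_zero (hw : P.IsTrajectory w) :
    stateEq hT.le P.dyn hreg.contDiff_dyn.continuous (w.x 0, y) = 0 := by
  obtain ⟨⟨K, hK⟩, -, -, hder⟩ := hw
  have hg : Continuous fun t => P.dyn (IccExtend hT.le y t) :=
    hreg.contDiff_dyn.continuous.comp (continuous_extend hT.le y)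
  have hae : ∀ᵐ t ∂volume.restrict (Icc 0 P.T), HasDerivAt w.x (P.dyn (IccExtend hT.le y t)) t := by
    filter_upwards [hder, ae_restrict_mem measurableSet_Icc] with t ht hmem
    rw [IccExtend_of_mem _ _ hmem, hy]
    exact ht
  ext1 t
  have h := eq_add_integral_of_ae_hasDerivAt hK hg hT.le hae t.2
  have h2 : (stateOf y - constMap _ (w.x 0) - primitive hT.le (composeLeft P.dyn
      hreg.contDiff_dyn.continuous y) : C(Icc 0 P.T, Vec n)) t = 0 := by
    rw [ContinuousMap.sub_apply, ContinuousMap.sub_apply, stateOf_apply, constMap_apply, hy,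
      primitive_apply]
    simp only
    rw [h, add_sub_cancel_left, sub_eq_zero]
    rfl
  exact h2

omit hreg in
theorem endpoints_eq : endpoints hT.le (w.x 0, y) = (w.x 0, w.x P.T) := by
  rw [endpoints_apply, hy]

theorem fderiv_endpointLagrangian_left (α : Vec (dφ + 1)) (β : Vec dη) :
    fderiv ℝ (fun x₀ => P.endpointLagrangian α β (x₀, w.x P.T)) (w.x 0) =
      (fderiv ℝ (endpointSum P.φ P.η α β) (endpoints hT.le (w.x 0, y))).comp
        (ContinuousLinearMap.inl ℝ _ _) := by
  rw [endpoints_eq hT hy]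
  exact (((contDiff_endpointSum hreg.contDiff_φ hreg.contDiff_η α β).differentiable two_ne_zero
    _).hasFDerivAt.comp (w.x 0) (hasFDerivAt_prodMk_left (w.x 0) (w.x P.T))).fderiv

theorem fderiv_endpointLagrangian_right (α : Vec (dφ + 1)) (β : Vec dη) :
    fderiv ℝ (fun x₁ => P.endpointLagrangian α β (w.x 0, x₁)) (w.x P.T) =
      (fderiv ℝ (endpointSum P.φ P.η α β) (endpoints hT.le (w.x 0, y))).comp
        (ContinuousLinearMap.inr ℝ _ _) := by
  rw [endpoints_eq hT hy]
  exact (((contDiff_endpointSum hreg.contDiff_φ hreg.contDiff_η α β).differentiable two_ne_zero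
    _).hasFDerivAt.comp (w.x P.T) (hasFDerivAt_prodMk_right (w.x 0) (w.x P.T))).fderiv

/-- The values of `p` outside `[0, T]` are arbitrary, so `p` may fail to have two-sided derivatives
at the ends. It is replaced by `p 0` plus the integral of a continuous extension of the right-hand
side of the costate equation. -/
theorem IsMultiplier.exists_isCostate {α : Vec (dφ + 1)} {β : Vec dη} {p : ℝ → RowVec n}
    (hp : P.IsMultiplier w α β p) : ∃ q q' : ℝ → RowVec n, EqOn q p (Icc 0 P.T) ∧
      Continuous q' ∧ (∀ t, HasDerivAt q (q' t) t) ∧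
      IsCostate hT.le P.dyn P.φ P.η (w.x 0) y α β q := by
  obtain ⟨K, hK⟩ := hp.lipschitz
  let pc : C(Icc 0 P.T, RowVec n) := ⟨fun t => p t, hK.continuousOn.domRestrict⟩
  have hpc : Continuous (IccExtend hT.le pc) := continuous_extend hT.le pc
  have hF : Continuous fun t => fderiv ℝ P.dyn (IccExtend hT.le y t) :=
    (hreg.contDiff_dyn.continuous_fderiv two_ne_zero).comp (continuous_extend hT.le y)
  let g : ℝ → RowVec n := fun t =>
    -(IccExtend hT.le pc t).comp ((fderiv ℝ P.dyn (IccExtend hT.le y t)).comp inX)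
  have hg : Continuous g := (hpc.clm_comp (hF.clm_comp continuous_const)).neg
  have hgt : ∀ t (ht : t ∈ Icc 0 P.T),
      g t = -(p t).comp ((fderiv ℝ P.dyn (w.x t, w.u t, w.v t)).comp inX) := fun t ht => by
    simp only [g]
    rw [IccExtend_of_mem _ _ ht, IccExtend_of_mem _ _ ht, hy]
    rfl
  have hae : ∀ᵐ t ∂volume.restrict (Icc 0 P.T), HasDerivAt p (g t) t := by
    filter_upwards [hp.costate, ae_restrict_mem measurableSet_Icc] with t ht hmem
    rw [hgt t hmem, ← hreg.fderiv_H_x]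
    exact ht
  have hq := fun t (ht : t ∈ Icc 0 P.T) => eq_add_integral_of_ae_hasDerivAt hK hg hT.le hae ht
  set q : ℝ → RowVec n := fun t => p 0 + ∫ s in (0 : ℝ)..t, g s with hqdef
  have hqp : EqOn q p (Icc 0 P.T) := fun t ht => (hq t ht).symm
  have hqd : ∀ t, HasDerivAt q (g t) t := fun t =>
    (hasDerivAt_integral_of_continuous hg t).const_add (p 0)
  -- Stationarity almost everywhere becomes stationarity everywhere, because both sides are
  -- continuous on `[0, T]`.
  have hstat : ∀ {A : Type} [NormedAddCommGroup A] [NormedSpace ℝ A]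
      (a : A →L[ℝ] Vec n × Vec l × Vec m), (∀ᵐ t ∂volume.restrict (Icc 0 P.T),
        (p t).comp ((fderiv ℝ P.dyn (w.x t, w.u t, w.v t)).comp a) = 0) →
      ∀ t ∈ Icc 0 P.T, (p t).comp ((fderiv ℝ P.dyn (w.x t, w.u t, w.v t)).comp a) = 0 := by
    intro A _ _ a ha t ht
    have hc : Continuous fun t => (IccExtend hT.le pc t).comp
        ((fderiv ℝ P.dyn (IccExtend hT.le y t)).comp a) :=
      hpc.clm_comp (hF.clm_comp continuous_const)
    have heq : ∀ t ∈ Icc 0 P.T, (IccExtend hT.le pc t).comp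
        ((fderiv ℝ P.dyn (IccExtend hT.le y t)).comp a) =
          (p t).comp ((fderiv ℝ P.dyn (w.x t, w.u t, w.v t)).comp a) := fun t ht => by
      rw [IccExtend_of_mem _ _ ht, IccExtend_of_mem _ _ ht, hy]
      rfl
    have h := Measure.eqOn_Icc_of_ae_eq volume hT.ne (g := fun _ => (0 : A →L[ℝ] ℝ)) (by
      filter_upwards [ha, ae_restrict_mem measurableSet_Icc] with t ht hmem
      exact (heq t hmem).trans ht) hc.continuousOn continuousOn_const ht
    exact (heq t ht).symm.trans h
  refine ⟨q, g, hqp, hg, hqd, ⟨fun t => ?_, ?_, ?_, fun t => ?_⟩⟩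
  · refine (hqd t).congr_deriv ?_
    rw [hgt t t.2, hqp t.2, hy]
    rfl
  · rw [hqp ⟨le_rfl, hT.le⟩, hp.transversality_zero, fderiv_endpointLagrangian_left hreg hT hy]
  · rw [hqp ⟨hT.le, le_rfl⟩, hp.transversality_T, fderiv_endpointLagrangian_right hreg hT hy]
  · have hU := hstat inU (by
      filter_upwards [hp.stationarity_u] with t ht
      rw [← hreg.fderiv_H_u]
      exact ht) t t.2
    have hV := hstat inV (by
      filter_upwards [hp.stationarity_v] with t ht
      rw [← hreg.fderiv_H_v]
      exact ht) t t.2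
    rw [hqp t.2, hy]
    refine ContinuousLinearMap.ext fun z => ?_
    have hz : (ContinuousLinearMap.inr ℝ (Vec n) (Vec l × Vec m)) z = inU z.1 + inV z.2 := by
      simp [inU_apply, inV_apply]
    have h1 := DFunLike.congr_fun hU z.1
    have h2 := DFunLike.congr_fun hV z.2
    simp only [ContinuousLinearMap.comp_apply, zero_apply] at h1 h2 ⊢
    rw [hz, map_add, map_add, h1, h2, add_zero]

/-- With this converse, uniqueness of the multiplier applies to costates constructed from
annihilators. -/
theorem isMultiplier_of_isCostate {α : Vec (dφ + 1)} {β : Vec dη} {p : ℝ → RowVec n}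
    (hn : ‖α‖ + ‖β‖ = 1) (hα : ∀ i, 0 ≤ α i)
    (hp : IsCostate hT.le P.dyn P.φ P.η (w.x 0) y α β p) : P.IsMultiplier w α β p := by
  have hder : ∀ t ∈ Icc 0 P.T, HasDerivAt p
      (-(p t).comp ((fderiv ℝ P.dyn (w.x t, w.u t, w.v t)).comp inX)) t := fun t ht => by
    have h := hp.deriv ⟨t, ht⟩
    rw [hy] at h
    exact h
  have hpc : ContinuousOn p (Icc 0 P.T) := fun t ht => (hder t ht).continuousAt.continuousWithinAt
  have hyc : ContinuousOn (fun t => (w.x t, w.u t, w.v t)) (Icc 0 P.T) := by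
    rw [continuousOn_iff_continuous_domRestrict]
    exact y.continuous.congr hy
  have hF : ContinuousOn (fun t => fderiv ℝ P.dyn (w.x t, w.u t, w.v t)) (Icc 0 P.T) :=
    (hreg.contDiff_dyn.continuous_fderiv two_ne_zero).comp_continuousOn hyc
  have hst : ∀ t ∈ Icc 0 P.T, ∀ z, p t (fderiv ℝ P.dyn (w.x t, w.u t, w.v t) (0, z)) = 0 :=
    fun t ht z => by
    have h := DFunLike.congr_fun (hp.stationary ⟨t, ht⟩) z
    rw [hy] at h
    exact h
  refine ⟨exists_lipschitzOnWith_of_hasDerivAt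
    (hpc.clm_comp (hF.clm_comp continuousOn_const)).neg hder, hn, hα, ?_, ?_, ?_, ?_, ?_⟩
  · filter_upwards [ae_restrict_mem measurableSet_Icc] with t ht
    rw [hreg.fderiv_H_x]
    exact hder t ht
  · rw [hp.left, fderiv_endpointLagrangian_left hreg hT hy]
  · rw [hp.right, fderiv_endpointLagrangian_right hreg hT hy]
  · filter_upwards [ae_restrict_mem measurableSet_Icc] with t ht
    rw [hreg.fderiv_H_u]
    exact ContinuousLinearMap.ext fun z => hst t ht _
  · filter_upwards [ae_restrict_mem measurableSet_Icc] with t ht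
    rw [hreg.fderiv_H_v]
    exact ContinuousLinearMap.ext fun z => hst t ht _

/-- All conditions are homogeneous, so division by `‖α'‖ + ‖β'‖` (Euclidean norms) produces a
normalized multiplier, which is the given one. -/
theorem IsUniqueMultiplier.exists_smul {α : Vec (dφ + 1)} {β : Vec dη} {p : ℝ → RowVec n}
    (h : P.IsUniqueMultiplier w α β p) (α' : Fin (dφ + 1) → ℝ) (β' : Fin dη → ℝ)
    (p' : ℝ → RowVec n) (hα' : ∀ i, 0 ≤ α' i) (hne : α' ≠ 0 ∨ β' ≠ 0)
    (hp' : IsCostate hT.le P.dyn P.φ P.η (w.x 0) y α' β' p') :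
    ∃ c : ℝ, 0 ≤ c ∧ α' = c • (α : Fin (dφ + 1) → ℝ) ∧ β' = c • (β : Fin dη → ℝ) := by
  set s := ‖(WithLp.toLp 2 α' : Vec (dφ + 1))‖ + ‖(WithLp.toLp 2 β' : Vec dη)‖ with hs
  have hs0 : 0 < s := by
    rcases hne with hne | hne
    · refine add_pos_of_pos_of_nonneg (norm_pos_iff.2 fun h0 => hne ?_) (norm_nonneg _)
      simpa using h0
    · refine add_pos_of_nonneg_of_pos (norm_nonneg _) (norm_pos_iff.2 fun h0 => hne ?_)
      simpa using h0
  have hm := isMultiplier_of_isCostate hreg hT hy (α := s⁻¹ • WithLp.toLp 2 α')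
    (β := s⁻¹ • WithLp.toLp 2 β') (p := fun t => s⁻¹ • p' t)
    (by
      rw [norm_smul, norm_smul, ← mul_add, ← hs, Real.norm_of_nonneg (inv_nonneg.2 hs0.le),
        inv_mul_cancel₀ hs0.ne'])
    (fun i => mul_nonneg (inv_nonneg.2 hs0.le) (hα' i))
    (hp'.smul hreg.contDiff_φ hreg.contDiff_η s⁻¹)
  obtain ⟨h1, h2, -⟩ := h.2 _ _ _ hm
  refine ⟨s, hs0.le, ?_, ?_⟩
  · rw [← h1]
    funext i
    simp [hs0.ne']
  · rw [← h2]
    funext i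
    simp [hs0.ne']

/-- A continuous process close in the supremum norm is an admissible competitor in the `L^∞` sense.
Since the inequality constraints are active, decreasing all of them strictly keeps the process
feasible, and decreasing the cost as well contradicts minimality. -/
theorem IsWeakMinimum.not_decreasing (hmin : P.IsWeakMinimum w)
    (hactive : ∀ i : Fin dφ, P.φ i.succ (w.x 0, w.x P.T) = 0) :
    ∃ ε > 0, ∀ z, ‖z - (w.x 0, y)‖ < ε →
      stateEq hT.le P.dyn hreg.contDiff_dyn.continuous z = 0 →
      (∀ j, P.η j (endpoints hT.le z) = 0) →
        ¬ ∀ i, P.φ i (endpoints hT.le z) < P.φ i (endpoints hT.le (w.x 0, y)) := by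
  obtain ⟨-, ε, hε, hmin⟩ := hmin
  refine ⟨ε, hε, ?_⟩
  rintro ⟨x₀, z⟩ hz hstate hη hφ
  rw [endpoints_eq hT hy] at hφ
  have hzc := continuous_extend hT.le z
  have hg : Continuous fun t => P.dyn (IccExtend hT.le z t) :=
    hreg.contDiff_dyn.continuous.comp hzc
  -- The state is given by its integral rather than by `z`, so that it is differentiable on the
  -- whole line.
  let w' : Triple n l m := ⟨fun t => x₀ + ∫ s in (0 : ℝ)..t, P.dyn (IccExtend hT.le z s),
    fun t => (IccExtend hT.le z t).2.1, fun t => (IccExtend hT.le z t).2.2⟩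
  have hder : ∀ t, HasDerivAt w'.x (P.dyn (IccExtend hT.le z t)) t := fun t =>
    (hasDerivAt_integral_of_continuous hg t).const_add x₀
  have hx : ∀ t (ht : t ∈ Icc 0 P.T), w'.x t = (z ⟨t, ht⟩).1 := fun t ht => by
    have h : stateOf z - constMap _ x₀ - primitive hT.le (composeLeft P.dyn
      hreg.contDiff_dyn.continuous z) = 0 := hstate
    rw [sub_sub, sub_eq_zero] at h
    exact (DFunLike.congr_fun h ⟨t, ht⟩).symm
  have hend : endpoints hT.le (x₀, z) = (w'.x 0, w'.x P.T) := by
    rw [endpoints_apply, hx P.T ⟨hT.le, le_rfl⟩]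
    simp [w']
  have hF : ∀ t ∈ Icc 0 P.T, P.F (w'.x t) (w'.u t) (w'.v t) = P.dyn (IccExtend hT.le z t) :=
    fun t ht => by
    rw [hx t ht, ← P.dyn_apply]
    simp only [w', IccExtend_of_mem _ _ ht]
  rw [hend] at hη hφ
  have hfeas : P.IsFeasible w' := by
    refine ⟨⟨exists_lipschitzOnWith_of_hasDerivAt hg.continuousOn fun t _ => hder t, ?_, ?_, ?_⟩,
      hη, fun i => ((hφ i.succ).trans_eq (hactive i)).le⟩
    · exact memLp_top_of_bound (hzc.snd.fst.aestronglyMeasurable) ‖z‖ (Eventually.of_forall fun t =>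
        ((norm_fst_le _).trans (norm_snd_le _)).trans (norm_extend_le hT.le z t))
    · exact memLp_top_of_bound (hzc.snd.snd.aestronglyMeasurable) ‖z‖ (Eventually.of_forall fun t =>
        ((norm_snd_le _).trans (norm_snd_le _)).trans (norm_extend_le hT.le z t))
    · filter_upwards [ae_restrict_mem measurableSet_Icc] with t ht
      rw [hF t ht]
      exact hder t
  have hd : ∀ t : Icc 0 P.T, ‖z t - (w.x t, w.u t, w.v t)‖ ≤ ‖(x₀, z) - (w.x 0, y)‖ := fun t => by
    rw [← hy]
    exact ((z - y).norm_coe_le_norm t).trans (norm_snd_le ((x₀, z) - (w.x 0, y)))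
  refine (hφ 0).not_ge (hmin w' hfeas (eLpNorm_top_lt_ofReal hz hε ?_)
    (eLpNorm_top_lt_ofReal hz hε ?_) (eLpNorm_top_lt_ofReal hz hε ?_))
  · filter_upwards [ae_restrict_mem measurableSet_Icc] with t ht
    rw [Pi.sub_apply, hx t ht]
    exact (norm_fst_le _).trans (hd ⟨t, ht⟩)
  · filter_upwards [ae_restrict_mem measurableSet_Icc] with t ht
    have h : w'.u t = (z ⟨t, ht⟩).2.1 := by simp only [w', IccExtend_of_mem _ _ ht]
    rw [Pi.sub_apply, h]
    exact ((norm_fst_le _).trans (norm_snd_le _)).trans (hd ⟨t, ht⟩)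
  · filter_upwards [ae_restrict_mem measurableSet_Icc] with t ht
    have h : w'.v t = (z ⟨t, ht⟩).2.2 := by simp only [w', IccExtend_of_mem _ _ ht]
    rw [Pi.sub_apply, h]
    exact ((norm_snd_le _).trans (norm_snd_le _)).trans (hd ⟨t, ht⟩)

end Problem

/-! ### From operators to the matrices of the statement. -/

namespace LQCoeffs

variable {E U V : Type*} [NormedAddCommGroup E] [NormedSpace ℝ E]
  [NormedAddCommGroup U] [NormedSpace ℝ U] [NormedAddCommGroup V] [NormedSpace ℝ V]
  (D : LQCoeffs E U V)

/-- The operator `B = F_x F_v - (d/dt) F_v`. -/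
def transfer (t : ℝ) : V →L[ℝ] E := (D.Fx t).comp (D.Fv t) - D.Fv' t

/-- The time derivative of the bilinear form `(y, z) ↦ Q_vx y (F_v z)`. -/
def productDeriv (t : ℝ) : V →L[ℝ] V →L[ℝ] ℝ :=
  (D.Qvx' t).bilinearComp (.id ℝ V) (D.Fv t) + (D.Qvx t).bilinearComp (.id ℝ V) (D.Fv' t)

/-- The `y`-`y` block of the transformed quadratic form. -/
def gohBlock (t : ℝ) : V →L[ℝ] V →L[ℝ] ℝ :=
  (D.Qxx t).bilinearComp (D.Fv t) (D.Fv t)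
    - ((D.Qvx t).bilinearComp (.id ℝ V) (D.transfer t)
      + ((D.Qvx t).bilinearComp (.id ℝ V) (D.transfer t)).flip)
    - (1 / 2 : ℝ) • (D.productDeriv t + (D.productDeriv t).flip)

/-- The `y`-`u` block of the transformed quadratic form. -/
def gohCross (t : ℝ) : V →L[ℝ] U →L[ℝ] ℝ :=
  (D.Qux t).flip.bilinearComp (D.Fv t) (.id ℝ U) - (D.Qvx t).bilinearComp (.id ℝ V) (D.Fu t)

theorem transfer_apply (t : ℝ) (y : V) : D.transfer t y = D.Fx t (D.Fv t y) - D.Fv' t y := rfl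

theorem productDeriv_apply (t : ℝ) (y z : V) :
    D.productDeriv t y z = D.Qvx' t y (D.Fv t z) + D.Qvx t y (D.Fv' t z) := rfl

theorem gohBlock_apply (t : ℝ) (y z : V) :
    D.gohBlock t y z = D.Qxx t (D.Fv t y) (D.Fv t z)
      - (D.Qvx t y (D.transfer t z) + D.Qvx t z (D.transfer t y))
      - 1 / 2 * (D.productDeriv t y z + D.productDeriv t z y) := rfl

theorem gohCross_apply (t : ℝ) (y : V) (u : U) :
    D.gohCross t y u = D.Qux t u (D.Fv t y) - D.Qvx t y (D.Fu t u) := rfl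

/-- On the diagonal a bilinear form agrees with its symmetric part. This is why the derivative of
`Q_vx F_v` enters through that of its symmetrization `S`. -/
theorem gohForm_eq (t : ℝ) (y : V) (u : U) :
    D.gohForm t y u = D.Quu t u u + 2 * D.gohCross t y u + D.gohBlock t y y := by
  simp only [gohForm, rate, gohBlock_apply, gohCross_apply, productDeriv_apply, transfer_apply,
    map_add, map_sub]
  ring

theorem hasDerivWithinAt_product {s : Set ℝ} {t : ℝ} (hF : HasDerivWithinAt D.Fv (D.Fv' t) s t)
    (hQ : HasDerivWithinAt D.Qvx (D.Qvx' t) s t) (y z : V) :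
    HasDerivWithinAt (fun t => D.Qvx t y (D.Fv t z)) (D.productDeriv t y z) s t := by
  have h1 := hQ.clm_apply (hasDerivWithinAt_const t s y)
  have h2 := hF.clm_apply (hasDerivWithinAt_const t s z)
  simp only [map_zero, add_zero] at h1 h2
  exact h1.clm_apply h2

variable {D} [FiniteDimensional ℝ E] [FiniteDimensional ℝ U] [FiniteDimensional ℝ V]

/-- The variations were placed at interior times; the condition is closed and the coefficients are
continuous, so it passes to `0` and `T`. -/
theorem IsNonneg.symm_of_mem_Icc (hD : D.IsNonneg) {t : ℝ} (ht : t ∈ Icc 0 D.T) (y z : V) :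
    D.Qvx t y (D.Fv t z) = D.Qvx t z (D.Fv t y) := by
  have hc : IsClosed {t | D.Qvx t y (D.Fv t z) = D.Qvx t z (D.Fv t y)} :=
    isClosed_eq (by fun_prop) (by fun_prop)
  have h : closure (Ioo 0 D.T) ⊆ {t | D.Qvx t y (D.Fv t z) = D.Qvx t z (D.Fv t y)} :=
    closure_minimal (fun t ht => hD.symm ht y z) hc
  rw [closure_Ioo D.pos.ne] at h
  exact h ht

theorem IsNonneg.gohForm_nonneg_of_mem_Icc (hD : D.IsNonneg) {t : ℝ} (ht : t ∈ Icc 0 D.T) (y : V)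
    (u : U) : 0 ≤ D.gohForm t y u := by
  have hc : IsClosed {t | 0 ≤ D.gohForm t y u} :=
    isClosed_le continuous_const (by unfold gohForm rate; fun_prop)
  have h : closure (Ioo 0 D.T) ⊆ {t | 0 ≤ D.gohForm t y u} :=
    closure_minimal (fun t ht => hD.gohForm_nonneg ht y u) hc
  rw [closure_Ioo D.pos.ne] at h
  exact h ht

end LQCoeffs

theorem sum_smul_stdVec {k : ℕ} (x : Vec k) : ∑ b, x b • (stdVec b : Vec k) = x := by
  ext a
  simp [Pi.single_apply]

theorem sum_apply_stdVec {k : ℕ} {Y : Type*} [NormedAddCommGroup Y] [NormedSpace ℝ Y]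
    (L : Vec k →L[ℝ] Y) (x : Vec k) : ∑ b, x b • L (stdVec b) = L x := by
  conv_rhs => rw [← sum_smul_stdVec x, map_sum]
  simp only [map_smul]

theorem dotProduct_mulVec_of_entries {k k' : ℕ} {M : Matrix (Fin k) (Fin k') ℝ}
    (L : Vec k →L[ℝ] Vec k' →L[ℝ] ℝ) (hM : ∀ i j, M i j = L (stdVec i) (stdVec j))
    (a : Fin k → ℝ) (b : Fin k' → ℝ) :
    a ⬝ᵥ M.mulVec b = L (WithLp.toLp 2 a) (WithLp.toLp 2 b) := by
  rw [← sum_apply_stdVec L, sum_apply]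
  refine Finset.sum_congr rfl fun i _ => ?_
  rw [smul_apply, ← sum_apply_stdVec (L (stdVec i))]
  simp only [Matrix.mulVec, dotProduct, hM, smul_eq_mul]
  congr 1
  exact Finset.sum_congr rfl fun j _ => mul_comm _ _

namespace Problem

variable {n l m dφ dη : ℕ} (P : Problem n l m dφ dη)

/-- The matrices of derivatives along `w` and `p` are those of the operators `D`. -/
structure Represents (w : Triple n l m) (p : ℝ → RowVec n)
    (D : LQCoeffs (Vec n) (Vec l) (Vec m)) : Prop where
  time : D.T = P.T
  fx : ∀ t ∈ Icc 0 P.T, ∀ a b, P.Fx w t a b = D.Fx t (stdVec b) a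
  fu : ∀ t ∈ Icc 0 P.T, ∀ a b, P.Fu w t a b = D.Fu t (stdVec b) a
  fv : ∀ t ∈ Icc 0 P.T, ∀ a b, P.Fv w t a b = D.Fv t (stdVec b) a
  hxx : ∀ t ∈ Icc 0 P.T, ∀ a b, P.Hxx w p t a b = D.Qxx t (stdVec a) (stdVec b)
  hux : ∀ t ∈ Icc 0 P.T, ∀ a b, P.Hux w p t a b = D.Qux t (stdVec a) (stdVec b)
  huu : ∀ t ∈ Icc 0 P.T, ∀ a b, P.Huu w p t a b = D.Quu t (stdVec a) (stdVec b)
  hvx : ∀ t ∈ Icc 0 P.T, ∀ a b, P.Hvx w p t a b = D.Qvx t (stdVec a) (stdVec b)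
  symm_Qxx : ∀ t x x', D.Qxx t x x' = D.Qxx t x' x
  symm_Quu : ∀ t u u', D.Quu t u u' = D.Quu t u' u
  deriv_Fv : ∀ t ∈ Icc 0 P.T, HasDerivWithinAt D.Fv (D.Fv' t) (Icc 0 P.T) t
  deriv_Qvx : ∀ t ∈ Icc 0 P.T, HasDerivWithinAt D.Qvx (D.Qvx' t) (Icc 0 P.T) t

namespace Represents

variable {P} {w : Triple n l m} {p : ℝ → RowVec n} {D : LQCoeffs (Vec n) (Vec l) (Vec m)}
  (h : P.Represents w p D) {t : ℝ} (ht : t ∈ Icc 0 P.T)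
include h ht

theorem hvx_mul_fv (i j : Fin m) :
    (P.Hvx w p t * P.Fv w t) i j = D.Qvx t (stdVec i) (D.Fv t (stdVec j)) := by
  rw [Matrix.mul_apply, ← sum_apply_stdVec (D.Qvx t (stdVec i))]
  refine Finset.sum_congr rfl fun k _ => ?_
  rw [h.hvx t ht, h.fv t ht, smul_eq_mul, mul_comm]

theorem matDeriv_fv (a : Fin n) (i : Fin m) :
    P.matDeriv t (P.Fv w) a i = D.Fv' t (stdVec i) a := by
  have h1 := (h.deriv_Fv t ht).clm_apply (hasDerivWithinAt_const t _ (stdVec i))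
  rw [map_zero, add_zero] at h1
  have h2 : HasDerivWithinAt (fun s => D.Fv s (stdVec i) a) (D.Fv' t (stdVec i) a) (Icc 0 P.T) t :=
    (EuclideanSpace.proj a : Vec n →L[ℝ] ℝ).hasFDerivAt.comp_hasDerivWithinAt t h1
  have h3 : HasDerivWithinAt (fun s => P.Fv w s a i) (D.Fv' t (stdVec i) a) (Icc 0 P.T) t :=
    h2.congr (fun s hs => h.fv s hs a i) (h.fv t ht a i)
  exact h3.derivWithin (uniqueDiffOn_Icc (h.time ▸ D.pos) t ht)

theorem b_apply (a : Fin n) (i : Fin m) : P.B w t a i = D.transfer t (stdVec i) a := by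
  rw [B, Matrix.sub_apply, h.matDeriv_fv ht, Matrix.mul_apply, D.transfer_apply, PiLp.sub_apply]
  congr 1
  rw [← sum_apply_stdVec (D.Fx t)]
  simp only [WithLp.ofLp_sum, Finset.sum_apply, PiLp.smul_apply, smul_eq_mul]
  refine Finset.sum_congr rfl fun k _ => ?_
  rw [h.fx t ht, h.fv t ht, mul_comm]

theorem hvx_mul_b (i j : Fin m) :
    (P.Hvx w p t * P.B w t) i j = D.Qvx t (stdVec i) (D.transfer t (stdVec j)) := by
  rw [Matrix.mul_apply, ← sum_apply_stdVec (D.Qvx t (stdVec i))]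
  refine Finset.sum_congr rfl fun k _ => ?_
  rw [h.hvx t ht, h.b_apply ht, smul_eq_mul, mul_comm]

theorem e_apply (i : Fin m) (a : Fin l) :
    P.E w p t i a = D.gohCross t (stdVec i) (stdVec a) := by
  rw [E, Matrix.sub_apply, Matrix.mul_apply, Matrix.mul_apply, D.gohCross_apply]
  congr 1
  · rw [← sum_apply_stdVec (D.Qux t (stdVec a))]
    refine Finset.sum_congr rfl fun k _ => ?_
    rw [Matrix.transpose_apply, Matrix.transpose_apply, h.hux t ht, h.fv t ht, smul_eq_mul]
  · rw [← sum_apply_stdVec (D.Qvx t (stdVec i))]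
    refine Finset.sum_congr rfl fun k _ => ?_
    rw [h.hvx t ht, h.fu t ht, smul_eq_mul, mul_comm]

theorem s_apply (i j : Fin m) : P.S w p t i j =
    1 / 2 * (D.Qvx t (stdVec i) (D.Fv t (stdVec j)) + D.Qvx t (stdVec j) (D.Fv t (stdVec i))) := by
  rw [S, Matrix.smul_apply, Matrix.add_apply, Matrix.transpose_apply, h.hvx_mul_fv ht,
    h.hvx_mul_fv ht, smul_eq_mul]

theorem matDeriv_s (i j : Fin m) : P.matDeriv t (P.S w p) i j =
    1 / 2 * (D.productDeriv t (stdVec i) (stdVec j) + D.productDeriv t (stdVec j) (stdVec i)) := by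
  have h1 := D.hasDerivWithinAt_product (h.deriv_Fv t ht) (h.deriv_Qvx t ht)
  have h2 := ((h1 (stdVec i) (stdVec j)).add (h1 (stdVec j) (stdVec i))).const_mul (1 / 2)
  have h3 : HasDerivWithinAt (fun s => P.S w p s i j) _ (Icc 0 P.T) t :=
    h2.congr (fun s hs => h.s_apply hs i j) (h.s_apply ht i j)
  exact h3.derivWithin (uniqueDiffOn_Icc (h.time ▸ D.pos) t ht)

theorem fv_hxx_fv (i j : Fin m) : ((P.Fv w t).transpose * P.Hxx w p t * P.Fv w t) i j =
    D.Qxx t (D.Fv t (stdVec i)) (D.Fv t (stdVec j)) := by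
  rw [Matrix.mul_apply, ← sum_apply_stdVec (D.Qxx t (D.Fv t (stdVec i)))]
  refine Finset.sum_congr rfl fun k _ => ?_
  rw [Matrix.mul_apply, h.fv t ht, smul_eq_mul, mul_comm, ← sum_apply_stdVec (D.Qxx t), sum_apply]
  congr 1
  refine Finset.sum_congr rfl fun k' _ => ?_
  rw [Matrix.transpose_apply, h.hxx t ht, h.fv t ht]
  rfl

theorem r_apply (i j : Fin m) : P.R w p t i j = D.gohBlock t (stdVec i) (stdVec j) := by
  rw [R, Matrix.sub_apply, Matrix.sub_apply, Matrix.add_apply, Matrix.transpose_apply,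
    h.fv_hxx_fv ht, h.hvx_mul_b ht, h.hvx_mul_b ht, h.matDeriv_s ht, D.gohBlock_apply]

theorem isSymm_hvx_mul_fv (hD : D.IsNonneg) : (P.Hvx w p t * P.Fv w t).IsSymm := by
  refine Matrix.IsSymm.ext fun i j => ?_
  rw [h.hvx_mul_fv ht, h.hvx_mul_fv ht]
  exact hD.symm_of_mem_Icc (h.time.symm ▸ ht) _ _

/-- The quadratic form of the block matrix at `Sum.elim a b` is `gohForm` with `y = b` and `u = a`.
Symmetry comes from that of `Q_uu` and `Q_xx` together with the symmetrized terms of `gohBlock`. -/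
theorem posSemidef (hD : D.IsNonneg) :
    (Matrix.fromBlocks (P.Huu w p t) (P.E w p t).transpose (P.E w p t)
      (P.R w p t)).PosSemidef := by
  refine Matrix.PosSemidef.of_dotProduct_mulVec_nonneg ?_ fun x => ?_
  · refine Matrix.IsHermitian.fromBlocks ?_ ?_ ?_
    · refine Matrix.IsHermitian.ext fun i j => ?_
      rw [star_trivial, h.huu t ht, h.huu t ht, h.symm_Quu]
    · rw [Matrix.conjTranspose_eq_transpose_of_trivial, Matrix.transpose_transpose]
    · refine Matrix.IsHermitian.ext fun i j => ?_
      rw [star_trivial, h.r_apply ht, h.r_apply ht, D.gohBlock_apply, D.gohBlock_apply, h.symm_Qxx]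
      ring
  · set a : Fin l → ℝ := x ∘ Sum.inl with ha
    set b : Fin m → ℝ := x ∘ Sum.inr with hb
    have hx : x = Sum.elim a b := (Sum.elim_comp_inl_inr x).symm
    rw [star_trivial, Matrix.fromBlocks_mulVec, ← ha, ← hb, hx, sumElim_dotProduct_sumElim,
      dotProduct_add, dotProduct_add, Matrix.mulVec_transpose, dotProduct_comm a (Matrix.vecMul _ _),
      ← Matrix.dotProduct_mulVec, dotProduct_mulVec_of_entries _ (h.huu t ht),
      dotProduct_mulVec_of_entries _ (h.e_apply ht), dotProduct_mulVec_of_entries _ (h.r_apply ht)]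
    have h1 := hD.gohForm_nonneg_of_mem_Icc (h.time.symm ▸ ht) (WithLp.toLp 2 b) (WithLp.toLp 2 a)
    rw [D.gohForm_eq] at h1
    linarith

end Represents

end Problem

/-! ### Brackets and assembly. -/

theorem fderiv_fst_section {X U Y : Type*} [NormedAddCommGroup X] [NormedSpace ℝ X]
    [NormedAddCommGroup U] [NormedSpace ℝ U] [NormedAddCommGroup Y] [NormedSpace ℝ Y]
    {g : X × U → Y} {x : X} {u : U} (h : DifferentiableAt ℝ g (x, u)) (z : X) :
    fderiv ℝ (fun x' => g (x', u)) x z = fderiv ℝ g (x, u) (z, 0) := by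
  have hd : HasFDerivAt (fun x' => g (x', u)) ((fderiv ℝ g (x, u)).comp (.inl ℝ X U)) x :=
    h.hasFDerivAt.comp x (hasFDerivAt_prodMk_left x u)
  rw [hd.fderiv]
  rfl

namespace Problem

variable {n l m dφ dη : ℕ} {P : Problem n l m dφ dη}

/-- The derivative of `F` in the `j`-th direction of `v` is `f_j`, so `p (D_x f_i) f_j` is the `(i,
j)` entry of `H_vx F_v`, and the bracket measures its failure to be symmetric. Neither side depends
on `v`. -/
theorem bracketX_eq (hreg : P.IsRegular) (i j : Fin m) (x : Vec n) (u : Vec l) (v : Vec m)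
    (q : RowVec n) : q (bracketX (P.f i.succ) (P.f j.succ) x u) =
      mixedForm coordV (fun i => P.f i.succ) q (x, u) (stdVec i)
          (fderiv ℝ P.dyn (x, u, v) (inV (stdVec j)))
        - mixedForm coordV (fun i => P.f i.succ) q (x, u) (stdVec j)
          (fderiv ℝ P.dyn (x, u, v) (inV (stdVec i))) := by
  have hc : ∀ i k : Fin m, coordV k (stdVec i) = if k = i then (1 : ℝ) else 0 := fun i k => by
    simp [coordV_apply]
  have h1 : ∀ i : Fin m, fderiv ℝ P.dyn (x, u, v) (inV (stdVec i)) = P.f i.succ (x, u) :=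
    fun i => by
    refine (fderiv_affineField_inV (c := coordV) (g := fun i : Fin m => P.f i.succ) (hreg.1 0).1
      (fun i => (hreg.1 i.succ).1) _ _).trans ?_
    simp [hc, projXU_apply]
  have h2 : ∀ i z, mixedForm coordV (fun i : Fin m => P.f i.succ) q (x, u) (stdVec i) z =
      q (fderiv ℝ (P.f i.succ) (x, u) (z, 0)) := fun i z => by
    rw [mixedForm_apply]
    simp [hc]
  have h3 : ∀ (i : Fin m) z, fderiv ℝ (fun x' => P.f i.succ (x', u)) x z =
      fderiv ℝ (P.f i.succ) (x, u) (z, 0) := fun i z =>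
    fderiv_fst_section ((hreg.1 i.succ).1.differentiable two_ne_zero (x, u)) z
  rw [bracketX, map_sub, h1, h1, h2, h2, h3, h3]

/-- The second variation along the minimum supplies the coefficients `D`. The costate in `D` is the
modified one, which agrees with `p` on `[0, T]`, where the matrices are compared. -/
theorem exists_represents (hreg : P.IsRegular) (hT : 0 < P.T) {w : Triple n l m}
    (hmin : P.IsWeakMinimum w) (hactive : ∀ i : Fin dφ, P.φ i.succ (w.x 0, w.x P.T) = 0)
    (hu : ContDiffOn ℝ 1 w.u (Icc 0 P.T)) (hv : ContDiffOn ℝ 1 w.v (Icc 0 P.T))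
    {α : Vec (dφ + 1)} {β : Vec dη} {p : ℝ → RowVec n} (hunique : P.IsUniqueMultiplier w α β p) :
    ∃ D : LQCoeffs (Vec n) (Vec l) (Vec m), D.IsNonneg ∧ P.Represents w p D ∧
      ∀ t ∈ Icc 0 P.T, ∀ i j : Fin m,
        p t (bracketX (P.f i.succ) (P.f j.succ) (w.x t) (w.u t)) =
          D.Qvx t (stdVec i) (D.Fv t (stdVec j)) - D.Qvx t (stdVec j) (D.Fv t (stdVec i)) := by
  have hF := hreg.contDiff_dyn
  have htraj := hmin.1.1
  obtain ⟨K, hK⟩ := htraj.1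
  let y : C(Icc 0 P.T, Vec n × Vec l × Vec m) := ⟨fun t => (w.x t, w.u t, w.v t),
    hK.continuousOn.domRestrict.prodMk
      (hu.continuousOn.domRestrict.prodMk hv.continuousOn.domRestrict)⟩
  have hy : ∀ t : Icc 0 P.T, y t = (w.x t, w.u t, w.v t) := fun _ => rfl
  have hyext : ∀ t ∈ Icc 0 P.T, IccExtend hT.le y t = (w.x t, w.u t, w.v t) := fun t ht => by
    rw [IccExtend_of_mem _ _ ht, hy]
  have hun := uniqueDiffOn_Icc hT
  let y' : C(Icc 0 P.T, Vec n × Vec l × Vec m) :=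
    ⟨fun t => (P.dyn (y t), derivWithin w.u (Icc 0 P.T) t, derivWithin w.v (Icc 0 P.T) t),
      (hF.continuous.comp y.continuous).prodMk
        ((hu.continuousOn_derivWithin hun le_rfl).domRestrict.prodMk
          (hv.continuousOn_derivWithin hun le_rfl).domRestrict)⟩
  have hstate := htraj.stateEq_eq_zero hreg hT hy
  have hxt : ∀ t ∈ Icc 0 P.T, w.x t = w.x 0 + ∫ s in (0 : ℝ)..t, P.dyn (IccExtend hT.le y s) :=
    fun t ht => by
    have h : stateOf y - constMap _ (w.x 0) - primitive hT.le (composeLeft P.dyn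
      hF.continuous y) = 0 := hstate
    rw [sub_sub, sub_eq_zero] at h
    exact DFunLike.congr_fun h ⟨t, ht⟩
  have hder : ∀ t ∈ Icc 0 P.T,
      HasDerivWithinAt (IccExtend hT.le y) (IccExtend hT.le y' t) (Icc 0 P.T) t := by
    intro t ht
    have hg : Continuous fun t => P.dyn (IccExtend hT.le y t) :=
      hF.continuous.comp (continuous_extend hT.le y)
    -- The state is assumed to be only Lipschitz; the integral equation with continuous right-hand
    -- side makes it `C¹`.
    have h1 : HasDerivWithinAt w.x (P.dyn (y ⟨t, ht⟩)) (Icc 0 P.T) t := by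
      have h := ((hasDerivAt_integral_of_continuous hg t).const_add (w.x 0)).hasDerivWithinAt
        (s := Icc 0 P.T)
      rw [IccExtend_of_mem _ _ ht] at h
      exact h.congr hxt (hxt t ht)
    have h2 := (hu.differentiableOn one_ne_zero t ht).hasDerivWithinAt
    have h3 := (hv.differentiableOn one_ne_zero t ht).hasDerivWithinAt
    rw [IccExtend_of_mem _ _ ht]
    exact (h1.prodMk (h2.prodMk h3)).congr hyext (hyext t ht)
  obtain ⟨q, q', hqp, hq'c, hqd, hcost⟩ := hunique.1.exists_isCostate hreg hT hy
  let r : Reference (Vec n) (Vec l) (Vec m) (Fin m) :=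
    { T := P.T
      pos := hT
      g₀ := P.f 0
      g := fun i => P.f i.succ
      c := coordV
      contDiff_g₀ := (hreg.1 0).1
      contDiff_g := fun i => (hreg.1 i.succ).1
      y := IccExtend hT.le y
      y' := IccExtend hT.le y'
      p := q
      p' := q'
      continuous_y := continuous_extend hT.le y
      continuous_y' := continuous_extend hT.le y'
      continuous_p := continuous_iff_continuousAt.2 fun t => (hqd t).continuousAt
      continuous_p' := hq'c
      hasDerivWithinAt_y := hder
      hasDerivWithinAt_p := fun t _ => (hqd t).hasDerivWithinAt }
  have hne : (α : Fin (dφ + 1) → ℝ) ≠ 0 ∨ (β : Fin dη → ℝ) ≠ 0 := by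
    by_contra! h0
    have h1 : α = 0 := by ext i; exact congrFun h0.1 i
    have h2 : β = 0 := by ext i; exact congrFun h0.2 i
    have h3 := hunique.1.nontrivial
    rw [h1, h2, norm_zero, norm_zero, add_zero] at h3
    exact zero_ne_one h3
  have hnonneg : r.lqCoeffs.IsNonneg := by
    refine r.isNonneg y (fun t => (IccExtend_val hT.le y t).symm) fun z hz hzT => ?_
    exact second_variation_nonneg hT hF hreg.contDiff_φ hreg.contDiff_η hstate
      (fun j => by rw [endpoints_eq hT hy]; exact hmin.1.2.1 j) hunique.1.nonneg hne hcost
      (fun α' β' p' => hunique.exists_smul hreg hT hy α' β' p')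
      (hmin.not_decreasing hreg hT hy hactive) hz hzT
  refine ⟨r.lqCoeffs, hnonneg, ?_, fun t ht i j => ?_⟩
  · refine ⟨rfl, fun t ht a b => ?_, fun t ht a b => ?_, fun t ht a b => ?_, fun t ht a b => ?_,
      fun t ht a b => ?_, fun t ht a b => ?_, fun t ht a b => ?_, fun t x x' => ?_,
      fun t u u' => ?_, r.hasDerivWithinAt_Fv, r.hasDerivWithinAt_Qvx⟩
    · rw [hreg.Fx_apply, ← hyext t ht]; rfl
    · rw [hreg.Fu_apply, ← hyext t ht]; rfl
    · rw [hreg.Fv_apply, ← hyext t ht]; rfl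
    · rw [hreg.Hxx_apply, ← hyext t ht, ← hqp ht]; rfl
    · rw [hreg.Hux_apply, ← hyext t ht, ← hqp ht]; rfl
    · rw [hreg.Huu_apply, ← hyext t ht, ← hqp ht]; rfl
    · rw [hreg.Hvx_apply, ← hyext t ht, ← hqp ht]
      exact (r.mixedForm_eq (q t) (IccExtend hT.le y t) (stdVec a) (stdVec b)).symm
    · exact congrArg (q t) (r.symm _ _ _)
    · exact congrArg (q t) (r.symm _ _ _)
  · rw [bracketX_eq hreg i j _ _ (w.v t), ← hyext t ht, ← hqp ht]
    have h : (w.x t, w.u t) = projXU (IccExtend hT.le y t) := by rw [hyext t ht]; rfl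
    rw [h]
    rfl

end Problem

end SingularOC

end

theorem mainTheorem8 {n l m dφ dη : ℕ} (P : SingularOC.Problem n l m dφ dη) (hT : 0 < P.T)
    (hreg : P.IsRegular) (w : SingularOC.Triple n l m) (hmin : P.IsWeakMinimum w)
    (hactive : ∀ i : Fin dφ, P.φ i.succ (w.x 0, w.x P.T) = 0)
    (hu : ContDiffOn ℝ 1 w.u (Set.Icc 0 P.T)) (hv : ContDiffOn ℝ 1 w.v (Set.Icc 0 P.T))
    (α : SingularOC.Vec (dφ + 1)) (β : SingularOC.Vec dη) (p : ℝ → SingularOC.RowVec n)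
    (hunique : P.IsUniqueMultiplier w α β p) :
    (∀ t ∈ Set.Icc 0 P.T,
      P.V w p t = 0 ∧ (P.Hvx w p t * P.Fv w t).IsSymm ∧
        ∀ i j : Fin m,
          p t (SingularOC.bracketX (P.f i.succ) (P.f j.succ) (w.x t) (w.u t)) = 0) ∧
    (∀ t ∈ Set.Icc 0 P.T,
      (Matrix.fromBlocks (P.Huu w p t) (P.E w p t).transpose (P.E w p t)
        (P.R w p t)).PosSemidef) := by
  obtain ⟨D, hD, hrep, hbr⟩ :=
    SingularOC.Problem.exists_represents hreg hT hmin hactive hu hv hunique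
  refine ⟨fun t ht => ?_, fun t ht => hrep.posSemidef ht hD⟩
  have hsymm := hrep.isSymm_hvx_mul_fv ht hD
  refine ⟨?_, hsymm, fun i j => ?_⟩
  · rw [SingularOC.Problem.V, hsymm.eq, sub_self, smul_zero]
  · rw [hbr t ht, hD.symm_of_mem_Icc (hrep.time.symm ▸ ht), sub_self]
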